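/- **Setting.** Let $N\ge 0$, $C_N\mathbb C=\{(z_1,\dots,z_N)\in\mathbb C^N: z_i\ne z_j\text{ for }i\ne j\}$ and $X_N=C_N\mathbb C/S_N$. A chord $P=|ij\rangle=|ji\rangle$ is an unordered pair of distinct indices in $\{1,\dots,N\}$, and $\Delta z[P]=z_i-z_j$ (its $d\log$ does not depend on the sign). Let $\overline{\mathcal A}(X_N)=\bigl(C_N\mathbb C\times\mathbb C[[\,|ij\rangle: i<j\,]]\bigr)/S_N\to X_N$ be the bundle of completed algebras of chord diagrams based at points of $X_N$, where $S_N$ permutes points and chords simultaneously, with the KZ connection $\nabla=d-\omega$, $\omega=\frac1{2\pi i}\sum_{P}|P\rangle\,d\log\Delta z[P]$. For an oriented compact one-dimensional manifold $X$ with numbered components, $\mathcal A^{(m)}(X)$ is the complex vector space spanned by chord diagrams with $m$ chords on $X$, modulo the 4-T relation and the framing independence relation, and $\overline{\mathcal A}(X)=\prod_m\mathcal A^{(m)}(X)$. For a tangle or link cut at its critical points into monotone strands, the Kontsevich integral is $$Z=\sum_{m\ge0}\frac1{(2\pi i)^m}\sum_{P=(P_1,\dots,P_m)}\Bigl(\int_{t_1<\dots<t_m}(-1)^{\varepsilon(P)}\prod_{k}d\log\Delta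 z[P_k](t_k)\Bigr)D_P ,$$ where each $P_k$ is an unordered pair of distinct strands, the chord $P_k$ being horizontal at height $t_k$ (there is no contribution from heights at which one of the two strands is absent), $\varepsilon(P)$ is the number of chord feet on strands oriented downwards, and $D_P$ is the resulting chord diagram on the underlying one-manifold. A pairing with $D_P=0$ contributes $0$. Let $\gamma:[0,1]\to X_N$ be a loop having a $C^1$ lift $z=(z_1,\dots,z_N):[0,1]\to C_N\mathbb C$, and let $s\in S_N$ be the permutation with $z_i(1)=z_{s(i)}(0)$. Let $\tilde\gamma\subset\mathbb C\times[0,1]$ be the geometric braid with strands $t\mapsto(z_i(t),t)$, oriented upwards. **Theorem.** 1. (Holonomy.) Let $h=\exp\bigl(\int_I\omega(\gamma)\bigr)$. For every $\psi_0$ there is a unique section $\Psi$ of $\overline{\mathcal A}(X_N)$ along $\gamma$ that is horizontal for the KZ connection and starts at $\Psi(0)=[z(0),\psi_0]$, and $\Psi(1)=[z(1),h\,\psi_0]$. 2. (Expansion.) For each $m$, the part of degree $m$ of $h$ is $\sum_{P_1,\dots,P_m}I(P)\,|P_1\rangle\cdots|P_m\rangle$, where $$I(P)=\frac1{(2\pi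 i)^m}\int_{0\le t_1<\dots<t_m\le1}\prod_{k}d\log\Delta z[P_k](\gamma(t_k)).$$ 3. (Lifting to the braid.) Let $\tilde h_m=\sum_{P_1,\dots,P_m}I(P)\,|P\rangle(\tilde\gamma)\in\mathcal A^{(m)}(\tilde\gamma)$, where $|P\rangle(\tilde\gamma)$ is the braid $\tilde\gamma$ with the chords $P_1,\dots,P_m$ placed on it from bottom to top, and $\tilde h=(\tilde h_m)_m$. Then $\tilde h$ is the Kontsevich integral of the braid $\tilde\gamma$. 4. (Closing the strands of the braid.) Gluing the top of the $i$-th strand to the bottom of the $s(i)$-th strand, and mapping to chord diagrams on $\coprod S^1$ (one circle for each cycle of $s$), sends $\tilde h$ to the Kontsevich integral of the closed braid, that is, to the formula for $Z$ above with the strands of $\tilde\gamma$ as strands and with $D_P$ the chord diagram on $\coprod S^1$. 5. (The closure as a Morse link.) Suppose that $\gamma$ is based at $\{0,1,\dots,N-1\}$, labelled in this order. For $R>0$ let $L_R$ be the closure of $\tilde\gamma$ by $N$ parallel arcs: the $n$-th arc lies in $\{\operatorname{Re}=n\}\times\mathbb R$ and goes from the top $(n,1)$ of the braid to the bottom $(n,0)$.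 At height $t\in[-1,0]\cup[1,2]$ its two points have complex coordinates $n+\frac{R}{2}i\pm\frac R2\sqrt{1+t}\,i$, respectively $n+\frac R2 i\pm\frac R2\sqrt{2-t}\,i$, and over $[0,1]$ it is the vertical line over $n+Ri$, oriented downwards. Let $c_R:\overline{\mathcal A}(\tilde\gamma)\to\overline{\mathcal A}(\coprod S^1)$ be the linear closing map that grafts on the contributions of the top and bottom portions of the closure: on a diagram $D$, $$c_R(D)=\sum_{Q,Q'}\frac{1}{(2\pi i)^{|Q|+|Q'|}}\Bigl(\int_{-1<t_1<\dots<t_{|Q|}<0}(-1)^{\varepsilon(Q)}\prod d\log\Delta z[Q_k]\Bigr)\Bigl(\int_{1<t_1<\dots<t_{|Q'|}<2}(-1)^{\varepsilon(Q')}\prod d\log\Delta z[Q'_k]\Bigr)\,[\,Q\cdot D\cdot Q'\,],$$ where $Q,Q'$ run over all pairings between the legs of the closing arcs, and $[Q\cdot D\cdot Q']$ is the chord diagram on $\coprod S^1$ with the chords $Q$ near the minima, those of $D$ on the braid and the chords $Q'$ near the maxima. It depends on $\gamma$ only through $s$. Then in each degree $m$, for all sufficiently large $R$: the strands of $L_R$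 are disjoint at all heights in $(-1,2)$; the integrals in $Z(L_R)$ and $c_R$ whose chord diagrams, respectively whose grafting maps $D\mapsto[Q\cdot D\cdot Q']$, do not vanish converge absolutely; and $$Z(L_R)_m=c_R(\tilde h)_m+\Lambda_{R,m},$$ where $\Lambda_{R,m}$ is the part of $Z(L_R)_m$ coming from pairings and heights with at least one chord, at a height in $(0,1)$, having a foot on a strand in the back of the closure. Moreover $\Lambda_{R,m}\to0$ as $R\to\infty$, in the sense that $W(\Lambda_{R,m})\to0$ for every linear functional $W$ on $\mathcal A^{(m)}(\coprod S^1)$. -/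

import Mathlib

open Set Filter Topology MeasureTheory

noncomputable section

/-! ### Configuration spaces of points in the plane -/

/-- `C_N ℂ = ℂ^N - Δ`, the space of `N` distinct ordered points of the plane. -/
abbrev Conf (N : ℕ) : Type := {Z : Fin N → ℂ // Function.Injective Z}

/-- Two ordered configurations are identified when they differ by a relabelling of the points. -/
instance confSetoid (N : ℕ) : Setoid (Conf N) where
  r Z W := ∃ s : Equiv.Perm (Fin N), ∀ i, W.1 (s i) = Z.1 i
  iseqv :=
    { refl := fun _ => ⟨1, fun _ => rfl⟩
      symm := by
        rintro Z W ⟨s, h⟩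
        exact ⟨s⁻¹, fun i => by rw [← h (s⁻¹ i)]; simp⟩
      trans := by
        rintro Z W V ⟨s, h⟩ ⟨r, k⟩
        exact ⟨r * s, fun i => by rw [Equiv.Perm.mul_apply, k, h]⟩ }

/-- `X_N = (ℂ^N - Δ) / S_N`, with the quotient topology. -/
abbrev UConf (N : ℕ) : Type := Quotient (confSetoid N)

/-! ### The bundle of chord diagrams based at points of `X_N` and its KZ connection -/

/-- A chord between two distinct elements of the index set `ι`: `|ij⟩ = |ji⟩`, `i ≠ j`. -/
abbrev Chord (ι : Type) : Type := {e : Sym2 ι // ¬ e.IsDiag}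

instance (ι : Type) [Finite ι] : Finite (Chord ι) :=
  have : Finite (Sym2 ι) := Quot.finite _
  inferInstance

instance (ι : Type) [Finite ι] : Fintype (Chord ι) := Fintype.ofFinite _

/-- `|ij⟩ ↦ |σ(i)σ(j)⟩`. -/
def Chord.perm {ι : Type} (s : Equiv.Perm ι) (P : Chord ι) : Chord ι :=
  ⟨Sym2.map s P.1, fun h => P.2 ((Sym2.isDiag_map s.injective).1 h)⟩

/-- The graded completed algebra `ℂ[[ |ij⟩ : i < j ]]` of chord diagrams with support a point of
`C_N ℂ`: the fibre of the bundle. -/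
abbrev ChordSeries (N : ℕ) : Type := MvPowerSeries (Chord (Fin N)) ℂ

/-- The action of the symmetric group on chord diagrams with support a configuration. -/
def permSeries {N : ℕ} (s : Equiv.Perm (Fin N)) (f : ChordSeries N) : ChordSeries N :=
  MvPowerSeries.rename (Chord.perm s) f

theorem Chord.perm_one {ι : Type} : Chord.perm (1 : Equiv.Perm ι) = id := by
  funext P; ext1; simp [Chord.perm]

theorem Chord.perm_mul {ι : Type} (s r : Equiv.Perm ι) :
    Chord.perm (s * r) = Chord.perm s ∘ Chord.perm r := by
  funext P; ext1; simp [Chord.perm, Sym2.map_map]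

theorem permSeries_one {N : ℕ} (f : ChordSeries N) : permSeries 1 f = f := by
  simp [permSeries, Chord.perm_one]

theorem permSeries_mul {N : ℕ} (s r : Equiv.Perm (Fin N)) (f : ChordSeries N) :
    permSeries (s * r) f = permSeries s (permSeries r f) := by
  simp [permSeries, Chord.perm_mul, MvPowerSeries.rename_rename]

/-- The diagonal action of `S_N` on the trivial bundle over `C_N ℂ`. -/
instance bundleSetoid (N : ℕ) : Setoid (Conf N × ChordSeries N) where
  r p q := ∃ s : Equiv.Perm (Fin N), (∀ i, q.1.1 (s i) = p.1.1 i) ∧ q.2 = permSeries s p.2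
  iseqv :=
    { refl := fun p => ⟨1, fun _ => rfl, (permSeries_one p.2).symm⟩
      symm := by
        rintro p q ⟨s, h, h'⟩
        refine ⟨s⁻¹, fun i => by rw [← h (s⁻¹ i)]; simp, ?_⟩
        rw [h', ← permSeries_mul, inv_mul_cancel, permSeries_one]
      trans := by
        rintro p q v ⟨s, h, h'⟩ ⟨r, k, k'⟩
        refine ⟨r * s, fun i => by rw [Equiv.Perm.mul_apply, k, h], ?_⟩
        rw [k', h', ← permSeries_mul] }

/-- The total space of the bundle of (completed) chord diagrams over `X_N`. -/
abbrev ChordBundle (N : ℕ) : Type := Quotient (bundleSetoid N)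

/-- The bundle projection. -/
def ChordBundle.proj {N : ℕ} : ChordBundle N → UConf N :=
  Quotient.map Prod.fst (by rintro p q ⟨s, h, -⟩; exact ⟨s, h⟩)

/-- The value of `d log (z_i - z_j)` at `Z` on the tangent vector `v`. -/
def dlogDiff {ι : Type} (Z v : ι → ℂ) (P : Chord ι) : ℂ :=
  Sym2.lift ⟨fun i j => (v i - v j) / (Z i - Z j), fun i j => by
    show (v i - v j) / (Z i - Z j) = (v j - v i) / (Z j - Z i)
    rw [← neg_sub (v j), ← neg_sub (Z j), neg_div_neg_eq]⟩ P.1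

/-- The KZ connection form `ω = (1 / 2πi) ∑_P |P⟩ dlog Δz[P]`, at `Z`, on the tangent vector `v`. -/
def kzForm {N : ℕ} (Z v : Fin N → ℂ) : ChordSeries N :=
  ∑ P : Chord (Fin N),
    MvPowerSeries.C ((2 * Real.pi * Complex.I)⁻¹ * dlogDiff Z v P) * MvPowerSeries.X P

/-- `z` is, on the unit interval, a continuously differentiable lift to `C_N ℂ` of the path `γ`
of `X_N` (the values of `z` outside of the unit interval play no role). -/
def IsC1Lift {N : ℕ} {x y : UConf N} (γ : Path x y) (z : ℝ → Conf N) : Prop :=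
  ContDiffOn ℝ 1 (fun t => (z t).1) (Icc 0 1) ∧ ∀ t : unitInterval, γ t = ⟦z t⟧

/-- The velocity of a lift. -/
def velocity {N : ℕ} (z : ℝ → Conf N) (t : ℝ) : Fin N → ℂ :=
  derivWithin (fun u => (z u).1) (Icc 0 1) t

/-- `Ψ` is a section of the bundle along `γ` that is horizontal for the KZ connection
`∇ = d - ω`: over a lift of `γ` it is given by a series `ψ` with `dψ/dt = ω(dγ/dt) ψ`. -/
def IsHorizontal {N : ℕ} {x y : UConf N} (γ : Path x y) (Ψ : unitInterval → ChordBundle N) :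
    Prop :=
  ∃ (z : ℝ → Conf N) (ψ : ℝ → ChordSeries N), IsC1Lift γ z ∧
    (∀ t : unitInterval, Ψ t = ⟦(z t, ψ t)⟧) ∧
    ∀ t ∈ Icc (0 : ℝ) 1, ∀ d : Chord (Fin N) →₀ ℕ,
      HasDerivWithinAt (fun u => MvPowerSeries.coeff d (ψ u))
        (MvPowerSeries.coeff d (kzForm (z t).1 (velocity z t) * ψ t)) (Icc 0 1) t

/-- `∫_I ω(γ)`, computed coefficient by coefficient. -/
def kzIntegral {N : ℕ} (z : ℝ → Conf N) : ChordSeries N :=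
  fun d => ∫ t in (0 : ℝ)..1, MvPowerSeries.coeff d (kzForm (z t).1 (velocity z t))

/-- `exp (∫_I ω(γ))`. -/
def kzExp {N : ℕ} (z : ℝ → Conf N) : ChordSeries N :=
  (PowerSeries.exp ℂ).subst (kzIntegral z)

/-! ### Chord diagrams on one-dimensional manifolds -/

/-- Inserting a letter `b` just after, minus just before, each occurrence of `a` in a word. -/
def insertionSum {M : Type} [AddCommGroup M] (a b : ℕ) : List ℕ → (List ℕ → M) → M
  | [], _ => 0
  | x :: u, f =>
      (if x = a then f (a :: b :: u) - f (b :: a :: u) else 0) +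
        insertionSum a b u (fun v => f (x :: v))

/-- A chord diagram of degree `m` on an oriented one-dimensional manifold with components indexed
by `κ` is encoded by a word for each component: the labels of the chords, in the order in which
their feet are met along the component (starting anywhere on a circle). Each label is met twice
or not at all, and there are `2 m` feet. -/
def IsChordWord {κ : Type} [Fintype κ] (m : ℕ) (w : κ → List ℕ) : Prop :=
  (∀ l, ∑ k, (w k).count l = 0 ∨ ∑ k, (w k).count l = 2) ∧ ∑ k, (w k).length = 2 * m

open Classical in
/-- The relations between words defining `𝒜^(m)(X)`, where `X` has components `κ`, those in `C`
being circles and the other ones intervals: words that do not encode a chord diagram of degree `m`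
are discarded, labels of chords are immaterial, as is the starting point on a circle; then the 4-T
relation and the framing independence relation. -/
inductive ChordRel {κ : Type} [Fintype κ] (C : Set κ) (m : ℕ) : ((κ → List ℕ) →₀ ℂ) → Prop
  | discard (w : κ → List ℕ) (h : ¬ IsChordWord m w) : ChordRel C m (Finsupp.single w 1)
  | relabel (w : κ → List ℕ) (r : Equiv.Perm ℕ) :
      ChordRel C m (Finsupp.single w 1 - Finsupp.single (fun k => (w k).map r) 1)
  | rotate (w : κ → List ℕ) (k : κ) (l : ℕ) (u : List ℕ) (hk : k ∈ C) (h : w k = l :: u) :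
      ChordRel C m (Finsupp.single w 1 - Finsupp.single (Function.update w k (u ++ [l])) 1)
  | fourTerm (w : κ → List ℕ) (a b : ℕ) (h : a ≠ b) :
      ChordRel C m
        (∑ k, insertionSum a b (w k) fun u => Finsupp.single (Function.update w k u) (1 : ℂ))
  | isolated (w : κ → List ℕ) (k : κ) (u v : List ℕ) (l : ℕ) (h : w k = u ++ l :: l :: v) :
      ChordRel C m (Finsupp.single w 1)

/-- The span of the relations. -/
def chordRelSpan {κ : Type} [Fintype κ] (C : Set κ) (m : ℕ) : Submodule ℂ ((κ → List ℕ) →₀ ℂ) :=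
  Submodule.span ℂ {x | ChordRel C m x}

/-- `𝒜^(m)(X)`, the space of chord diagrams of degree `m` on the one-dimensional manifold `X` with
components `κ`, of which those in `C` are circles and the other ones are intervals. The graded
completion of `𝒜(X)` is the product of these spaces over all `m`. -/
abbrev ChordSpace {κ : Type} [Fintype κ] (C : Set κ) (m : ℕ) : Type :=
  ((κ → List ℕ) →₀ ℂ) ⧸ chordRelSpan C m

/-- The class of a word. -/
def chordDiagram {κ : Type} [Fintype κ] (C : Set κ) (m : ℕ) (w : κ → List ℕ) : ChordSpace C m :=
  (chordRelSpan C m).mkQ (Finsupp.single w 1)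

/-! ### Gluing chord diagrams

A manifold with components `κ` is obtained by juxtaposing pieces: components of a manifold with
components `ι`, and intervals that already carry chord feet. -/

/-- The word on one piece. -/
def pieceWord {ι : Type} (r : ℕ ↪ ℕ) (w : ι → List ℕ) : ι ⊕ List ℕ → List ℕ
  | Sum.inl i => (w i).map r
  | Sum.inr u => u

/-- The word on a juxtaposition of pieces. -/
def glueWord {ι κ : Type} (pieces : κ → List (ι ⊕ List ℕ)) (r : ℕ ↪ ℕ) (w : ι → List ℕ) :
    κ → List ℕ :=
  fun k => (pieces k).flatMap (pieceWord r w)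

/-- The number of feet on a piece before anything is placed on the components `ι`. -/
def pieceFeet {ι : Type} : ι ⊕ List ℕ → ℕ
  | Sum.inl _ => 0
  | Sum.inr u => u.length

/-- Each component occurs once, the pieces carry `2 d` feet with labels that are not used. -/
structure IsGluing {ι κ : Type} [Fintype ι] [Fintype κ] (pieces : κ → List (ι ⊕ List ℕ))
    (r : ℕ ↪ ℕ) (d : ℕ) : Prop where
  nodup : ∀ k, ((pieces k).filterMap Sum.getLeft?).Nodup
  once : ∃ c : ι → κ, ∀ i k, Sum.inl i ∈ pieces k ↔ c i = k
  fresh : ∀ k u, Sum.inr u ∈ pieces k → ∀ l, r l ∉ u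
  feet : ∑ k, ((pieces k).map pieceFeet).sum = 2 * d

theorem insertionSum_append {M : Type} [AddCommGroup M] (a b : ℕ) (u v : List ℕ)
    (f : List ℕ → M) :
    insertionSum a b (u ++ v) f =
      insertionSum a b u (fun x => f (x ++ v)) + insertionSum a b v (fun x => f (u ++ x)) := by
  induction u generalizing f with
  | nil => simp [insertionSum]
  | cons x u ih => simp only [List.cons_append, insertionSum, ih, add_assoc]

theorem insertionSum_fresh {M : Type} [AddCommGroup M] (a b : ℕ) (u : List ℕ) (f : List ℕ → M)
    (h : a ∉ u) : insertionSum a b u f = 0 := by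
  induction u generalizing f with
  | nil => rfl
  | cons x u ih =>
    simp only [List.mem_cons, not_or] at h
    simp [insertionSum, ih _ h.2, Ne.symm h.1]

theorem insertionSum_map {M : Type} [AddCommGroup M] (r : ℕ ↪ ℕ) (a b : ℕ) (u : List ℕ)
    (f : List ℕ → M) :
    insertionSum (r a) (r b) (u.map r) f = insertionSum a b u (fun x => f (x.map r)) := by
  induction u generalizing f with
  | nil => rfl
  | cons x u ih => simp [insertionSum, ih]

theorem map_insertionSum {M M' : Type} [AddCommGroup M] [AddCommGroup M'] (g : M →+ M') (a b : ℕ)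
    (u : List ℕ) (f : List ℕ → M) :
    g (insertionSum a b u f) = insertionSum a b u (fun x => g (f x)) := by
  induction u generalizing f with
  | nil => simp [insertionSum]
  | cons x u ih =>
    simp only [insertionSum, map_add, ih]
    split_ifs <;> simp

theorem flatMap_update_of_notMem {ι : Type} [DecidableEq ι] (r : ℕ ↪ ℕ) (w : ι → List ℕ) (i : ι)
    (x : List ℕ) (L : List (ι ⊕ List ℕ)) (h : Sum.inl i ∉ L) :
    L.flatMap (pieceWord r (Function.update w i x)) = L.flatMap (pieceWord r w) := by
  induction L with
  | nil => rfl
  | cons p L ih =>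
    simp only [List.mem_cons, not_or] at h
    simp only [List.flatMap_cons, ih h.2]
    congr 1
    rcases p with j | u
    · have : j ≠ i := fun e => h.1 (by rw [e])
      simp [pieceWord, Function.update_of_ne this]
    · rfl

theorem insertionSum_flatMap {ι M : Type} [DecidableEq ι] [AddCommGroup M] (r : ℕ ↪ ℕ)
    (w : ι → List ℕ) (a b : ℕ) (L : List (ι ⊕ List ℕ)) (f : List ℕ → M)
    (hn : (L.filterMap Sum.getLeft?).Nodup) (hf : ∀ u, Sum.inr u ∈ L → r a ∉ u) :
    insertionSum (r a) (r b) (L.flatMap (pieceWord r w)) f =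
      ((L.filterMap Sum.getLeft?).map fun i => insertionSum a b (w i) fun x =>
        f (L.flatMap (pieceWord r (Function.update w i x)))).sum := by
  induction L generalizing f with
  | nil => rfl
  | cons p L ih =>
    rw [List.flatMap_cons, insertionSum_append]
    rcases p with i | u
    · rw [List.filterMap_cons_some (b := i) (by rfl)] at hn ⊢
      rw [List.nodup_cons] at hn
      have hi : Sum.inl i ∉ L := fun h => hn.1 (List.mem_filterMap.2 ⟨_, h, rfl⟩)
      rw [List.map_cons, List.sum_cons, ih _ hn.2 fun u hu => hf u (List.mem_cons_of_mem _ hu)]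
      congr 1
      · simp only [pieceWord, insertionSum_map, List.flatMap_cons, Function.update_self,
          flatMap_update_of_notMem r w i _ L hi]
      · congr 1
        refine List.map_congr_left fun j hj => ?_
        have : i ≠ j := fun e => hn.1 (e ▸ hj)
        simp [pieceWord, Function.update_of_ne this]
    · rw [List.filterMap_cons_none (by rfl)] at hn ⊢
      rw [ih _ hn fun u hu => hf u (List.mem_cons_of_mem _ hu),
        insertionSum_fresh _ _ _ _ (by simpa [pieceWord] using hf u (List.mem_cons_self ..)), zero_add]
      rfl

/-- A sum over all pieces is a sum over the components and the other pieces. -/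
theorem IsGluing.sum {ι κ : Type} [Fintype ι] [Fintype κ] {pieces : κ → List (ι ⊕ List ℕ)}
    {r : ℕ ↪ ℕ} {d : ℕ} (h : IsGluing pieces r d) {M : Type} [AddCommMonoid M] (F : ι → M) :
    ∑ k, (((pieces k).filterMap Sum.getLeft?).map F).sum = ∑ i, F i := by
  classical
  obtain ⟨c, hc⟩ := h.once
  rw [← Finset.sum_fiberwise Finset.univ c F]
  refine Finset.sum_congr rfl fun k _ => ?_
  rw [← List.sum_toFinset F (h.nodup k)]
  refine Finset.sum_congr ?_ fun _ _ => rfl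
  ext i
  simp only [List.mem_toFinset, List.mem_filterMap, Finset.mem_filter, Finset.mem_univ, true_and]
  rw [← hc]
  constructor
  · rintro ⟨p, hp, e⟩
    rcases p with j | u
    · simp only [Sum.getLeft?_inl, Option.some.injEq] at e
      exact e ▸ hp
    · simp at e
  · exact fun hp => ⟨_, hp, rfl⟩

theorem length_flatMap_pieceWord {ι : Type} (r : ℕ ↪ ℕ) (w : ι → List ℕ)
    (L : List (ι ⊕ List ℕ)) :
    (L.flatMap (pieceWord r w)).length =
      ((L.filterMap Sum.getLeft?).map fun i => (w i).length).sum + (L.map pieceFeet).sum := by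
  induction L with
  | nil => rfl
  | cons p L ih =>
    rcases p with i | u
    · rw [List.filterMap_cons_some (b := i) (by rfl)]
      simp [List.flatMap_cons, ih, pieceWord, pieceFeet, add_assoc]
    · rw [List.filterMap_cons_none (by rfl)]
      simp only [List.flatMap_cons, ih, pieceWord, pieceFeet, List.length_append, List.map_cons,
        List.sum_cons]
      omega

theorem count_flatMap_pieceWord {ι : Type} (r : ℕ ↪ ℕ) (w : ι → List ℕ) (l : ℕ)
    (L : List (ι ⊕ List ℕ)) (hf : ∀ u, Sum.inr u ∈ L → r l ∉ u) :
    (L.flatMap (pieceWord r w)).count (r l) =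
      ((L.filterMap Sum.getLeft?).map fun i => (w i).count l).sum := by
  induction L with
  | nil => rfl
  | cons p L ih =>
    have ih' := ih fun u hu => hf u (List.mem_cons_of_mem _ hu)
    rcases p with i | u
    · rw [List.filterMap_cons_some (b := i) (by rfl)]
      simp [List.flatMap_cons, ih', pieceWord, List.count_map_of_injective _ _ r.injective]
    · rw [List.filterMap_cons_none (by rfl)]
      simp [List.flatMap_cons, ih', pieceWord, List.count_eq_zero.2 (hf u (List.mem_cons_self ..))]

theorem IsGluing.chordWord {ι κ : Type} [Fintype ι] [Fintype κ] {pieces : κ → List (ι ⊕ List ℕ)}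
    {r : ℕ ↪ ℕ} {d m n : ℕ} (h : IsGluing pieces r d) (hm : m + d = n) (w : ι → List ℕ)
    (hw : IsChordWord n (glueWord pieces r w)) : IsChordWord m w := by
  refine ⟨fun l => ?_, ?_⟩
  · have := hw.1 (r l)
    simp only [glueWord, fun k => count_flatMap_pieceWord r w l (pieces k)
      (fun u hu => h.fresh k u hu l), h.sum] at this
    exact this
  · have := hw.2
    simp only [glueWord, length_flatMap_pieceWord, Finset.sum_add_distrib, h.sum, h.feet] at this
    omega

theorem glueWord_update {ι κ : Type} [Fintype ι] [Fintype κ] [DecidableEq ι] [DecidableEq κ]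
    {pieces : κ → List (ι ⊕ List ℕ)} {r : ℕ ↪ ℕ} {d : ℕ} (h : IsGluing pieces r d)
    (w : ι → List ℕ) (i : ι) (k : κ) (hi : Sum.inl i ∈ pieces k) (x : List ℕ) :
    glueWord pieces r (Function.update w i x) =
      Function.update (glueWord pieces r w) k
        ((pieces k).flatMap (pieceWord r (Function.update w i x))) := by
  obtain ⟨c, hc⟩ := h.once
  funext j
  by_cases hj : j = k
  · subst hj; simp [glueWord]
  · rw [Function.update_of_ne hj]
    exact flatMap_update_of_notMem r w i x _ fun h' =>
      hj (((hc i j).1 h').symm.trans ((hc i k).1 hi))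

theorem glueWord_relabel {ι κ : Type} [Fintype ι] [Fintype κ] {pieces : κ → List (ι ⊕ List ℕ)}
    {r : ℕ ↪ ℕ} {d : ℕ} (h : IsGluing pieces r d) (w : ι → List ℕ) (s : Equiv.Perm ℕ) :
    glueWord pieces r (fun i => (w i).map s) =
      fun k => (glueWord pieces r w k).map (s.viaEmbedding r) := by
  funext k
  simp only [glueWord, List.map_flatMap]
  refine List.flatMap_congr fun p hp => ?_
  rcases p with i | u
  · simp only [pieceWord, List.map_map]
    refine List.map_congr_left fun l _ => ?_
    simp [Equiv.Perm.viaEmbedding_apply]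
  · simp only [pieceWord]
    have : u.map (s.viaEmbedding r) = u.map id := List.map_congr_left fun l hl =>
      Equiv.Perm.viaEmbedding_apply_of_notMem s r l (by
        rintro ⟨l', rfl⟩
        exact h.fresh k u hp l' hl)
    rw [this, List.map_id]

/-- Gluing is compatible with the relations between chord diagrams. -/
theorem IsGluing.le_comap {ι κ : Type} [Fintype ι] [Fintype κ] {pieces : κ → List (ι ⊕ List ℕ)}
    {r : ℕ ↪ ℕ} {d m n : ℕ} (h : IsGluing pieces r d) (hm : m + d = n) (C : Set κ) :
    chordRelSpan (∅ : Set ι) m ≤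
      (chordRelSpan C n).comap (Finsupp.lmapDomain ℂ ℂ (glueWord pieces r)) := by
  classical
  refine Submodule.span_le.2 fun x hx => ?_
  rw [SetLike.mem_coe, Submodule.mem_comap]
  cases hx with
  | discard w hw =>
    simp only [Finsupp.lmapDomain_apply, Finsupp.mapDomain_single]
    exact Submodule.subset_span (.discard _ fun h' => hw (h.chordWord hm w h'))
  | relabel w s =>
    simp only [map_sub, Finsupp.lmapDomain_apply, Finsupp.mapDomain_single, glueWord_relabel h]
    exact Submodule.subset_span (.relabel _ _)
  | rotate w k l u hk _ => exact hk.elim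
  | fourTerm w a b hab =>
    have key : Finsupp.lmapDomain ℂ ℂ (glueWord pieces r)
        (∑ i, insertionSum a b (w i) fun u => Finsupp.single (Function.update w i u) (1 : ℂ)) =
        ∑ k, insertionSum (r a) (r b) (glueWord pieces r w k) fun u =>
          Finsupp.single (Function.update (glueWord pieces r w) k u) (1 : ℂ) := by
      rw [map_sum, ← h.sum]
      refine Finset.sum_congr rfl fun k _ => ?_
      rw [glueWord, insertionSum_flatMap r w a b _ _ (h.nodup k) fun u hu => h.fresh k u hu a]
      congr 1
      refine List.map_congr_left fun i hi => ?_
      have hi' : Sum.inl i ∈ pieces k := by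
        obtain ⟨p, hp, e⟩ := List.mem_filterMap.1 hi
        rcases p with j | u
        · simp only [Sum.getLeft?_inl, Option.some.injEq] at e
          exact e ▸ hp
        · simp at e
      have := map_insertionSum (Finsupp.lmapDomain ℂ ℂ (glueWord pieces r)).toAddMonoidHom a b
        (w i) fun u => Finsupp.single (Function.update w i u) (1 : ℂ)
      refine this.trans ?_
      congr 1
      funext u
      simp [Finsupp.mapDomain_single, glueWord_update h w i k hi' u]
    have h2 : ChordRel C n (∑ k, insertionSum (r a) (r b) (glueWord pieces r w k) fun u =>
          Finsupp.single (Function.update (glueWord pieces r w) k u) (1 : ℂ)) := by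
      have := ChordRel.fourTerm (C := C) (m := n) (glueWord pieces r w) (r a) (r b)
        (r.injective.ne hab)
      convert this
    have key' : (∑ i, insertionSum a b (w i) fun u => Finsupp.single
          (@Function.update ι (fun _ => List ℕ) (Classical.propDecidable <| · = ·) w i u) (1 : ℂ)) =
        ∑ i, insertionSum a b (w i) fun u => Finsupp.single (Function.update w i u) (1 : ℂ) := by
      congr!
    rw [key', key]
    exact Submodule.subset_span h2
  | isolated w i u v l hw =>
    simp only [Finsupp.lmapDomain_apply, Finsupp.mapDomain_single]
    obtain ⟨c, hc⟩ := h.once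
    obtain ⟨A, B, hAB⟩ := List.append_of_mem ((hc i (c i)).2 rfl)
    refine Submodule.subset_span (.isolated _ (c i)
      (A.flatMap (pieceWord r w) ++ u.map r) (v.map r ++ B.flatMap (pieceWord r w)) (r l) ?_)
    simp [glueWord, hAB, pieceWord, hw]

/-- Gluing intervals, some of which already carry chord feet. -/
def glueMap {ι κ : Type} [Fintype ι] [Fintype κ] {pieces : κ → List (ι ⊕ List ℕ)}
    {r : ℕ ↪ ℕ} {d m n : ℕ} (h : IsGluing pieces r d) (hm : m + d = n) (C : Set κ) :
    ChordSpace (∅ : Set ι) m →ₗ[ℂ] ChordSpace C n :=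
  Submodule.mapQ _ _ (Finsupp.lmapDomain ℂ ℂ (glueWord pieces r)) (h.le_comap hm C)

/-- The components of the closed manifold obtained from intervals indexed by `ι` by gluing the end
of the interval `i` to the start of the interval `p i`: the cycles of `p`. -/
abbrev Cycles {ι : Type} (p : Equiv.Perm ι) : Type := Quotient (Equiv.Perm.SameCycle.setoid p)

instance {ι : Type} [Finite ι] (p : Equiv.Perm ι) : Fintype (Cycles p) := Fintype.ofFinite _

/-- The intervals that are met along a circle, in order. -/
def cyclePieces {ι : Type} (p : Equiv.Perm ι) (c : Cycles p) : List (ι ⊕ List ℕ) :=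
  (List.range (Function.minimalPeriod p c.out)).map fun j => Sum.inl (p^[j] c.out)

theorem isGluing_cyclePieces {ι : Type} [Fintype ι] (p : Equiv.Perm ι) :
    IsGluing (cyclePieces p) (Function.Embedding.refl ℕ) 0 where
  nodup c := by
    have := Function.nodup_periodicOrbit (f := p) (x := c.out)
    rw [Function.periodicOrbit, Cycle.nodup_coe_iff] at this
    simpa [cyclePieces, List.filterMap_map, Function.comp_def] using this
  once := by
    refine ⟨fun i => ⟦i⟧, fun i c => ?_⟩
    have h := Function.mem_periodicOrbit_iff (f := p) (y := i)
      (p.injective.mem_periodicPts c.out)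
    rw [Function.periodicOrbit, Cycle.mem_coe_iff] at h
    have h1 : Sum.inl i ∈ cyclePieces p c ↔ ∃ n, p^[n] c.out = i := by
      rw [← h]
      simp [cyclePieces, eq_comm]
    rw [h1]
    conv_rhs => rw [← Quotient.out_eq c, eq_comm]
    rw [Quotient.eq]
    constructor
    · rintro ⟨n, hn⟩
      exact ⟨n, by rw [← hn, zpow_natCast, Equiv.Perm.iterate_eq_pow]⟩
    · intro hs
      obtain ⟨n, -, hn⟩ := Equiv.Perm.SameCycle.exists_pow_eq' hs
      exact ⟨n, by rw [Equiv.Perm.iterate_eq_pow]; exact hn⟩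
  fresh k u hu := by simp [cyclePieces] at hu
  feet := by
    refine Finset.sum_eq_zero fun c _ => ?_
    simp [cyclePieces, pieceFeet, Function.comp_def]

/-- Closing up: from chord diagrams supported on intervals (the strands of a tangle that is embedded
in space) to chord diagrams on a disjoint union of circles, one for each cycle of `p`. -/
def closeMap {ι : Type} [Fintype ι] (p : Equiv.Perm ι) (m : ℕ) :
    ChordSpace (∅ : Set ι) m →ₗ[ℂ] ChordSpace (univ : Set (Cycles p)) m :=
  glueMap (isGluing_cyclePieces p) (add_zero m) univ

/-! ### The Kontsevich integral -/

/-- The monotone strands of a tangle or link in `ℂ × ℝ`, cut at its critical points: the strand `s`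
is the graph of `pos s` over the heights between `lo s` and `hi s`, oriented upwards or not. -/
structure Strands (ι : Type) where
  pos : ι → ℝ → ℂ
  lo : ι → ℝ
  hi : ι → ℝ
  up : ι → Bool

open Classical in
/-- The chord feet met along the strand `s`, when the `k`-th chord from the bottom is `P k`. -/
def strandWord {ι : Type} (up : ι → Bool) {m : ℕ} (P : Fin m → Chord ι) (s : ι) : List ℕ :=
  if up s then ((List.finRange m).filter fun k => s ∈ (P k).1).map Fin.val
  else (((List.finRange m).filter fun k => s ∈ (P k).1).map Fin.val).reverse

/-- The sign contributed by the two feet of a chord: a factor `-1` for each foot on a strand that is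
oriented downwards. -/
def chordSign {ι : Type} (up : ι → Bool) (P : Chord ι) : ℂ :=
  Sym2.lift ⟨fun i j => (if up i then 1 else -1) * (if up j then 1 else -1),
    fun _ _ => mul_comm _ _⟩ P.1

open Classical in
/-- The form `± d log Δz[P]` along the strands, as a function of the height; it is `0` at heights
where there is no horizontal chord between the two strands. -/
def chordForm {ι : Type} (S : Strands ι) (P : Chord ι) (t : ℝ) : ℂ :=
  if ∀ s ∈ P.1, S.lo s < t ∧ t < S.hi s then
    chordSign S.up P * dlogDiff (fun s => S.pos s t) (fun s => deriv (S.pos s) t) P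
  else 0

/-- `∏ₖ ± d log Δz[P k]`, at the heights `T`. -/
def pairingForm {ι : Type} (S : Strands ι) {m : ℕ} (P : Fin m → Chord ι) (T : Fin m → ℝ) : ℂ :=
  ∏ k, chordForm S (P k) (T k)

/-- `∫ ∏ₖ ± d log Δz[P k]` over the heights `T 0 < ⋯ < T (m - 1)` that belong to `B`. -/
def pairingIntegral {ι : Type} (S : Strands ι) {m : ℕ} (P : Fin m → Chord ι)
    (B : Set (Fin m → ℝ)) : ℂ :=
  ∫ T in {T | StrictMono T} ∩ B, pairingForm S P T

/-- The degree `m` part of the Kontsevich integral of a tangle with strands `S`, all of its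
components being monotone strands. -/
def kontsevichTangle {ι : Type} [Fintype ι] (S : Strands ι) (m : ℕ) : ChordSpace (∅ : Set ι) m :=
  ((2 * Real.pi * Complex.I) ^ m)⁻¹ • ∑ P : Fin m → Chord ι,
    pairingIntegral S P univ • chordDiagram ∅ m (strandWord S.up P)

/-- The chord diagram `D_P` on a disjoint union of circles defined by a pairing `P` on a link with
strands `S`, the strand `s` being followed by the strand `p s`. -/
def linkDiagram {ι : Type} [Fintype ι] (S : Strands ι) (p : Equiv.Perm ι) {m : ℕ}
    (P : Fin m → Chord ι) : ChordSpace (univ : Set (Cycles p)) m :=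
  closeMap p m (chordDiagram ∅ m (strandWord S.up P))

/-- The sum `(2πi)⁻ᵐ ∑_P (∫ (-1)^ε(P) ∏ d log Δz[P_i]) D_P` over the pairings `P` of length `m`, where
the integral is over those heights of the chords that belong to `B P`. -/
def kontsevichPart {ι : Type} [Fintype ι] (S : Strands ι) (p : Equiv.Perm ι) (m : ℕ)
    (B : (Fin m → Chord ι) → Set (Fin m → ℝ)) : ChordSpace (univ : Set (Cycles p)) m :=
  ((2 * Real.pi * Complex.I) ^ m)⁻¹ • ∑ P : Fin m → Chord ι,
    pairingIntegral S P (B P) • linkDiagram S p P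

/-- The degree `m` part of the Kontsevich integral of a link with strands `S`, the strand `s` being
followed by the strand `p s`. -/
def kontsevichLink {ι : Type} [Fintype ι] (S : Strands ι) (p : Equiv.Perm ι) (m : ℕ) :
    ChordSpace (univ : Set (Cycles p)) m :=
  kontsevichPart S p m fun _ => univ

/-- Absolute convergence of the integrals that occur in the Kontsevich integral of a link. -/
def KontsevichConverges {ι : Type} [Fintype ι] (S : Strands ι) (p : Equiv.Perm ι) (m : ℕ) : Prop :=
  ∀ P : Fin m → Chord ι, linkDiagram S p P ≠ 0 → IntegrableOn (pairingForm S P) {T | StrictMono T}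

/-! ### Lifting the holonomy to the braid -/

/-- The coefficient of the word `P` of chords in the expansion of the holonomy:
`(2πi)⁻ᵐ ∫_{0 ≤ t₁ < ⋯ < tₘ ≤ 1} ∏ d log Δz[P_i](γ t_i)`. -/
def kzIterated {N : ℕ} (z : ℝ → Conf N) {m : ℕ} (P : Fin m → Chord (Fin N)) : ℂ :=
  ((2 * Real.pi * Complex.I) ^ m)⁻¹ *
    ∫ T in {T : Fin m → ℝ | StrictMono T ∧ ∀ k, T k ∈ Icc (0 : ℝ) 1},
      ∏ k, dlogDiff (z (T k)).1 (velocity z (T k)) (P k)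

/-- The expansion of the holonomy, each product of chords `|P_i⟩` based at the points `γ(t_i)` being
lifted to the chord diagram on the geometric braid with these chords at the heights `t_i`. -/
def liftedHolonomy {N : ℕ} (z : ℝ → Conf N) (m : ℕ) : ChordSpace (∅ : Set (Fin N)) m :=
  ∑ P : Fin m → Chord (Fin N),
    kzIterated z P • chordDiagram ∅ m (strandWord (fun _ => true) P)

/-- The geometric braid in `ℂ × [0, 1]` defined by a path of configurations. -/
def braidStrands {N : ℕ} (z : ℝ → Conf N) : Strands (Fin N) where
  pos i t := (z t).1 i
  lo _ := 0
  hi _ := 1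
  up _ := true

/-! ### The closure of the braid -/

/-- Half of the distance between the two legs of a closing arc at height `t`. -/
def arcRadius (R t : ℝ) : ℝ := R / 2 * Real.sqrt (min 1 (min (1 + t) (2 - t)))

/-- The arcs that close a braid based at `0, …, N - 1`: for each `n` an arc in the plane of real part
`n` that goes from the top `(n, 1)` of the braid, through a maximum at height `2`, down along the
vertical line over `n + R i`, and through a minimum at height `-1`, to the bottom `(n, 0)` of the
braid. The leg `inl i` goes up from the `i`-th minimum to the `s i`-th maximum (at heights in `[0, 1]`
it is to be replaced by the `i`-th strand of the braid) and the leg `inr n` goes down. -/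
def closingStrands {N : ℕ} (s : Equiv.Perm (Fin N)) (R : ℝ) : Strands (Fin N ⊕ Fin N) where
  pos j t := match j with
    | Sum.inl i => (if t < 0 then ((i : ℕ) : ℂ) else ((s i : ℕ) : ℂ)) +
        ((R / 2 - arcRadius R t : ℝ) : ℂ) * Complex.I
    | Sum.inr n => ((n : ℕ) : ℂ) + ((R / 2 + arcRadius R t : ℝ) : ℂ) * Complex.I
  lo _ := -1
  hi _ := 2
  up j := j.isLeft

open Classical in
/-- The closure of the braid defined by `z`, a Morse link with `N` maxima and `N` minima. -/
def closureStrands {N : ℕ} (z : ℝ → Conf N) (s : Equiv.Perm (Fin N)) (R : ℝ) :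
    Strands (Fin N ⊕ Fin N) :=
  { closingStrands s R with
    pos := fun j t => match j with
      | Sum.inl i => if t ∈ Icc (0 : ℝ) 1 then (z t).1 i else (closingStrands s R).pos (Sum.inl i) t
      | Sum.inr n => (closingStrands s R).pos (Sum.inr n) t }

/-- Travelling along the closure, the leg `inl i` is followed by the leg `inr (s i)`, which is
followed by the leg `inl (s i)`. -/
def closureNext {N : ℕ} (s : Equiv.Perm (Fin N)) : Equiv.Perm (Fin N ⊕ Fin N) :=
  (Equiv.sumComm _ _).trans (Equiv.sumCongr (Equiv.refl _) s)

/-- Labels for the chords of the braid, distinct from those for the other chords. -/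
def braidLabel : ℕ ↪ ℕ := ⟨fun l => 3 * l, fun a b h => by simpa using h⟩

/-- Along the legs of the closure: the chords `Q` near the minima, the braid, the chords `Q'` near
the maxima (in the opposite order on the legs that go down). -/
def closurePieces {N a b : ℕ} (Q : Fin b → Chord (Fin N ⊕ Fin N))
    (Q' : Fin a → Chord (Fin N ⊕ Fin N)) : Fin N ⊕ Fin N → List (Fin N ⊕ List ℕ)
  | Sum.inl i =>
      [Sum.inr ((strandWord Sum.isLeft Q (Sum.inl i)).map fun l => 3 * l + 1), Sum.inl i,
        Sum.inr ((strandWord Sum.isLeft Q' (Sum.inl i)).map fun l => 3 * l + 2)]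
  | Sum.inr n =>
      [Sum.inr ((strandWord Sum.isLeft Q' (Sum.inr n)).map fun l => 3 * l + 2),
        Sum.inr ((strandWord Sum.isLeft Q (Sum.inr n)).map fun l => 3 * l + 1)]

theorem sum_length_strandWord {ι : Type} [Fintype ι] (up : ι → Bool) {m : ℕ}
    (P : Fin m → Chord ι) : ∑ s, (strandWord up P s).length = 2 * m := by
  classical
  have h1 : ∀ s, (strandWord up P s).length = ∑ k, if s ∈ (P k).1 then 1 else 0 := by
    intro s
    have : (strandWord up P s).length =
        ((List.finRange m).filter fun k => s ∈ (P k).1).length := by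
      unfold strandWord
      split_ifs
      · simp only [List.length_map]
      · simp only [List.length_reverse, List.length_map]
    rw [this, Finset.sum_boole, Nat.cast_id, ← List.toFinset_card_of_nodup
      ((List.nodup_finRange m).filter _)]
    congr 1
    ext k
    simp
  simp only [h1]
  rw [Finset.sum_comm]
  have h2 : ∀ k, (∑ s, if s ∈ (P k).1 then 1 else 0) = 2 := by
    intro k
    rw [← Sym2.card_toFinset_of_not_isDiag (P k).1 (P k).2, Finset.card_eq_sum_ones,
      ← Finset.sum_filter]
    congr 1
    ext s
    simp
  simp [h2, mul_comm]

theorem isGluing_closurePieces {N a b : ℕ} (Q : Fin b → Chord (Fin N ⊕ Fin N))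
    (Q' : Fin a → Chord (Fin N ⊕ Fin N)) : IsGluing (closurePieces Q Q') braidLabel (b + a) where
  nodup j := by
    rcases j with i | n
    · exact List.nodup_singleton i
    · exact List.nodup_nil
  once := by
    refine ⟨Sum.inl, fun i j => ?_⟩
    rcases j with j | n <;> simp [closurePieces]
  fresh j u hu l hl := by
    have key : (∃ x : ℕ, 3 * x + 1 = 3 * l) ∨ ∃ x : ℕ, 3 * x + 2 = 3 * l := by
      rcases j with i | n <;> simp [closurePieces] at hu <;> rcases hu with rfl | rfl <;>
        obtain ⟨x, -, hx⟩ := List.mem_map.1 hl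
      · exact Or.inl ⟨x, hx⟩
      · exact Or.inr ⟨x, hx⟩
      · exact Or.inr ⟨x, hx⟩
      · exact Or.inl ⟨x, hx⟩
    omega
  feet := by
    have h1 := sum_length_strandWord Sum.isLeft Q
    have h2 := sum_length_strandWord Sum.isLeft Q'
    rw [Fintype.sum_sum_type] at h1 h2 ⊢
    simp only [closurePieces, pieceFeet, List.map_cons, List.map_nil, List.sum_cons, List.sum_nil,
      List.length_map, Finset.sum_add_distrib, add_zero, zero_add]
    omega

/-- Closing up a chord diagram of degree `k` on the braid, after adding `b` chords near the minima
and `a` chords near the maxima of the closure. -/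
def graftMap {N a b k m : ℕ} (s : Equiv.Perm (Fin N)) (Q : Fin b → Chord (Fin N ⊕ Fin N))
    (Q' : Fin a → Chord (Fin N ⊕ Fin N)) (hm : k + (b + a) = m) :
    ChordSpace (∅ : Set (Fin N)) k →ₗ[ℂ] ChordSpace (univ : Set (Cycles (closureNext s))) m :=
  closeMap (closureNext s) m ∘ₗ glueMap (isGluing_closurePieces Q Q') hm ∅

/-- The weight of the chords `Q` near the minima. -/
def bottomIntegral {N b : ℕ} (s : Equiv.Perm (Fin N)) (R : ℝ)
    (Q : Fin b → Chord (Fin N ⊕ Fin N)) : ℂ :=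
  pairingIntegral (closingStrands s R) Q {T | ∀ k, T k ∈ Ioo (-1 : ℝ) 0}

/-- The weight of the chords `Q'` near the maxima. -/
def topIntegral {N a : ℕ} (s : Equiv.Perm (Fin N)) (R : ℝ)
    (Q' : Fin a → Chord (Fin N ⊕ Fin N)) : ℂ :=
  pairingIntegral (closingStrands s R) Q' {T | ∀ k, T k ∈ Ioo (1 : ℝ) 2}

/-- Closing up an element `x` of the graded completion of the space of chord diagrams on the braid:
the contributions of the chords in the top and bottom portions of the closure are grafted onto `x`,
and the result is mapped to chord diagrams on a disjoint union of circles (degree `m` part). It only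
depends on the closing arcs. -/
def closeGraft {N : ℕ} (s : Equiv.Perm (Fin N)) (R : ℝ)
    (x : ∀ k, ChordSpace (∅ : Set (Fin N)) k) (m : ℕ) :
    ChordSpace (univ : Set (Cycles (closureNext s))) m :=
  ∑ q : {q : Fin (m + 1) × Fin (m + 1) // (q.1 : ℕ) + q.2 ≤ m},
    ((2 * Real.pi * Complex.I) ^ ((q.1.1 : ℕ) + q.1.2))⁻¹ •
      ∑ Q : Fin q.1.1 → Chord (Fin N ⊕ Fin N), ∑ Q' : Fin q.1.2 → Chord (Fin N ⊕ Fin N),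
        (bottomIntegral s R Q * topIntegral s R Q') •
          graftMap s Q Q' (Nat.sub_add_cancel q.2) (x (m - (q.1.1 + q.1.2)))

/-- Absolute convergence of the integrals that occur in `closeGraft`. -/
def ClosingConverges {N : ℕ} (s : Equiv.Perm (Fin N)) (R : ℝ) : Prop :=
  ∀ (a b k : ℕ) (Q : Fin b → Chord (Fin N ⊕ Fin N)) (Q' : Fin a → Chord (Fin N ⊕ Fin N)),
    graftMap s Q Q' (rfl : k + (b + a) = k + (b + a)) ≠ 0 →
      IntegrableOn (pairingForm (closingStrands s R) Q)
        ({T | StrictMono T} ∩ {T | ∀ k, T k ∈ Ioo (-1 : ℝ) 0}) ∧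
      IntegrableOn (pairingForm (closingStrands s R) Q')
        ({T | StrictMono T} ∩ {T | ∀ k, T k ∈ Ioo (1 : ℝ) 2})

/-- The part of the Kontsevich integral of the closure that involves, at a height at which the braid
is, a chord with a foot on one of the strands in the back of the closure. -/
def longPart {N : ℕ} (z : ℝ → Conf N) (s : Equiv.Perm (Fin N)) (R : ℝ) (m : ℕ) :
    ChordSpace (univ : Set (Cycles (closureNext s))) m :=
  kontsevichPart (closureStrands z s R) (closureNext s) m fun P =>
    {T | ∃ k, T k ∈ Ioo (0 : ℝ) 1 ∧ ∃ n, Sum.inr n ∈ (P k).1}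

end

/-! Holonomy. The chords in a fibre commute, so the KZ equation `ψ' = ω ψ` is solved by the
exponential of the integrated form. Derivatives are taken coefficient by coefficient. Since `ω` has
no constant term, the derivative of a coefficient involves only coefficients of smaller degree, and
uniqueness is an induction on the degree (`eq_of_hasDerivWithinAt_mul`). Two lifts of a path differ
by one constant permutation (`IsC1Lift.exists_perm`), so the choice of lift does not matter.

Expansion. The degree `m` part of the exponential is an `m`-th power divided by `m!`. A product of
`m` integrals over `[0, 1]` is an integral over a cube, and the cube is cut into `m!` simplices
(`sum_perm_integral_strictMono`). The resulting coefficients are those of the Kontsevich integral of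
the braid, and closing the strands is linear.

Convergence for the Morse closure. At a height distance `x` from the extrema, a chord between an
ascending and a descending leg has a form of size at most `1 / x`, which is not integrable by
itself; two legs on the same side move in parallel and contribute nothing. If the lowest chord joins
the two legs of one minimum, its diagram has an isolated chord and vanishes (`closeMap_eq_zero`).
Otherwise the real parts of its ends differ by at least `1`, hence `|Δz| ≥ max (1, R √x) ≥ (R
√x)^(3/4)`, which gains a factor `R^(1/4) x^(1/8)`. All other chords are farther from the minima, so
this gain can be shared equally by the `m` chords; every factor is then dominated by a power with
exponent `-1 + 1/(8m)`, which is integrable (`prod_le_gapWeight`). The maxima are treated in the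
same way with the highest chord.

Long chords. The two gains cost at most `R^(1/4)` each, hence `R^(1/2)` in all. A chord at the
height of the braid with a foot in the back has a form of size `O(1/R)`, because the back is at
distance at least `R / 2` from the braid and does not move. So the long part is `O(R^(-1/2))`
(`tendsto_longIntegral`).

Decomposition. The heights `0` and `1` cut an increasing tuple of heights into three blocks. Without
long chords the middle block is a pairing on the braid, the integral factors by Fubini
(`pairingIntegral_join`), and the diagram is the grafted one up to the names of its chords
(`chordDiagram_join`). Summing over the block sizes gives `kontsevichLink_closure`. -/

/-! ### Power series with differentiable coefficients -/

open MvPowerSeries in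
theorem HasDerivWithinAt.coeff_mul {σ : Type} {f g : ℝ → MvPowerSeries σ ℂ}
    {f' g' : MvPowerSeries σ ℂ} {s : Set ℝ} {t : ℝ}
    (hf : ∀ d, HasDerivWithinAt (fun u => coeff d (f u)) (coeff d f') s t)
    (hg : ∀ d, HasDerivWithinAt (fun u => coeff d (g u)) (coeff d g') s t) (d : σ →₀ ℕ) :
    HasDerivWithinAt (fun u => coeff d (f u * g u)) (coeff d (f' * g t + f t * g')) s t := by
  classical
  simp only [map_add, MvPowerSeries.coeff_mul, ← Finset.sum_add_distrib]
  exact HasDerivWithinAt.fun_sum fun p _ => (hf p.1).mul (hg p.2)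

open MvPowerSeries in
theorem HasDerivWithinAt.coeff_pow {σ : Type} {f : ℝ → MvPowerSeries σ ℂ}
    {f' : MvPowerSeries σ ℂ} {s : Set ℝ} {t : ℝ}
    (hf : ∀ d, HasDerivWithinAt (fun u => coeff d (f u)) (coeff d f') s t) (n : ℕ) (d : σ →₀ ℕ) :
    HasDerivWithinAt (fun u => coeff d (f u ^ n)) (coeff d ((n : MvPowerSeries σ ℂ) * f t ^ (n - 1) * f'))
      s t := by
  induction n generalizing d with
  | zero => simpa using hasDerivWithinAt_const (c := coeff d (1 : MvPowerSeries σ ℂ)) t s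
  | succ n ih =>
    simp only [pow_succ]
    convert HasDerivWithinAt.coeff_mul ih hf d using 2
    -- Truncated subtraction: `f ^ (n - 1) * f = f ^ n` needs `n ≥ 1`, and for `n = 0` the numerical
    -- factor `n` is zero.
    rcases n with _ | n
    · simp
    · push_cast
      simp only [pow_succ]
      ring

-- In a product, the coefficient of `g` of full degree is paired with the constant coefficient of
-- `w`, which is zero. This makes the KZ equation triangular with respect to the degree.
open MvPowerSeries in
theorem coeff_mul_congr {σ : Type} {w f g : MvPowerSeries σ ℂ} (hw : constantCoeff w = 0)
    (d : σ →₀ ℕ) (h : ∀ e : σ →₀ ℕ, e.degree < d.degree → coeff e f = coeff e g) :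
    coeff d (w * f) = coeff d (w * g) := by
  classical
  simp only [MvPowerSeries.coeff_mul]
  refine Finset.sum_congr rfl fun p hp => ?_
  rw [Finset.HasAntidiagonal.mem_antidiagonal] at hp
  by_cases h0 : p.1 = 0
  · simp [h0, hw]
  · rw [h]
    rw [← hp, map_add]
    have : p.1.degree ≠ 0 := by rwa [Ne, Finsupp.degree_eq_zero_iff]
    omega

open MvPowerSeries in
/-- A linear differential equation `f' = w f`, where `w` has no constant coefficient, has at most
one solution with a given initial value. -/
theorem eq_of_hasDerivWithinAt_mul {σ : Type} {w f g : ℝ → MvPowerSeries σ ℂ}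
    (hw : ∀ t, constantCoeff (w t) = 0)
    (hf : ∀ t ∈ Icc (0 : ℝ) 1, ∀ d,
      HasDerivWithinAt (fun u => coeff d (f u)) (coeff d (w t * f t)) (Icc 0 1) t)
    (hg : ∀ t ∈ Icc (0 : ℝ) 1, ∀ d,
      HasDerivWithinAt (fun u => coeff d (g u)) (coeff d (w t * g t)) (Icc 0 1) t)
    (h0 : f 0 = g 0) {t : ℝ} (ht : t ∈ Icc (0 : ℝ) 1) : f t = g t := by
  suffices h : ∀ n : ℕ, ∀ d : σ →₀ ℕ, d.degree = n → ∀ t ∈ Icc (0 : ℝ) 1,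
      coeff d (f t) = coeff d (g t) from MvPowerSeries.ext fun d => h _ d rfl t ht
  intro n
  induction n using Nat.strong_induction_on with
  | _ n ih =>
    intro d hd t ht
    -- By induction `f` and `g` agree in smaller degrees, so the right-hand sides of the two
    -- equations agree in degree `n` and the difference of the coefficients is constant.
    have key : ∀ t ∈ Icc (0 : ℝ) 1, HasDerivWithinAt (fun u => coeff d (f u) - coeff d (g u)) 0
        (Icc 0 1) t := by
      intro t ht
      have := (hf t ht d).sub (hg t ht d)
      rwa [coeff_mul_congr (hw t) d fun e he => ih _ (hd ▸ he) e rfl t ht, sub_self] at this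
    have h1 := constant_of_derivWithin_zero (fun t ht => (key t ht).differentiableWithinAt)
      (fun t ht => (key t (Ico_subset_Icc_self ht)).derivWithin
        (uniqueDiffOn_Icc one_pos t (Ico_subset_Icc_self ht))) t ht
    rw [h0, sub_self] at h1
    exact sub_eq_zero.1 h1

/-! ### The exponential of a linear form -/

/-- The linear form `∑ a_P X_P`. -/
noncomputable def linearSeries {σ : Type} [Fintype σ] (a : σ → ℂ) : MvPowerSeries σ ℂ :=
  ∑ P, MvPowerSeries.C (a P) * MvPowerSeries.X P

theorem constantCoeff_linearSeries {σ : Type} [Fintype σ] (a : σ → ℂ) :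
    MvPowerSeries.constantCoeff (linearSeries a) = 0 := by
  simp [linearSeries]

theorem coeff_linearSeries {σ : Type} [Fintype σ] [DecidableEq σ] (a : σ → ℂ) (d : σ →₀ ℕ) :
    MvPowerSeries.coeff d (linearSeries a) = ∑ P, if d = Finsupp.single P 1 then a P else 0 := by
  simp [linearSeries, MvPowerSeries.coeff_X]

theorem prod_X_eq {σ : Type} {m : ℕ} (P : Fin m → σ) :
    (∏ k, (MvPowerSeries.X (P k) : MvPowerSeries σ ℂ)) =
      MvPowerSeries.monomial (∑ k, Finsupp.single (P k) 1) 1 := by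
  simp only [MvPowerSeries.X_def, MvPowerSeries.prod_monomial]
  simp

theorem coeff_linearSeries_pow {σ : Type} [Fintype σ] (a : σ → ℂ) (n : ℕ) (d : σ →₀ ℕ) :
    MvPowerSeries.coeff d (linearSeries a ^ n) =
      ∑ P : Fin n → σ, (∏ k, a (P k)) *
        MvPowerSeries.coeff d (∏ k, (MvPowerSeries.X (P k) : MvPowerSeries σ ℂ)) := by
  rw [linearSeries, Fintype.sum_pow, map_sum]
  refine Finset.sum_congr rfl fun P _ => ?_
  rw [Finset.prod_mul_distrib, ← map_prod, MvPowerSeries.coeff_C_mul]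

theorem coeff_linearSeries_pow_of_ne {σ : Type} [Fintype σ] (a : σ → ℂ) (n : ℕ) (d : σ →₀ ℕ)
    (h : d.degree ≠ n) : MvPowerSeries.coeff d (linearSeries a ^ n) = 0 := by
  classical
  rw [coeff_linearSeries_pow]
  refine Finset.sum_eq_zero fun P _ => ?_
  rw [prod_X_eq, MvPowerSeries.coeff_monomial, if_neg, mul_zero]
  rintro rfl
  simp at h

theorem hasSubst_linearSeries {σ : Type} [Fintype σ] (a : σ → ℂ) :
    PowerSeries.HasSubst (linearSeries a) :=
  PowerSeries.HasSubst.of_constantCoeff_zero (constantCoeff_linearSeries a)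

/-- The exponential of the linear form `∑ a_P X_P`. -/
noncomputable def expSeries {σ : Type} [Fintype σ] (a : σ → ℂ) : MvPowerSeries σ ℂ :=
  (PowerSeries.exp ℂ).subst (linearSeries a)

/-- Powers of a linear form are homogeneous, so a single term of the exponential series contributes
to each coefficient; no convergence is involved. -/
theorem coeff_expSeries {σ : Type} [Fintype σ] (a : σ → ℂ) (d : σ →₀ ℕ) :
    MvPowerSeries.coeff d (expSeries a) =
      (d.degree.factorial : ℂ)⁻¹ * MvPowerSeries.coeff d (linearSeries a ^ d.degree) := by
  rw [expSeries, PowerSeries.coeff_subst (hasSubst_linearSeries a), finsum_eq_single _ d.degree]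
  · simp [PowerSeries.coeff_exp]
  · intro n hn
    rw [coeff_linearSeries_pow_of_ne _ _ _ hn.symm, smul_zero]

theorem expSeries_zero {σ : Type} [Fintype σ] : expSeries (0 : σ → ℂ) = 1 := by
  classical
  ext d
  rw [coeff_expSeries]
  have h0 : linearSeries (0 : σ → ℂ) = 0 := by simp [linearSeries]
  rw [h0, MvPowerSeries.coeff_one]
  by_cases hd : d = 0
  · simp [hd]
  · have : d.degree ≠ 0 := by rwa [Ne, Finsupp.degree_eq_zero_iff]
    simp [hd, zero_pow this]

theorem hasDerivWithinAt_linearSeries {σ : Type} [Fintype σ] {a : σ → ℝ → ℂ} {a' : σ → ℂ}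
    {s : Set ℝ} {t : ℝ} (h : ∀ P, HasDerivWithinAt (a P) (a' P) s t) (d : σ →₀ ℕ) :
    HasDerivWithinAt (fun u => MvPowerSeries.coeff d (linearSeries fun P => a P u))
      (MvPowerSeries.coeff d (linearSeries a')) s t := by
  classical
  simp only [coeff_linearSeries]
  refine HasDerivWithinAt.fun_sum fun P _ => ?_
  split_ifs
  · exact h P
  · exact hasDerivWithinAt_const ..

/-- The derivative of `L ^ n` is `n L ^ (n - 1) L'` because the variables commute, and `n / n! = 1 /
(n - 1)!` reproduces the exponential one degree lower. -/
theorem hasDerivWithinAt_expSeries {σ : Type} [Fintype σ] {a : σ → ℝ → ℂ} {a' : σ → ℂ}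
    {s : Set ℝ} {t : ℝ} (h : ∀ P, HasDerivWithinAt (a P) (a' P) s t) (d : σ →₀ ℕ) :
    HasDerivWithinAt (fun u => MvPowerSeries.coeff d (expSeries fun P => a P u))
      (MvPowerSeries.coeff d (linearSeries a' * expSeries fun P => a P t)) s t := by
  classical
  simp only [coeff_expSeries _ d]
  have key := (HasDerivWithinAt.coeff_pow (hasDerivWithinAt_linearSeries h) d.degree d).const_mul
    ((d.degree.factorial : ℂ)⁻¹)
  refine key.congr_deriv (Eq.symm ?_)
  rcases hn : d.degree with _ | n
  · rw [Finsupp.degree_eq_zero_iff] at hn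
    simp [hn, constantCoeff_linearSeries]
  · have h1 : ∀ c : MvPowerSeries σ ℂ, ((n + 1 : ℕ) : MvPowerSeries σ ℂ) * c =
        MvPowerSeries.C ((n + 1 : ℕ) : ℂ) * c := by intro c; simp
    rw [mul_assoc, h1, MvPowerSeries.coeff_C_mul, Nat.add_sub_cancel, mul_comm (_ ^ n),
      MvPowerSeries.coeff_mul, MvPowerSeries.coeff_mul, Finset.mul_sum, Finset.mul_sum]
    refine Finset.sum_congr rfl fun p hp => ?_
    rw [Finset.HasAntidiagonal.mem_antidiagonal] at hp
    by_cases h0 : p.1 = 0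
    · simp [h0, constantCoeff_linearSeries]
    have hd : p.1.degree + p.2.degree = n + 1 := by rw [← map_add, hp, hn]
    have h0' : p.1.degree ≠ 0 := by rwa [Ne, Finsupp.degree_eq_zero_iff]
    -- `L'` is homogeneous of degree one, so only these terms of the convolution survive, and in
    -- them the other factor has degree exactly `n`.
    by_cases h1 : p.1.degree = 1
    · have h2 : p.2.degree = n := by omega
      rw [coeff_expSeries, h2, Nat.factorial_succ]
      have : (n.factorial : ℂ) ≠ 0 := by exact_mod_cast n.factorial_ne_zero
      have : ((n : ℂ) + 1) ≠ 0 := by exact_mod_cast n.succ_ne_zero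
      push_cast
      field_simp
    · rw [← pow_one (linearSeries a'), coeff_linearSeries_pow_of_ne _ _ _ h1]
      simp

/-! ### Parallel transport -/

theorem Chord.ind {ι : Type} {p : Chord ι → Prop}
    (h : ∀ i j (hij : ¬ (s(i, j) : Sym2 ι).IsDiag), p ⟨s(i, j), hij⟩) (P : Chord ι) : p P := by
  obtain ⟨e, he⟩ := P
  induction e using Sym2.ind with
  | _ i j => exact h i j he

theorem continuousOn_lift {N : ℕ} {x y : UConf N} {γ : Path x y} {z : ℝ → Conf N}
    (hz : IsC1Lift γ z) (i : Fin N) : ContinuousOn (fun t => (z t).1 i) (Icc 0 1) :=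
  (continuous_apply i).comp_continuousOn hz.1.continuousOn

theorem continuousOn_velocity {N : ℕ} {x y : UConf N} {γ : Path x y} {z : ℝ → Conf N}
    (hz : IsC1Lift γ z) (i : Fin N) : ContinuousOn (fun t => velocity z t i) (Icc 0 1) :=
  (continuous_apply i).comp_continuousOn
    (hz.1.continuousOn_derivWithin (uniqueDiffOn_Icc one_pos) le_rfl)

theorem hasDerivWithinAt_lift {N : ℕ} {x y : UConf N} {γ : Path x y} {z : ℝ → Conf N}
    (hz : IsC1Lift γ z) (i : Fin N) {t : ℝ} (ht : t ∈ Icc (0 : ℝ) 1) :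
    HasDerivWithinAt (fun u => (z u).1 i) (velocity z t i) (Icc 0 1) t :=
  hasDerivWithinAt_pi.1 ((hz.1.differentiableOn one_ne_zero t ht).hasDerivWithinAt) i

theorem continuousOn_dlogDiff {N : ℕ} {x y : UConf N} {γ : Path x y} {z : ℝ → Conf N}
    (hz : IsC1Lift γ z) (P : Chord (Fin N)) :
    ContinuousOn (fun t => dlogDiff (z t).1 (velocity z t) P) (Icc 0 1) := by
  induction P using Chord.ind with
  | _ i j h =>
    refine ((continuousOn_velocity hz i).sub (continuousOn_velocity hz j)).div
      ((continuousOn_lift hz i).sub (continuousOn_lift hz j)) fun t _ => ?_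
    exact sub_ne_zero.2 fun e => h ((z t).2 e)

/-- The coefficient of the chord `P` in the integral of the KZ form over `[0, t]`. -/
noncomputable def kzCoeff {N : ℕ} (z : ℝ → Conf N) (t : ℝ) (P : Chord (Fin N)) : ℂ :=
  (2 * Real.pi * Complex.I)⁻¹ * ∫ u in (0 : ℝ)..t, dlogDiff (z u).1 (velocity z u) P

theorem hasDerivWithinAt_kzCoeff {N : ℕ} {x y : UConf N} {γ : Path x y} {z : ℝ → Conf N}
    (hz : IsC1Lift γ z) (P : Chord (Fin N)) {t : ℝ} (ht : t ∈ Icc (0 : ℝ) 1) :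
    HasDerivWithinAt (fun u => kzCoeff z u P)
      ((2 * Real.pi * Complex.I)⁻¹ * dlogDiff (z t).1 (velocity z t) P) (Icc 0 1) t := by
  -- Instance argument of the fundamental theorem of calculus within `Icc 0 1`, which covers the
  -- endpoints as well.
  have : Fact (t ∈ Icc (0 : ℝ) 1) := ⟨ht⟩
  have hc := continuousOn_dlogDiff hz P
  refine HasDerivWithinAt.const_mul _ (intervalIntegral.integral_hasDerivWithinAt_right ?_
    (hc.stronglyMeasurableAtFilter_nhdsWithin measurableSet_Icc t) (hc t ht))
  refine (hc.mono ?_).intervalIntegrable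
  rw [uIcc_of_le ht.1]
  exact Icc_subset_Icc_right ht.2

theorem kzForm_eq_linearSeries {N : ℕ} (Z v : Fin N → ℂ) :
    kzForm Z v = linearSeries fun P => (2 * Real.pi * Complex.I)⁻¹ * dlogDiff Z v P := rfl

theorem kzIntegral_eq_linearSeries {N : ℕ} {x y : UConf N} {γ : Path x y} {z : ℝ → Conf N}
    (hz : IsC1Lift γ z) : kzIntegral z = linearSeries (kzCoeff z 1) := by
  classical
  funext d
  change (∫ t in (0 : ℝ)..1, MvPowerSeries.coeff d (kzForm (z t).1 (velocity z t))) =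
    MvPowerSeries.coeff d (linearSeries (kzCoeff z 1))
  simp only [kzForm_eq_linearSeries, coeff_linearSeries]
  rw [intervalIntegral.integral_finsetSum]
  · refine Finset.sum_congr rfl fun P _ => ?_
    split_ifs
    · rw [intervalIntegral.integral_const_mul, kzCoeff]
    · simp
  · intro P _
    split_ifs
    · refine (ContinuousOn.intervalIntegrable ?_).const_mul _
      rw [uIcc_of_le zero_le_one]
      exact continuousOn_dlogDiff hz P
    · simp

theorem kzExp_eq_expSeries {N : ℕ} {x y : UConf N} {γ : Path x y} {z : ℝ → Conf N}
    (hz : IsC1Lift γ z) : kzExp z = expSeries (kzCoeff z 1) := by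
  rw [kzExp, kzIntegral_eq_linearSeries hz, expSeries]

theorem constantCoeff_kzForm {N : ℕ} (Z v : Fin N → ℂ) :
    MvPowerSeries.constantCoeff (kzForm Z v) = 0 :=
  constantCoeff_linearSeries _

/-- Two lifts of a path differ by a constant relabelling. -/
theorem IsC1Lift.exists_perm {N : ℕ} {x y : UConf N} {γ : Path x y} {z z' : ℝ → Conf N}
    (hz : IsC1Lift γ z) (hz' : IsC1Lift γ z') :
    ∃ s : Equiv.Perm (Fin N), ∀ t ∈ Icc (0 : ℝ) 1, ∀ i, (z' t).1 (s i) = (z t).1 i := by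
  have hex : ∀ t : unitInterval, ∃ s : Equiv.Perm (Fin N), ∀ i, (z' t).1 (s i) = (z t).1 i :=
    fun t => Quotient.exact ((hz.2 t).symm.trans (hz'.2 t))
  choose c hc using hex
  -- The relabelling at time `t` is unique since the points are distinct. Each of its finitely many
  -- values is taken on a closed set, so it is continuous into a discrete space, hence constant on
  -- the interval.
  let _ : TopologicalSpace (Equiv.Perm (Fin N)) := ⊥
  have : DiscreteTopology (Equiv.Perm (Fin N)) := ⟨rfl⟩
  have hsing : ∀ s, c ⁻¹' {s} = ⋂ i, {t : unitInterval | (z' t).1 (s i) = (z t).1 i} := by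
    intro s
    ext t
    simp only [mem_preimage, mem_singleton_iff, mem_iInter, mem_ofPred_eq]
    constructor
    · rintro rfl i
      exact hc t i
    · intro h
      ext1 i
      exact (z' t).2 ((hc t i).trans (h i).symm)
  have hcont : Continuous c := by
    refine continuous_iff_isClosed.2 fun A _ => ?_
    rw [← biUnion_of_singleton A, preimage_iUnion₂]
    refine (toFinite A).isClosed_biUnion fun s _ => ?_
    rw [hsing]
    exact isClosed_iInter fun i => isClosed_eq
      ((continuousOn_lift hz' _).comp_continuous continuous_subtype_val fun t => t.2)
      ((continuousOn_lift hz _).comp_continuous continuous_subtype_val fun t => t.2)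
  refine ⟨c 0, fun t ht i => ?_⟩
  rw [← hc ⟨t, ht⟩ i, PreconnectedSpace.constant inferInstance hcont (x := 0) (y := ⟨t, ht⟩)]

theorem velocity_of_perm {N : ℕ} {x y : UConf N} {γ : Path x y} {z z' : ℝ → Conf N}
    (hz : IsC1Lift γ z) (hz' : IsC1Lift γ z') {s : Equiv.Perm (Fin N)}
    (hs : ∀ t ∈ Icc (0 : ℝ) 1, ∀ i, (z' t).1 (s i) = (z t).1 i) {t : ℝ}
    (ht : t ∈ Icc (0 : ℝ) 1) (i : Fin N) : velocity z' t (s i) = velocity z t i :=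
  (uniqueDiffOn_Icc one_pos t ht).eq_deriv _ (hasDerivWithinAt_lift hz' (s i) ht)
    ((hasDerivWithinAt_lift hz i ht).congr (fun u hu => hs u hu i) (hs t ht i))

theorem dlogDiff_perm {ι : Type} {Z v Z' v' : ι → ℂ} {s : Equiv.Perm ι}
    (hZ : ∀ i, Z' (s i) = Z i) (hv : ∀ i, v' (s i) = v i) (P : Chord ι) :
    dlogDiff Z' v' (P.perm s) = dlogDiff Z v P := by
  induction P using Chord.ind with
  | _ i j h => simp [dlogDiff, Chord.perm, hZ, hv]

/-- A relabelling, as a permutation of the chords. -/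
def Chord.permEquiv {ι : Type} (s : Equiv.Perm ι) : Equiv.Perm (Chord ι) where
  toFun := Chord.perm s
  invFun := Chord.perm s⁻¹
  left_inv P := by
    have := congrFun (Chord.perm_mul s⁻¹ s) P
    rw [inv_mul_cancel, Chord.perm_one] at this
    exact this.symm
  right_inv P := by
    have := congrFun (Chord.perm_mul s s⁻¹) P
    rw [mul_inv_cancel, Chord.perm_one] at this
    exact this.symm

theorem permSeries_kzForm {N : ℕ} {Z v Z' v' : Fin N → ℂ} {s : Equiv.Perm (Fin N)}
    (hZ : ∀ i, Z' (s i) = Z i) (hv : ∀ i, v' (s i) = v i) :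
    permSeries s (kzForm Z v) = kzForm Z' v' := by
  rw [kzForm, kzForm, permSeries, map_sum]
  refine Fintype.sum_equiv (Chord.permEquiv s) _ _ fun P => ?_
  simp only [map_mul, MvPowerSeries.rename_C, MvPowerSeries.rename_X]
  rw [show Chord.permEquiv s P = P.perm s from rfl, dlogDiff_perm hZ hv]

theorem permSeries_mul_series {N : ℕ} (s : Equiv.Perm (Fin N)) (f g : ChordSeries N) :
    permSeries s (f * g) = permSeries s f * permSeries s g :=
  map_mul (MvPowerSeries.rename (Chord.perm s)) f g

theorem hasDerivWithinAt_permSeries {N : ℕ} (s : Equiv.Perm (Fin N)) {f : ℝ → ChordSeries N}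
    {f' : ChordSeries N} {A : Set ℝ} {t : ℝ}
    (hf : ∀ d, HasDerivWithinAt (fun u => MvPowerSeries.coeff d (f u)) (MvPowerSeries.coeff d f') A t)
    (d : Chord (Fin N) →₀ ℕ) :
    HasDerivWithinAt (fun u => MvPowerSeries.coeff d (permSeries s (f u)))
      (MvPowerSeries.coeff d (permSeries s f')) A t := by
  simp only [permSeries, MvPowerSeries.coeff_rename]
  exact HasDerivWithinAt.fun_sum fun e _ => hf e

/-- A horizontal section is given by a solution of the KZ equation over any lift. -/
theorem IsHorizontal.exists_series {N : ℕ} {x y : UConf N} {γ : Path x y}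
    {Φ : unitInterval → ChordBundle N} (h : IsHorizontal γ Φ) {z : ℝ → Conf N}
    (hz : IsC1Lift γ z) :
    ∃ φ : ℝ → ChordSeries N, (∀ t : unitInterval, Φ t = ⟦(z t, φ t)⟧) ∧
      ∀ t ∈ Icc (0 : ℝ) 1, ∀ d : Chord (Fin N) →₀ ℕ,
        HasDerivWithinAt (fun u => MvPowerSeries.coeff d (φ u))
          (MvPowerSeries.coeff d (kzForm (z t).1 (velocity z t) * φ t)) (Icc 0 1) t := by
  obtain ⟨z', φ, hz', hΦ, hφ⟩ := h
  obtain ⟨s, hs⟩ := hz'.exists_perm hz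
  refine ⟨fun t => permSeries s (φ t), fun t => ?_, fun t ht d => ?_⟩
  · rw [hΦ]
    exact Quotient.sound ⟨s, hs t t.2, rfl⟩
  · rw [← permSeries_kzForm (hs t ht) (velocity_of_perm hz' hz hs ht), ← permSeries_mul_series]
    exact hasDerivWithinAt_permSeries s (hφ t ht) d

/-- The symmetric group acts freely on configurations of distinct points, so each fibre of the
quotient bundle is still the whole algebra of series. -/
theorem eq_of_bundle_eq {N : ℕ} {Z : Conf N} {f g : ChordSeries N}
    (h : (⟦(Z, f)⟧ : ChordBundle N) = ⟦(Z, g)⟧) : f = g := by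
  obtain ⟨s, h1, h2⟩ := Quotient.exact h
  have : s = 1 := by
    ext1 i
    exact Z.2 (h1 i)
  rw [this, permSeries_one] at h2
  exact h2.symm

/-- The section is explicit: the exponential of the integral of the form up to time `t`, times `ψ₀`.
For uniqueness a competitor is first written over the same lift `z`. -/
theorem holonomy_eq_kzExp {N : ℕ} {x y : UConf N} (γ : Path x y) (z : ℝ → Conf N)
    (hz : IsC1Lift γ z) (ψ₀ : ChordSeries N) : ∃ Ψ : unitInterval → ChordBundle N,
      (∀ t, (Ψ t).proj = γ t) ∧ IsHorizontal γ Ψ ∧ Ψ 0 = ⟦(z 0, ψ₀)⟧ ∧ Ψ 1 = ⟦(z 1, kzExp z * ψ₀)⟧ ∧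
      ∀ Φ : unitInterval → ChordBundle N, IsHorizontal γ Φ → Φ 0 = Ψ 0 → Φ = Ψ := by
  set ψ : ℝ → ChordSeries N := fun t => expSeries (kzCoeff z t) * ψ₀
  have hψ : ∀ t ∈ Icc (0 : ℝ) 1, ∀ d : Chord (Fin N) →₀ ℕ,
      HasDerivWithinAt (fun u => MvPowerSeries.coeff d (ψ u))
        (MvPowerSeries.coeff d (kzForm (z t).1 (velocity z t) * ψ t)) (Icc 0 1) t := by
    intro t ht d
    have h := HasDerivWithinAt.coeff_mul (g := fun _ => ψ₀) (g' := 0)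
      (hasDerivWithinAt_expSeries fun P => hasDerivWithinAt_kzCoeff hz P ht)
      (fun d => by simpa using hasDerivWithinAt_const ..) d
    rwa [mul_zero, add_zero, mul_assoc, ← kzForm_eq_linearSeries] at h
  have hψ0 : ψ 0 = ψ₀ := by
    have : kzCoeff z 0 = 0 := by funext P; simp [kzCoeff]
    simp only [ψ, this, expSeries_zero, one_mul]
  refine ⟨fun t => ⟦(z t, ψ t)⟧, fun t => (hz.2 t).symm, ⟨z, ψ, hz, fun _ => rfl, hψ⟩, ?_, ?_,
    fun Φ hΦ h0 => ?_⟩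
  · simp only [Icc.coe_zero, hψ0]
  · simp only [Icc.coe_one, kzExp_eq_expSeries hz, ψ]
  · obtain ⟨φ, h1, h2⟩ := hΦ.exists_series hz
    have h3 : φ 0 = ψ 0 := eq_of_bundle_eq (Z := z 0) (by simpa [h1] using h0)
    funext t
    rw [h1, eq_of_hasDerivWithinAt_mul (fun t => constantCoeff_kzForm _ _) h2 hψ h3 t.2]

/-! ### Iterated integrals over the simplex -/

/-- Each hyperplane `T i = T j` is a proper subspace, hence a null set; almost every point of a cube
thus lies in the interior of one simplex. -/
theorem ae_injective (m : ℕ) : ∀ᵐ T : Fin m → ℝ, Function.Injective T := by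
  have h : ∀ i j : Fin m, i ≠ j → ∀ᵐ T : Fin m → ℝ, T i ≠ T j := by
    intro i j hij
    have h0 := Measure.addHaar_submodule (volume : Measure (Fin m → ℝ))
      (LinearMap.ker (LinearMap.proj (R := ℝ) (φ := fun _ : Fin m => ℝ) i - LinearMap.proj j)) (by
        intro htop
        have : Pi.single i (1 : ℝ) ∈ LinearMap.ker
            (LinearMap.proj (R := ℝ) (φ := fun _ : Fin m => ℝ) i - LinearMap.proj j) := by
          rw [htop]; trivial
        simp [hij.symm] at this)
    rw [ae_iff]
    convert h0 using 2
    ext T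
    simp [sub_eq_zero]
  have h' : ∀ᵐ T : Fin m → ℝ, ∀ i j : Fin m, i ≠ j → T i ≠ T j :=
    ae_all_iff.2 fun i => ae_all_iff.2 fun j => by
      by_cases hij : i = j
      · simp [hij]
      · filter_upwards [h i j hij] with T hT _ using hT
  filter_upwards [h'] with T hT i j hij
  by_contra hne
  exact hT i j hne hij

theorem measurableSet_strictMono (m : ℕ) : MeasurableSet {T : Fin m → ℝ | StrictMono T} := by
  have : {T : Fin m → ℝ | StrictMono T} = ⋂ i, ⋂ j, ⋂ _ : i < j, {T | T i < T j} := by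
    ext T; simp [StrictMono]
  rw [this]
  exact MeasurableSet.iInter fun i => MeasurableSet.iInter fun j => MeasurableSet.iInter fun _ =>
    measurableSet_lt (measurable_pi_apply i) (measurable_pi_apply j)

/-- The integrals over the simplices into which a cube is cut add up to the integral over the
cube. -/
theorem sum_perm_integral_strictMono {m : ℕ} (f : Fin m → ℝ → ℂ) (hf : ∀ k, Integrable (f k)) :
    ∑ σ : Equiv.Perm (Fin m), ∫ T in {T : Fin m → ℝ | StrictMono T}, ∏ k, f (σ k) (T k) =
      ∏ k, ∫ t, f k t := by
  rw [← integral_fintype_prod_volume_eq_prod]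
  have hint : Integrable fun T : Fin m → ℝ => ∏ k, f k (T k) := Integrable.fintype_prod hf
  have h1 : ∀ σ : Equiv.Perm (Fin m),
      ∫ T in {T : Fin m → ℝ | StrictMono T}, ∏ k, f (σ k) (T k) =
        ∫ T : Fin m → ℝ, {T | StrictMono (T ∘ σ)}.indicator (fun T => ∏ k, f k (T k)) T := by
    intro σ
    -- Permuting coordinates preserves volume. It moves the permutation from the integrand to the
    -- domain, so that all terms become integrals of the same function.
    have hmp := volume_measurePreserving_piCongrLeft (fun _ : Fin m => ℝ) σ
    rw [← integral_indicator (measurableSet_strictMono m),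
      ← hmp.integral_comp (MeasurableEquiv.measurableEmbedding _)
        ({T | StrictMono (T ∘ σ)}.indicator fun T => ∏ k, f k (T k))]
    congr 1
    funext T
    have hT : (MeasurableEquiv.piCongrLeft (fun _ : Fin m => ℝ) σ T) ∘ σ = T := by
      funext k
      exact Equiv.piCongrLeft_apply_apply (fun _ : Fin m => ℝ) σ T k
    simp only [indicator, mem_ofPred_eq, hT]
    congr 1
    rw [← Equiv.prod_comp σ fun k => f k _]
    refine Finset.prod_congr rfl fun k _ => ?_
    rw [← congrFun hT k]; rfl
  have hmeas : ∀ σ : Equiv.Perm (Fin m), MeasurableSet {T : Fin m → ℝ | StrictMono (T ∘ σ)} :=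
    fun σ => (measurableSet_strictMono m).preimage
      (measurable_pi_lambda _ fun k => measurable_pi_apply (σ k))
  simp only [h1]
  rw [← integral_finsetSum _ fun σ _ => hint.indicator (hmeas σ)]
  refine integral_congr_ae ?_
  filter_upwards [ae_injective m] with T hT
  -- A tuple with distinct entries is made increasing by exactly one permutation.
  rw [Finset.sum_eq_single (Tuple.sort T)]
  · exact indicator_of_mem
      ((Tuple.monotone_sort T).strictMono_of_injective (hT.comp (Equiv.injective _))) _
  · intro σ _ hσ
    refine indicator_of_notMem (fun h => hσ ?_) _
    have := Tuple.unique_monotone (StrictMono.monotone h) (Tuple.monotone_sort T)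
    ext1 k
    exact hT (congrFun this k)
  · simp

/-- Moves a restriction on all heights into the individual factors, so that integrals over different
height intervals can be compared factor by factor. -/
theorem setIntegral_cube {m : ℕ} (f : Fin m → ℝ → ℂ) (A : Set (Fin m → ℝ)) (hA : MeasurableSet A)
    (B : Set ℝ) (hB : MeasurableSet B) :
    ∫ T in A ∩ {T | ∀ k, T k ∈ B}, ∏ k, f k (T k) = ∫ T in A, ∏ k, B.indicator (f k) (T k) := by
  have hB' : MeasurableSet {T : Fin m → ℝ | ∀ k, T k ∈ B} := by
    have : {T : Fin m → ℝ | ∀ k, T k ∈ B} = ⋂ k, (fun T => T k) ⁻¹' B := by ext; simp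
    rw [this]
    exact MeasurableSet.iInter fun k => hB.preimage (measurable_pi_apply k)
  rw [← integral_indicator (hA.inter hB'), ← integral_indicator hA]
  congr 1
  funext T
  by_cases h1 : T ∈ A
  · by_cases h2 : ∀ k, T k ∈ B
    · rw [indicator_of_mem (show T ∈ A ∩ {T | ∀ k, T k ∈ B} from ⟨h1, h2⟩), indicator_of_mem h1]
      exact Finset.prod_congr rfl fun k _ => (indicator_of_mem (h2 k) _).symm
    · rw [indicator_of_notMem (fun h => h2 h.2), indicator_of_mem h1]
      push Not at h2
      obtain ⟨k, hk⟩ := h2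
      exact (Finset.prod_eq_zero (Finset.mem_univ k) (indicator_of_notMem hk _)).symm
  · rw [indicator_of_notMem (fun h => h1 h.1), indicator_of_notMem h1]

theorem kzIterated_eq {N : ℕ} (z : ℝ → Conf N) {m : ℕ} (P : Fin m → Chord (Fin N)) :
    kzIterated z P = ((2 * Real.pi * Complex.I) ^ m)⁻¹ * ∫ T in {T : Fin m → ℝ | StrictMono T},
      ∏ k, (Icc (0 : ℝ) 1).indicator (fun t => dlogDiff (z t).1 (velocity z t) (P k)) (T k) := by
  rw [kzIterated, ← setIntegral_cube (fun k t => dlogDiff (z t).1 (velocity z t) (P k)) _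
    (measurableSet_strictMono m) _ measurableSet_Icc]
  rfl

theorem sum_perm_kzIterated {N : ℕ} {x y : UConf N} {γ : Path x y} {z : ℝ → Conf N}
    (hz : IsC1Lift γ z) {m : ℕ} (P : Fin m → Chord (Fin N)) :
    ∑ σ : Equiv.Perm (Fin m), kzIterated z (P ∘ σ) = ∏ k, kzCoeff z 1 (P k) := by
  simp only [kzIterated_eq, Function.comp_apply]
  rw [← Finset.mul_sum, sum_perm_integral_strictMono (fun k => (Icc (0 : ℝ) 1).indicator
    fun t => dlogDiff (z t).1 (velocity z t) (P k))]
  · simp only [kzCoeff, Finset.prod_mul_distrib, Finset.prod_const, Finset.card_univ,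
      Fintype.card_fin, inv_pow]
    congr 1
    refine Finset.prod_congr rfl fun k _ => ?_
    rw [integral_indicator measurableSet_Icc, intervalIntegral.integral_of_le zero_le_one,
      integral_Icc_eq_integral_Ioc]
  · intro k
    exact ((continuousOn_dlogDiff hz (P k)).integrableOn_compact isCompact_Icc).integrable_indicator
      measurableSet_Icc

/-- The monomial of `P` does not depend on the order of its chords, so the sum over words is
unchanged when each integral is replaced by one for a permuted word. Summing over the `m!`
permutations yields products of full integrals, and `m!` cancels the factorial of the exponential.
-/
theorem coeff_kzExp {N : ℕ} {x y : UConf N} {γ : Path x y} {z : ℝ → Conf N}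
    (hz : IsC1Lift γ z) (m : ℕ) (d : Chord (Fin N) →₀ ℕ) (hd : d.degree = m) :
    MvPowerSeries.coeff d (kzExp z) = ∑ P : Fin m → Chord (Fin N), kzIterated z P *
      MvPowerSeries.coeff d (∏ k, (MvPowerSeries.X (P k) : ChordSeries N)) := by
  have hm : (m.factorial : ℂ) ≠ 0 := by exact_mod_cast m.factorial_ne_zero
  rw [kzExp_eq_expSeries hz, coeff_expSeries, hd, inv_mul_eq_iff_eq_mul₀ hm, coeff_linearSeries_pow]
  simp only [← sum_perm_kzIterated hz, Finset.sum_mul]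
  rw [Finset.sum_comm]
  have : ∀ σ : Equiv.Perm (Fin m), ∑ P : Fin m → Chord (Fin N), kzIterated z (P ∘ σ) *
      MvPowerSeries.coeff d (∏ k, (MvPowerSeries.X (P k) : ChordSeries N)) =
      ∑ P : Fin m → Chord (Fin N), kzIterated z P *
      MvPowerSeries.coeff d (∏ k, (MvPowerSeries.X (P k) : ChordSeries N)) := by
    intro σ
    refine Fintype.sum_equiv (σ.symm.arrowCongr (Equiv.refl _)) _ _ fun P => ?_
    congr 2
    exact (Equiv.prod_comp σ fun k => (MvPowerSeries.X (P k) : ChordSeries N)).symm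
  simp only [this, Finset.sum_const, Finset.card_univ, Fintype.card_perm, Fintype.card_fin,
    nsmul_eq_mul]

/-! ### The Kontsevich integral of the braid -/

theorem deriv_lift {N : ℕ} {x y : UConf N} {γ : Path x y} {z : ℝ → Conf N}
    (hz : IsC1Lift γ z) (i : Fin N) {t : ℝ} (ht : t ∈ Ioo (0 : ℝ) 1) :
    HasDerivAt (fun u => (z u).1 i) (velocity z t i) t :=
  (hasDerivWithinAt_lift hz i (Ioo_subset_Icc_self ht)).hasDerivAt (Icc_mem_nhds ht.1 ht.2)

/-- The open interval is forced: `chordForm` is zero at the ends of strands, and the two-sided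
derivative is known to be the velocity only at interior times. -/
theorem chordForm_braidStrands {N : ℕ} {x y : UConf N} {γ : Path x y} {z : ℝ → Conf N}
    (hz : IsC1Lift γ z) (P : Chord (Fin N)) : chordForm (braidStrands z) P =
      (Ioo (0 : ℝ) 1).indicator fun t => dlogDiff (z t).1 (velocity z t) P := by
  funext t
  induction P using Chord.ind with
  | _ i j h =>
    by_cases ht : t ∈ Ioo (0 : ℝ) 1
    · rw [indicator_of_mem ht, chordForm, if_pos (by intro s _; exact ht)]
      simp [chordSign, braidStrands, dlogDiff, (deriv_lift hz _ ht).deriv]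
    · rw [indicator_of_notMem ht, chordForm, if_neg]
      intro h'
      exact ht (h' i (Sym2.mem_mk_left i j))

theorem ae_apply {m : ℕ} {p : ℝ → Prop} (h : ∀ᵐ t : ℝ, p t) : ∀ᵐ T : Fin m → ℝ, ∀ k, p (T k) :=
  ae_all_iff.2 fun k => (Measure.quasiMeasurePreserving_eval (fun _ : Fin m => volume) k).ae h

theorem ae_ne (c : ℝ) : ∀ᵐ t : ℝ, t ≠ c := by
  rw [ae_iff]; simp

/-- One side uses closed and the other open height intervals; they differ on the null set where some
height is `0` or `1`. -/
theorem kzIterated_eq_pairingIntegral {N : ℕ} {x y : UConf N} {γ : Path x y} {z : ℝ → Conf N}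
    (hz : IsC1Lift γ z) {m : ℕ} (P : Fin m → Chord (Fin N)) :
    kzIterated z P = ((2 * Real.pi * Complex.I) ^ m)⁻¹ *
      pairingIntegral (braidStrands z) P univ := by
  rw [kzIterated_eq, pairingIntegral, inter_univ]
  congr 1
  refine integral_congr_ae (ae_restrict_of_ae ?_)
  filter_upwards [ae_apply (ae_ne 0), ae_apply (ae_ne 1)] with T h0 h1
  refine Finset.prod_congr rfl fun k _ => ?_
  rw [chordForm_braidStrands hz]
  by_cases h : T k ∈ Icc (0 : ℝ) 1
  · rw [indicator_of_mem h, indicator_of_mem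
      (show T k ∈ Ioo (0 : ℝ) 1 from ⟨lt_of_le_of_ne h.1 (h0 k).symm, lt_of_le_of_ne h.2 (h1 k)⟩)]
  · rw [indicator_of_notMem h, indicator_of_notMem fun h' => h (Ioo_subset_Icc_self h')]

theorem liftedHolonomy_eq_kontsevichTangle {N : ℕ} {x y : UConf N} {γ : Path x y}
    {z : ℝ → Conf N} (hz : IsC1Lift γ z) (m : ℕ) :
    liftedHolonomy z m = kontsevichTangle (braidStrands z) m := by
  rw [liftedHolonomy, kontsevichTangle, Finset.smul_sum]
  refine Finset.sum_congr rfl fun P _ => ?_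
  rw [kzIterated_eq_pairingIntegral hz, mul_smul]
  rfl

theorem closeMap_liftedHolonomy {N : ℕ} {x y : UConf N} {γ : Path x y}
    {z : ℝ → Conf N} (hz : IsC1Lift γ z) (s : Equiv.Perm (Fin N)) (m : ℕ) :
    closeMap s m (liftedHolonomy z m) = kontsevichLink (braidStrands z) s m := by
  rw [liftedHolonomy_eq_kontsevichTangle hz, kontsevichTangle, map_smul, map_sum, kontsevichLink,
    kontsevichPart]
  congr 1
  exact Finset.sum_congr rfl fun P _ => map_smul ..

/-! ### Diagrams with an isolated chord -/

theorem glueMap_chordDiagram {ι κ : Type} [Fintype ι] [Fintype κ] {pieces : κ → List (ι ⊕ List ℕ)}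
    {r : ℕ ↪ ℕ} {d m n : ℕ} (h : IsGluing pieces r d) (hm : m + d = n) (C : Set κ)
    (w : ι → List ℕ) :
    glueMap h hm C (chordDiagram ∅ m w) = chordDiagram C n (glueWord pieces r w) := by
  simp [glueMap, chordDiagram, Submodule.mapQ_apply, Finsupp.mapDomain_single]

theorem chordDiagram_eq_zero {κ : Type} [Fintype κ] {C : Set κ} {m : ℕ} {w : κ → List ℕ}
    (h : Finsupp.single w 1 ∈ chordRelSpan C m) : chordDiagram C m w = 0 :=
  (Submodule.Quotient.mk_eq_zero _).2 h

theorem chordDiagram_eq {κ : Type} [Fintype κ] {C : Set κ} {m : ℕ} {w w' : κ → List ℕ}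
    (h : Finsupp.single w 1 - Finsupp.single w' 1 ∈ chordRelSpan C m) :
    chordDiagram C m w = chordDiagram C m w' :=
  (Submodule.Quotient.eq _).2 h

theorem chordDiagram_relabel {κ : Type} [Fintype κ] (C : Set κ) (m : ℕ) (w : κ → List ℕ)
    (r : Equiv.Perm ℕ) : chordDiagram C m w = chordDiagram C m fun k => (w k).map r :=
  chordDiagram_eq (Submodule.subset_span (.relabel w r))

theorem pieceWord_refl {ι : Type} (w : ι → List ℕ) (i : ι) :
    pieceWord (Function.Embedding.refl ℕ) w (Sum.inl i) = w i := by
  exact List.map_id _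

/-- A chord with one foot at the end of a strand, and the other one at the start of the next strand,
is isolated. -/
theorem closeMap_eq_zero {ι : Type} [Fintype ι] (p : Equiv.Perm ι) (m : ℕ) (w : ι → List ℕ) (i : ι)
    (hi : p i ≠ i) (l : ℕ) (hu : ∃ u, w i = u ++ [l]) (hv : ∃ v, w (p i) = l :: v) :
    closeMap p m (chordDiagram ∅ m w) = 0 := by
  classical
  obtain ⟨u, hu⟩ := hu
  obtain ⟨v, hv⟩ := hv
  rw [closeMap, glueMap_chordDiagram]
  set W := glueWord (cyclePieces p) (Function.Embedding.refl ℕ) w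
  set c : Cycles p := ⟦i⟧
  set n := Function.minimalPeriod p c.out
  have hn : 0 < n := Function.minimalPeriod_pos_of_mem_periodicPts
    (p.injective.mem_periodicPts _)
  obtain ⟨j, hj, hij⟩ : ∃ j < n, p^[j] c.out = i := by
    have h : p.SameCycle c.out i := Quotient.exact (Quotient.out_eq c)
    obtain ⟨a, -, ha⟩ := Equiv.Perm.SameCycle.exists_pow_eq' h
    refine ⟨a % n, Nat.mod_lt _ hn, ?_⟩
    rw [Function.iterate_mod_minimalPeriod_eq, Equiv.Perm.iterate_eq_pow, ha]
  have hnext : p^[j + 1] c.out = p i := by rw [Function.iterate_succ_apply', hij]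
  have hW : W c = (List.range n).flatMap fun k => w (p^[k] c.out) := by
    simp only [W, glueWord, cyclePieces, List.flatMap_map, pieceWord_refl, n]
  -- Reading the circle from `c.out`, the strands `i` and `p i` are either consecutive in the word
  -- or the last and the first.
  rcases lt_or_eq_of_le (Nat.succ_le_of_lt hj) with hlt | heq
  · refine chordDiagram_eq_zero (Submodule.subset_span (.isolated W c
      (((List.range j).flatMap fun k => w (p^[k] c.out)) ++ u)
      (v ++ ((List.range (n - (j + 2))).flatMap fun k => w (p^[j + 2 + k] c.out))) l ?_))
    have hr : List.range n = List.range j ++ [j, j + 1] ++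
        (List.range (n - (j + 2))).map (j + 2 + ·) := by
      conv_lhs => rw [show n = j + 1 + 1 + (n - (j + 2)) by omega, List.range_add, List.range_succ,
        List.range_succ]
      simp [add_assoc]
    rw [hW, hr]
    simp [List.flatMap_append, List.flatMap_map, hij, hnext, hu, hv]
  -- If `j = 0` the circle consists of a single strand, against `p i ≠ i`.
  · have hj0 : j ≠ 0 := by
      rintro rfl
      have h1 : p^[n] c.out = c.out := Function.iterate_minimalPeriod
      rw [← heq, hnext, ← hij, Function.iterate_zero, id] at h1
      rw [← hij] at hi
      exact hi h1
    have hfirst : p^[0] c.out = p i := by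
      rw [← hnext, show j + 1 = n from heq]
      exact (Function.iterate_minimalPeriod (f := p) (x := c.out)).symm
    set x := (List.range (j - 1)).flatMap fun k => w (p^[k + 1] c.out)
    have hWc : W c = l :: (v ++ x ++ u ++ [l]) := by
      have hr : List.range n = 0 :: ((List.range (j - 1)).map (· + 1) ++ [j]) := by
        conv_lhs => rw [← show j + 1 = n from heq, List.range_succ,
          show j = (j - 1) + 1 by omega, List.range_succ_eq_map]
        simp only [List.cons_append]
        congr 3
        omega
      rw [hW, hr]
      simp only [List.flatMap_cons, List.flatMap_append, List.flatMap_map, hfirst, hij, hu, hv,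
        List.flatMap_nil, List.append_nil, List.cons_append, List.append_assoc, x]
    -- Moving the starting point past the first foot brings the two feet together at the end of the
    -- word.
    rw [chordDiagram_eq (Submodule.subset_span (.rotate W c l _ (mem_univ c) hWc))]
    refine chordDiagram_eq_zero (Submodule.subset_span (.isolated _ c (v ++ x ++ u) [] l ?_))
    simp

theorem strandWord_first {ι : Type} (up : ι → Bool) {m : ℕ} (P : Fin m → Chord ι) (k : Fin m)
    (hk : (k : ℕ) = 0) (s : ι) (hs : s ∈ (P k).1) :
    (up s = true → ∃ v, strandWord up P s = 0 :: v) ∧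
      (up s = false → ∃ u, strandWord up P s = u ++ [0]) := by
  classical
  obtain ⟨m, rfl⟩ : ∃ n, m = n + 1 := ⟨m - 1, by have := k.2; omega⟩
  obtain rfl : k = 0 := Fin.ext hk
  constructor <;> intro h <;> simp [strandWord, h, List.finRange_succ, hs]

theorem strandWord_last {ι : Type} (up : ι → Bool) {m : ℕ} (P : Fin m → Chord ι) (k : Fin m)
    (hk : (k : ℕ) + 1 = m) (s : ι) (hs : s ∈ (P k).1) :
    (up s = true → ∃ u, strandWord up P s = u ++ [(k : ℕ)]) ∧
      (up s = false → ∃ v, strandWord up P s = (k : ℕ) :: v) := by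
  classical
  obtain ⟨m, rfl⟩ : ∃ n, m = n + 1 := ⟨k, hk.symm⟩
  obtain rfl : k = Fin.last m := Fin.ext (by simpa using hk)
  constructor <;> intro h <;> simp [strandWord, h, List.finRange_succ_last, hs]

theorem closureNext_inl {N : ℕ} (s : Equiv.Perm (Fin N)) (i : Fin N) :
    closureNext s (Sum.inl i) = Sum.inr (s i) := rfl

theorem closureNext_inr {N : ℕ} (s : Equiv.Perm (Fin N)) (n : Fin N) :
    closureNext s (Sum.inr n) = Sum.inl n := rfl

/-- The lowest chord is the last one met on the descending leg and the first one met on the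
ascending leg that follows it. If it joins the two legs of a minimum, it is isolated. -/
theorem linkDiagram_eq_zero_of_first {N : ℕ} (S : Strands (Fin N ⊕ Fin N)) (hS : S.up = Sum.isLeft)
    (s : Equiv.Perm (Fin N)) {m : ℕ} (P : Fin m → Chord (Fin N ⊕ Fin N)) (k : Fin m)
    (hk : (k : ℕ) = 0) (n : Fin N) (hn : (P k).1 = s(Sum.inl n, Sum.inr n)) :
    linkDiagram S (closureNext s) P = 0 := by
  obtain ⟨u, hu⟩ := (strandWord_first S.up P k hk (Sum.inr n) (by simp [hn])).2 (by simp [hS])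
  obtain ⟨v, hv⟩ := (strandWord_first S.up P k hk (Sum.inl n) (by simp [hn])).1 (by simp [hS])
  exact closeMap_eq_zero _ m _ (Sum.inr n) (by simp [closureNext_inr]) 0 ⟨u, hu⟩ ⟨v, hv⟩

/-- At the maxima the ascending leg `i` continues into the descending leg `s i`, whence the
permutation in the hypothesis. -/
theorem linkDiagram_eq_zero_of_last {N : ℕ} (S : Strands (Fin N ⊕ Fin N)) (hS : S.up = Sum.isLeft)
    (s : Equiv.Perm (Fin N)) {m : ℕ} (P : Fin m → Chord (Fin N ⊕ Fin N)) (k : Fin m)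
    (hk : (k : ℕ) + 1 = m) (i : Fin N) (hi : (P k).1 = s(Sum.inl i, Sum.inr (s i))) :
    linkDiagram S (closureNext s) P = 0 := by
  obtain ⟨u, hu⟩ := (strandWord_last S.up P k hk (Sum.inl i) (by simp [hi])).1 (by simp [hS])
  obtain ⟨v, hv⟩ := (strandWord_last S.up P k hk (Sum.inr (s i)) (by simp [hi])).2 (by simp [hS])
  exact closeMap_eq_zero _ m _ (Sum.inl i) (by simp [closureNext_inl]) k ⟨u, hu⟩ ⟨v, hv⟩

theorem chordSpace_hom_eq_zero {ι M : Type} [Fintype ι] [AddCommGroup M] [Module ℂ M] {C : Set ι}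
    {m : ℕ} (f : ChordSpace C m →ₗ[ℂ] M) (h : ∀ w, f (chordDiagram C m w) = 0) : f = 0 := by
  refine Submodule.linearMap_qext _ (Finsupp.lhom_ext' fun w => LinearMap.ext_ring ?_)
  exact h w

theorem graftMap_chordDiagram {N a b k m : ℕ} (s : Equiv.Perm (Fin N))
    (Q : Fin b → Chord (Fin N ⊕ Fin N)) (Q' : Fin a → Chord (Fin N ⊕ Fin N)) (hm : k + (b + a) = m)
    (w : Fin N → List ℕ) : graftMap s Q Q' hm (chordDiagram ∅ k w) =
      closeMap (closureNext s) m (chordDiagram ∅ m (glueWord (closurePieces Q Q') braidLabel w)) := by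
  rw [graftMap, LinearMap.comp_apply, glueMap_chordDiagram]

theorem glueWord_closurePieces_inl {N a b : ℕ} (Q : Fin b → Chord (Fin N ⊕ Fin N))
    (Q' : Fin a → Chord (Fin N ⊕ Fin N)) (w : Fin N → List ℕ) (i : Fin N) :
    glueWord (closurePieces Q Q') braidLabel w (Sum.inl i) =
      (strandWord Sum.isLeft Q (Sum.inl i)).map (fun l => 3 * l + 1) ++
        ((w i).map (fun l => 3 * l) ++
          (strandWord Sum.isLeft Q' (Sum.inl i)).map fun l => 3 * l + 2) := by
  simp only [glueWord, closurePieces, List.flatMap_cons, List.flatMap_nil, pieceWord,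
    List.append_nil]
  rfl

theorem glueWord_closurePieces_inr {N a b : ℕ} (Q : Fin b → Chord (Fin N ⊕ Fin N))
    (Q' : Fin a → Chord (Fin N ⊕ Fin N)) (w : Fin N → List ℕ) (n : Fin N) :
    glueWord (closurePieces Q Q') braidLabel w (Sum.inr n) =
      (strandWord Sum.isLeft Q' (Sum.inr n)).map (fun l => 3 * l + 2) ++
        (strandWord Sum.isLeft Q (Sum.inr n)).map fun l => 3 * l + 1 := by
  simp [glueWord, closurePieces, pieceWord]

/-- The feet of `Q` are outermost at the minima, so the lowest chord stays isolated whatever diagram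
is placed on the braid; the whole grafting map vanishes. -/
theorem graftMap_eq_zero_of_first {N a b k m : ℕ} (s : Equiv.Perm (Fin N))
    (Q : Fin b → Chord (Fin N ⊕ Fin N)) (Q' : Fin a → Chord (Fin N ⊕ Fin N)) (hm : k + (b + a) = m)
    (j : Fin b) (hj : (j : ℕ) = 0) (n : Fin N) (hn : (Q j).1 = s(Sum.inl n, Sum.inr n)) :
    graftMap s Q Q' hm = 0 := by
  refine chordSpace_hom_eq_zero _ fun w => ?_
  obtain ⟨u, hu⟩ := (strandWord_first Sum.isLeft Q j hj (Sum.inr n) (by simp [hn])).2 (by simp)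
  obtain ⟨v, hv⟩ := (strandWord_first Sum.isLeft Q j hj (Sum.inl n) (by simp [hn])).1 (by simp)
  rw [graftMap_chordDiagram]
  -- The label `1` is `3 * 0 + 1`, that of the first chord of `Q`.
  refine closeMap_eq_zero _ m _ (Sum.inr n) (by simp [closureNext_inr]) 1 ?_ ?_
  · rw [glueWord_closurePieces_inr, hu, List.map_append, ← List.append_assoc]
    exact ⟨_, rfl⟩
  · rw [closureNext_inr, glueWord_closurePieces_inl, hv, List.map_cons, List.cons_append]
    exact ⟨_, rfl⟩

theorem graftMap_eq_zero_of_last {N a b k m : ℕ} (s : Equiv.Perm (Fin N))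
    (Q : Fin b → Chord (Fin N ⊕ Fin N)) (Q' : Fin a → Chord (Fin N ⊕ Fin N)) (hm : k + (b + a) = m)
    (j : Fin a) (hj : (j : ℕ) + 1 = a) (i : Fin N) (hi : (Q' j).1 = s(Sum.inl i, Sum.inr (s i))) :
    graftMap s Q Q' hm = 0 := by
  refine chordSpace_hom_eq_zero _ fun w => ?_
  obtain ⟨u, hu⟩ := (strandWord_last Sum.isLeft Q' j hj (Sum.inl i) (by simp [hi])).1 (by simp)
  obtain ⟨v, hv⟩ := (strandWord_last Sum.isLeft Q' j hj (Sum.inr (s i)) (by simp [hi])).2 (by simp)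
  rw [graftMap_chordDiagram]
  refine closeMap_eq_zero _ m _ (Sum.inl i) (by simp [closureNext_inl]) (3 * j + 2) ?_ ?_
  · rw [glueWord_closurePieces_inl, hu, List.map_append, ← List.append_assoc, ← List.append_assoc]
    exact ⟨_, rfl⟩
  · rw [closureNext_inl, glueWord_closurePieces_inr, hv, List.map_cons, List.cons_append]
    exact ⟨_, rfl⟩

/-! ### The chord forms on the closing arcs -/

theorem chordForm_congr {ι : Type} {S S' : Strands ι} (hlo : S.lo = S'.lo) (hhi : S.hi = S'.hi)
    (hup : S.up = S'.up) {t : ℝ} (h : ∀ j, S.pos j =ᶠ[𝓝 t] S'.pos j) (P : Chord ι) :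
    chordForm S P t = chordForm S' P t := by
  have h1 : (fun s => S.pos s t) = fun s => S'.pos s t := funext fun j => (h j).eq_of_nhds
  have h2 : (fun s => deriv (S.pos s) t) = fun s => deriv (S'.pos s) t :=
    funext fun j => (h j).deriv_eq
  rw [chordForm, chordForm, hlo, hhi, hup, h1, h2]

theorem norm_chordForm_le {ι : Type} (S : Strands ι) (i j : ι) (h : ¬ (s(i, j) : Sym2 ι).IsDiag)
    (t : ℝ) : ‖chordForm S ⟨s(i, j), h⟩ t‖ ≤
      ‖(deriv (S.pos i) t - deriv (S.pos j) t) / (S.pos i t - S.pos j t)‖ := by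
  rw [chordForm]
  split_ifs
  · rw [norm_mul]
    refine (mul_le_of_le_one_left (norm_nonneg _) ?_).trans_eq rfl
    simp only [chordSign, Sym2.lift_mk]
    split_ifs <;> simp
  · rw [norm_zero]
    exact norm_nonneg _

/-- `A` and `B` stand for the separation of the two legs of an arc and its derivative, with `q` the
square root of the distance to the critical height. -/
theorem norm_div_le_of_im {A B : ℂ} {R q : ℝ} (hR : 0 < R) (hq : 0 < q) (hA : |A.im| = R * q)
    (hB : ‖B‖ = R / (2 * q)) : ‖B / A‖ ≤ (q ^ 2)⁻¹ := by
  have h1 : R * q ≤ ‖A‖ := hA ▸ A.abs_im_le_norm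
  rw [norm_div, hB]
  calc R / (2 * q) / ‖A‖ ≤ R / (2 * q) / (R * q) := by gcongr
    _ = (q ^ 2)⁻¹ / 2 := by field_simp
    _ ≤ (q ^ 2)⁻¹ := half_le_self (by positivity)

/-- From `‖A‖ ≥ 1` and `‖A‖ ≥ R q` follows `‖A‖ ≥ (R q) ^ (3/4)`. The exponent `3/4` keeps a
positive power of `q` as a gain, at the cost of only `R ^ (1/4)`. -/
theorem norm_div_le_of_re_im {A B : ℂ} {R q : ℝ} (hR : 0 < R) (hq : 0 < q) (hA : |A.im| = R * q)
    (hA' : 1 ≤ |A.re|) (hB : ‖B‖ = R / (2 * q)) :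
    ‖B / A‖ ≤ (q ^ 2)⁻¹ * (R * q) ^ (1 / 4 : ℝ) := by
  have hx : 0 < R * q := by positivity
  have h1 : R * q ≤ ‖A‖ := hA ▸ A.abs_im_le_norm
  have h2 : 1 ≤ ‖A‖ := hA'.trans A.abs_re_le_norm
  have h3 : (R * q) ^ (3 / 4 : ℝ) ≤ ‖A‖ := by
    rcases le_total (R * q) 1 with h | h
    · exact (Real.rpow_le_one hx.le h (by norm_num)).trans h2
    · refine le_trans ?_ h1
      conv_rhs => rw [← Real.rpow_one (R * q)]
      exact Real.rpow_le_rpow_of_exponent_le h (by norm_num)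
  have h4 : (R * q) ^ (3 / 4 : ℝ) * (R * q) ^ (1 / 4 : ℝ) = R * q := by
    rw [← Real.rpow_add hx]; norm_num
  have h5 : 0 < (R * q) ^ (3 / 4 : ℝ) := by positivity
  rw [norm_div, hB]
  calc R / (2 * q) / ‖A‖ ≤ R / (2 * q) / (R * q) ^ (3 / 4 : ℝ) := by gcongr
    _ = (q ^ 2)⁻¹ * (R * q) ^ (1 / 4 : ℝ) / 2 := by
      rw [div_eq_iff h5.ne']
      calc R / (2 * q) = (q ^ 2)⁻¹ * (R * q) / 2 := by field_simp
        _ = (q ^ 2)⁻¹ * ((R * q) ^ (3 / 4 : ℝ) * (R * q) ^ (1 / 4 : ℝ)) / 2 := by rw [h4]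
        _ = _ := by ring
    _ ≤ (q ^ 2)⁻¹ * (R * q) ^ (1 / 4 : ℝ) := half_le_self (by positivity)

/-- The height `0` is excluded because the real part of the leg `inl i` jumps there from `i` to `s
i`; elsewhere it is locally constant. -/
theorem hasDerivAt_closing_inl {N : ℕ} (s : Equiv.Perm (Fin N)) {R r t : ℝ} (ht : t ≠ 0)
    (h : HasDerivAt (arcRadius R) r t) (i : Fin N) :
    HasDerivAt ((closingStrands s R).pos (Sum.inl i)) (((-r : ℝ) : ℂ) * Complex.I) t := by
  have h1 : HasDerivAt (fun u => (((if t < 0 then i else s i : Fin N) : ℕ) : ℂ) +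
      ((R / 2 - arcRadius R u : ℝ) : ℂ) * Complex.I) (((-r : ℝ) : ℂ) * Complex.I) t :=
    ((h.const_sub (R / 2)).ofReal_comp.mul_const _).const_add _
  refine h1.congr_of_eventuallyEq ?_
  rcases lt_or_gt_of_ne ht with h0 | h0
  · filter_upwards [Iio_mem_nhds h0] with u hu
    simp [closingStrands, h0, mem_Iio.1 hu]
  · filter_upwards [Ioi_mem_nhds h0] with u hu
    simp [closingStrands, h0.not_gt, (mem_Ioi.1 hu).not_gt]

theorem hasDerivAt_closing_inr {N : ℕ} (s : Equiv.Perm (Fin N)) {R r t : ℝ}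
    (h : HasDerivAt (arcRadius R) r t) (n : Fin N) :
    HasDerivAt ((closingStrands s R).pos (Sum.inr n)) ((r : ℂ) * Complex.I) t :=
  ((h.const_add (R / 2)).ofReal_comp.mul_const _).const_add _

theorem one_le_abs_natCast_sub {a b : ℕ} (h : a ≠ b) : 1 ≤ |(a : ℝ) - b| := by
  have : (1 : ℤ) ≤ |(a : ℤ) - b| := Int.one_le_abs (by omega)
  exact_mod_cast this

/-- Common estimate for both ends of the closure. The exceptional chords are those joining the two
legs of one arc; for any other pair of opposite legs the real parts are distinct integers, so they
differ by at least `1`. -/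
theorem norm_chordForm_closing {N : ℕ} (s : Equiv.Perm (Fin N)) {R t q r : ℝ} (hR : 0 < R)
    (hq : 0 < q) (ht : t ≠ 0) (hrad : arcRadius R t = R / 2 * q)
    (hr : HasDerivAt (arcRadius R) r t) (hr' : |r| = R / (4 * q)) (P : Chord (Fin N ⊕ Fin N)) :
    ‖chordForm (closingStrands s R) P t‖ ≤ (q ^ 2)⁻¹ ∧
      ((∀ n, P.1 ≠ s(Sum.inl n, Sum.inr (if t < 0 then n else s n))) →
        ‖chordForm (closingStrands s R) P t‖ ≤ (q ^ 2)⁻¹ * (R * q) ^ (1 / 4 : ℝ)) := by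
  have hmixed : ∀ (i n : Fin N) (h : ¬ (s(Sum.inl i, Sum.inr n) : Sym2 (Fin N ⊕ Fin N)).IsDiag),
      ‖chordForm (closingStrands s R) ⟨s(Sum.inl i, Sum.inr n), h⟩ t‖ ≤ (q ^ 2)⁻¹ ∧
      ((∀ k, s(Sum.inl i, Sum.inr n) ≠ s(Sum.inl k, Sum.inr (if t < 0 then k else s k))) →
        ‖chordForm (closingStrands s R) ⟨s(Sum.inl i, Sum.inr n), h⟩ t‖ ≤
          (q ^ 2)⁻¹ * (R * q) ^ (1 / 4 : ℝ)) := by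
    intro i n h
    have h0 := norm_chordForm_le (closingStrands s R) _ _ h t
    rw [(hasDerivAt_closing_inl s ht hr i).deriv, (hasDerivAt_closing_inr s hr n).deriv] at h0
    have hB : ‖((-r : ℝ) : ℂ) * Complex.I - (r : ℂ) * Complex.I‖ = R / (2 * q) := by
      have : ((-r : ℝ) : ℂ) * Complex.I - (r : ℂ) * Complex.I = ((-2 * r : ℝ) : ℂ) * Complex.I := by
        push_cast; ring
      rw [this, norm_mul, Complex.norm_I, mul_one, Complex.norm_real, Real.norm_eq_abs, abs_mul,
        hr']
      norm_num
      field_simp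
      norm_num
    have hA : (closingStrands s R).pos (Sum.inl i) t - (closingStrands s R).pos (Sum.inr n) t =
        ((((if t < 0 then i else s i : Fin N) : ℕ) : ℝ) - ((n : ℕ) : ℝ) : ℝ) +
          ((-(R * q) : ℝ) : ℂ) * Complex.I := by
      have : (if t < 0 then ((i : ℕ) : ℂ) else ((s i : ℕ) : ℂ)) =
          (((if t < 0 then i else s i : Fin N) : ℕ) : ℂ) := by split_ifs <;> rfl
      simp only [closingStrands, hrad, this]
      push_cast
      ring
    have hre : ((closingStrands s R).pos (Sum.inl i) t - (closingStrands s R).pos (Sum.inr n) t).re =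
        (((if t < 0 then i else s i : Fin N) : ℕ) : ℝ) - ((n : ℕ) : ℝ) := by rw [hA]; simp
    have him : |((closingStrands s R).pos (Sum.inl i) t -
        (closingStrands s R).pos (Sum.inr n) t).im| = R * q := by
      rw [hA]; simp [abs_of_pos hR, abs_of_pos hq]
    refine ⟨h0.trans (norm_div_le_of_im hR hq him hB), fun hlong =>
      h0.trans (norm_div_le_of_re_im hR hq him ?_ hB)⟩
    rw [hre]
    refine one_le_abs_natCast_sub fun e => hlong i ?_
    rw [Fin.ext e]
  have hzero : ∀ {p : Prop} (x : ℝ), x = 0 → x ≤ (q ^ 2)⁻¹ ∧ (p → x ≤ (q ^ 2)⁻¹ * (R * q) ^ (1 / 4 : ℝ)) := by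
    rintro p x rfl
    exact ⟨by positivity, fun _ => by positivity⟩
  induction P using Chord.ind with
  | _ i j h =>
    rcases i with i | i <;> rcases j with j | j
    -- Two ascending legs have the same velocity, so the form vanishes; likewise for two descending
    -- legs.
    · refine hzero _ (le_antisymm ?_ (norm_nonneg _))
      refine (norm_chordForm_le _ _ _ h t).trans ?_
      rw [(hasDerivAt_closing_inl s ht hr i).deriv, (hasDerivAt_closing_inl s ht hr j).deriv]
      simp
    · exact hmixed i j h
    · have e : (⟨s(Sum.inr i, Sum.inl j), h⟩ : Chord (Fin N ⊕ Fin N)) =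
          ⟨s(Sum.inl j, Sum.inr i), by rwa [Sym2.eq_swap]⟩ := Subtype.ext Sym2.eq_swap
      rw [e]
      exact hmixed j i _
    · refine hzero _ (le_antisymm ?_ (norm_nonneg _))
      refine (norm_chordForm_le _ _ _ h t).trans ?_
      rw [(hasDerivAt_closing_inr s hr i).deriv, (hasDerivAt_closing_inr s hr j).deriv]
      simp

/-- The distance to the minima, cut off at `1`. -/
def bottomGap (t : ℝ) : ℝ := min 1 (1 + t)

/-- The distance to the maxima, cut off at `1`. -/
def topGap (t : ℝ) : ℝ := min 1 (2 - t)

theorem bottomGap_of_nonneg {t : ℝ} (h : 0 ≤ t) : bottomGap t = 1 := min_eq_left (by linarith)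

theorem bottomGap_of_nonpos {t : ℝ} (h : t ≤ 0) : bottomGap t = 1 + t := min_eq_right (by linarith)

theorem topGap_of_le {t : ℝ} (h : t ≤ 1) : topGap t = 1 := min_eq_left (by linarith)

theorem topGap_of_ge {t : ℝ} (h : 1 ≤ t) : topGap t = 2 - t := min_eq_right (by linarith)

theorem bottomGap_pos {t : ℝ} (h : -1 < t) : 0 < bottomGap t := lt_min one_pos (by linarith)

theorem topGap_pos {t : ℝ} (h : t < 2) : 0 < topGap t := lt_min one_pos (by linarith)

theorem bottomGap_mono {t u : ℝ} (h : t ≤ u) : bottomGap t ≤ bottomGap u :=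
  min_le_min le_rfl (by linarith)

theorem topGap_anti {t u : ℝ} (h : t ≤ u) : topGap u ≤ topGap t :=
  min_le_min le_rfl (by linarith)

theorem arcRadius_bottom (R : ℝ) {t : ℝ} (h : t ≤ 0) : arcRadius R t = R / 2 * Real.sqrt (1 + t) := by
  rw [arcRadius, min_eq_left (show 1 + t ≤ 2 - t by linarith), min_eq_right (by linarith)]

theorem arcRadius_top (R : ℝ) {t : ℝ} (h : 1 ≤ t) : arcRadius R t = R / 2 * Real.sqrt (2 - t) := by
  rw [arcRadius, min_eq_right (show 2 - t ≤ 1 + t by linarith), min_eq_right (by linarith)]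

theorem arcRadius_middle (R : ℝ) {t : ℝ} (h : t ∈ Icc (0 : ℝ) 1) : arcRadius R t = R / 2 := by
  rw [arcRadius, min_eq_left (le_min (by linarith [h.1]) (by linarith [h.2])), Real.sqrt_one,
    mul_one]

theorem rpow_quarter_sqrt {R x : ℝ} (hR : 0 < R) (hx : 0 < x) :
    (R * Real.sqrt x) ^ (1 / 4 : ℝ) = R ^ (1 / 4 : ℝ) * x ^ (1 / 8 : ℝ) := by
  rw [Real.mul_rpow hR.le (Real.sqrt_nonneg _), Real.sqrt_eq_rpow, ← Real.rpow_mul hx.le]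
  norm_num

/-- Here `q = √(1 + t)`, so `q ^ 2` is the gap to the minima. The factor `topGap t` equals `1` at
these heights and gives the bounds near the minima and the maxima the same shape. -/
theorem norm_chordForm_bottom {N : ℕ} (s : Equiv.Perm (Fin N)) {R t : ℝ} (hR : 0 < R)
    (ht : t ∈ Ioo (-1 : ℝ) 0) (P : Chord (Fin N ⊕ Fin N)) :
    ‖chordForm (closingStrands s R) P t‖ ≤ (bottomGap t * topGap t)⁻¹ ∧
      ((∀ n, P.1 ≠ s(Sum.inl n, Sum.inr n)) → ‖chordForm (closingStrands s R) P t‖ ≤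
        (bottomGap t * topGap t)⁻¹ * (R ^ (1 / 4 : ℝ) * bottomGap t ^ (1 / 8 : ℝ))) := by
  have hx : 0 < 1 + t := by linarith [ht.1]
  have hr : HasDerivAt (arcRadius R) (R / (4 * Real.sqrt (1 + t))) t := by
    have h1 : HasDerivAt (fun u => R / 2 * Real.sqrt (1 + u)) (R / (4 * Real.sqrt (1 + t))) t := by
      refine ((((hasDerivAt_id t).const_add 1).sqrt hx.ne').const_mul (R / 2)).congr_deriv ?_
      simp only [id]
      field_simp
      norm_num
    refine h1.congr_of_eventuallyEq ?_
    filter_upwards [Iio_mem_nhds ht.2] with u hu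
    exact arcRadius_bottom R (le_of_lt hu)
  have key := norm_chordForm_closing s hR (Real.sqrt_pos.2 hx) ht.2.ne
    (arcRadius_bottom R ht.2.le) hr (abs_of_pos (by positivity)) P
  rw [Real.sq_sqrt hx.le, rpow_quarter_sqrt hR hx] at key
  simp only [if_pos ht.2] at key
  rw [bottomGap_of_nonpos ht.2.le, topGap_of_le (by linarith [ht.2]), mul_one]
  exact key

theorem norm_chordForm_top {N : ℕ} (s : Equiv.Perm (Fin N)) {R t : ℝ} (hR : 0 < R)
    (ht : t ∈ Ioo (1 : ℝ) 2) (P : Chord (Fin N ⊕ Fin N)) :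
    ‖chordForm (closingStrands s R) P t‖ ≤ (bottomGap t * topGap t)⁻¹ ∧
      ((∀ n, P.1 ≠ s(Sum.inl n, Sum.inr (s n))) → ‖chordForm (closingStrands s R) P t‖ ≤
        (bottomGap t * topGap t)⁻¹ * (R ^ (1 / 4 : ℝ) * topGap t ^ (1 / 8 : ℝ))) := by
  have hx : 0 < 2 - t := by linarith [ht.2]
  have ht0 : 0 < t := by linarith [ht.1]
  have hr : HasDerivAt (arcRadius R) (-(R / (4 * Real.sqrt (2 - t)))) t := by
    have h1 : HasDerivAt (fun u => R / 2 * Real.sqrt (2 - u)) (-(R / (4 * Real.sqrt (2 - t)))) t := by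
      refine ((((hasDerivAt_id t).const_sub 2).sqrt hx.ne').const_mul (R / 2)).congr_deriv ?_
      simp only [id]
      field_simp
      norm_num
    refine h1.congr_of_eventuallyEq ?_
    filter_upwards [Ioi_mem_nhds ht.1] with u hu
    exact arcRadius_top R (le_of_lt hu)
  have key := norm_chordForm_closing s hR (Real.sqrt_pos.2 hx) ht0.ne'
    (arcRadius_top R ht.1.le) hr (by rw [abs_neg]; exact abs_of_pos (by positivity)) P
  rw [Real.sq_sqrt hx.le, rpow_quarter_sqrt hR hx] at key
  simp only [if_neg ht0.not_gt] at key
  rw [bottomGap_of_nonneg ht0.le, topGap_of_ge ht.1.le, one_mul]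
  exact key

theorem chordForm_closure_eq_closing {N : ℕ} (z : ℝ → Conf N) (s : Equiv.Perm (Fin N)) (R : ℝ)
    {t : ℝ} (ht : t ∉ Icc (0 : ℝ) 1) (P : Chord (Fin N ⊕ Fin N)) :
    chordForm (closureStrands z s R) P t = chordForm (closingStrands s R) P t := by
  refine chordForm_congr (S := closureStrands z s R) (S' := closingStrands s R) rfl rfl rfl (fun j => ?_) P
  filter_upwards [isClosed_Icc.isOpen_compl.mem_nhds ht] with u hu
  rcases j with i | n
  · exact if_neg hu
  · rfl

/-! ### The chord forms on the middle portion of the closure -/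

theorem IsC1Lift.exists_bound {N : ℕ} {x y : UConf N} {γ : Path x y} {z : ℝ → Conf N}
    (hz : IsC1Lift γ z) : ∃ C : ℝ, 1 ≤ C ∧ ∀ t ∈ Icc (0 : ℝ) 1, (∀ i, ‖(z t).1 i‖ ≤ C) ∧
      (∀ i, ‖velocity z t i‖ ≤ C) ∧ ∀ P, ‖dlogDiff (z t).1 (velocity z t) P‖ ≤ C := by
  choose a ha using fun i => isCompact_Icc.exists_bound_of_continuousOn (continuousOn_lift hz i)
  choose b hb using fun i => isCompact_Icc.exists_bound_of_continuousOn (continuousOn_velocity hz i)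
  choose c hc using fun P => isCompact_Icc.exists_bound_of_continuousOn (continuousOn_dlogDiff hz P)
  have h1 : ∀ {ι : Type} [Fintype ι] (f : ι → ℝ) (i : ι), f i ≤ ∑ i, |f i| := fun f i =>
    (le_abs_self _).trans (Finset.single_le_sum (f := fun i => |f i|) (fun j _ => abs_nonneg _)
      (Finset.mem_univ i))
  have h0 : ∀ {ι : Type} [Fintype ι] (f : ι → ℝ), 0 ≤ ∑ i, |f i| := fun f =>
    Finset.sum_nonneg fun i _ => abs_nonneg _
  have ha0 := h0 a
  have hb0 := h0 b
  have hc0 := h0 c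
  refine ⟨1 + ∑ i, |a i| + ∑ i, |b i| + ∑ P, |c P|, by linarith, fun t ht => ⟨fun i => ?_,
    fun i => ?_, fun P => ?_⟩⟩
  · linarith [ha i t ht, h1 a i]
  · linarith [hb i t ht, h1 b i]
  · linarith [hc P t ht, h1 c P]

theorem closure_pos_inl {N : ℕ} (z : ℝ → Conf N) (s : Equiv.Perm (Fin N)) (R : ℝ) {t : ℝ}
    (ht : t ∈ Icc (0 : ℝ) 1) (i : Fin N) : (closureStrands z s R).pos (Sum.inl i) t = (z t).1 i :=
  if_pos ht

theorem closure_pos_inr {N : ℕ} (z : ℝ → Conf N) (s : Equiv.Perm (Fin N)) (R : ℝ) {t : ℝ}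
    (ht : t ∈ Icc (0 : ℝ) 1) (n : Fin N) :
    (closureStrands z s R).pos (Sum.inr n) t = ((n : ℕ) : ℂ) + (R : ℂ) * Complex.I := by
  simp only [closureStrands, closingStrands, arcRadius_middle R ht, add_halves]

theorem deriv_closure_inl {N : ℕ} {x y : UConf N} {γ : Path x y} {z : ℝ → Conf N}
    (hz : IsC1Lift γ z) (s : Equiv.Perm (Fin N)) (R : ℝ) {t : ℝ} (ht : t ∈ Ioo (0 : ℝ) 1)
    (i : Fin N) : deriv ((closureStrands z s R).pos (Sum.inl i)) t = velocity z t i := by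
  refine ((deriv_lift hz i ht).congr_of_eventuallyEq ?_).deriv
  filter_upwards [Icc_mem_nhds ht.1 ht.2] with u hu using closure_pos_inl z s R hu i

theorem deriv_closure_inr {N : ℕ} (z : ℝ → Conf N) (s : Equiv.Perm (Fin N)) (R : ℝ) {t : ℝ}
    (ht : t ∈ Ioo (0 : ℝ) 1) (n : Fin N) :
    deriv ((closureStrands z s R).pos (Sum.inr n)) t = 0 := by
  refine ((hasDerivAt_const t (((n : ℕ) : ℂ) + (R : ℂ) * Complex.I)).congr_of_eventuallyEq ?_).deriv
  filter_upwards [Icc_mem_nhds ht.1 ht.2] with u hu using closure_pos_inr z s R hu n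

/-- The imaginary part of a point of the braid is at most `C ≤ R / 2`, while that of the back is
`R`. -/
theorem norm_sub_back_ge {N : ℕ} {w : ℂ} {C R : ℝ} (hw : ‖w‖ ≤ C) (hR : 2 * (C + N) ≤ R)
    (n : Fin N) : R / 2 ≤ ‖w - (((n : ℕ) : ℂ) + (R : ℂ) * Complex.I)‖ := by
  have h1 : |(w - (((n : ℕ) : ℂ) + (R : ℂ) * Complex.I)).im| ≤ _ := Complex.abs_im_le_norm _
  have h2 := (abs_le.1 (Complex.abs_im_le_norm w)).2
  have h3 : (w - (((n : ℕ) : ℂ) + (R : ℂ) * Complex.I)).im = w.im - R := by simp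
  have h4 : (0 : ℝ) ≤ N := Nat.cast_nonneg N
  rw [h3] at h1
  have := neg_abs_le (w.im - R)
  linarith

/-- The constant `2 * C` comes from a velocity at most `C` over a distance at least `R / 2`. A chord
between two back strands contributes nothing since these do not move. -/
theorem norm_chordForm_middle {N : ℕ} {x y : UConf N} {γ : Path x y} {z : ℝ → Conf N}
    (hz : IsC1Lift γ z) (s : Equiv.Perm (Fin N)) {C R : ℝ} (hC1 : 1 ≤ C)
    (hC : ∀ t ∈ Icc (0 : ℝ) 1, (∀ i, ‖(z t).1 i‖ ≤ C) ∧
      (∀ i, ‖velocity z t i‖ ≤ C) ∧ ∀ P, ‖dlogDiff (z t).1 (velocity z t) P‖ ≤ C)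
    (hR : 2 * (C + N) ≤ R) {t : ℝ} (ht : t ∈ Ioo (0 : ℝ) 1) (P : Chord (Fin N ⊕ Fin N)) :
    ‖chordForm (closureStrands z s R) P t‖ ≤ 2 * C ∧
      ((∃ n, Sum.inr n ∈ P.1) → R * ‖chordForm (closureStrands z s R) P t‖ ≤ 2 * C) := by
  have ht' := Ioo_subset_Icc_self ht
  have hN : (0 : ℝ) ≤ N := Nat.cast_nonneg N
  have hR1 : 1 ≤ R := by linarith
  obtain ⟨hz1, hz2, hz3⟩ := hC t ht'
  have hback : ∀ {p : Prop} (x : ℝ), 0 ≤ x → R * x ≤ 2 * C →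
      x ≤ 2 * C ∧ (p → R * x ≤ 2 * C) := fun x hx h =>
    ⟨le_trans (le_mul_of_one_le_left hx hR1) h, fun _ => h⟩
  have hmixed : ∀ (i n : Fin N) (h : ¬ (s(Sum.inl i, Sum.inr n) : Sym2 (Fin N ⊕ Fin N)).IsDiag),
      R * ‖chordForm (closureStrands z s R) ⟨s(Sum.inl i, Sum.inr n), h⟩ t‖ ≤ 2 * C := by
    intro i n h
    refine (mul_le_mul_of_nonneg_left (norm_chordForm_le _ _ _ h t) (by linarith)).trans ?_
    rw [deriv_closure_inl hz s R ht, deriv_closure_inr z s R ht, closure_pos_inl z s R ht',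
      closure_pos_inr z s R ht', sub_zero, norm_div]
    have h1 := norm_sub_back_ge (hz1 i) hR n
    calc R * (‖velocity z t i‖ / ‖(z t).1 i - (((n : ℕ) : ℂ) + (R : ℂ) * Complex.I)‖)
        ≤ R * (C / (R / 2)) := by gcongr; exact hz2 i
      _ = 2 * C := by field_simp
  induction P using Chord.ind with
  | _ i j h =>
    rcases i with i | i <;> rcases j with j | j
    · refine ⟨?_, ?_⟩
      · refine (norm_chordForm_le _ _ _ h t).trans ?_
        rw [deriv_closure_inl hz s R ht, deriv_closure_inl hz s R ht, closure_pos_inl z s R ht',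
          closure_pos_inl z s R ht']
        have := hz3 ⟨s(i, j), fun e => h (by simpa using e)⟩
        simp only [dlogDiff, Sym2.lift_mk] at this
        linarith
      · rintro ⟨n, hn⟩
        simp at hn
    · exact hback _ (norm_nonneg _) (hmixed i j h)
    · have e : (⟨s(Sum.inr i, Sum.inl j), h⟩ : Chord (Fin N ⊕ Fin N)) =
          ⟨s(Sum.inl j, Sum.inr i), by rwa [Sym2.eq_swap]⟩ := Subtype.ext Sym2.eq_swap
      rw [e]
      exact hback _ (norm_nonneg _) (hmixed j i _)
    · refine hback _ (norm_nonneg _) ?_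
      have h0 := norm_chordForm_le (closureStrands z s R) _ _ h t
      rw [deriv_closure_inr z s R ht, deriv_closure_inr z s R ht, sub_zero, zero_div,
        norm_zero] at h0
      rw [le_antisymm h0 (norm_nonneg _), mul_zero]
      linarith

/-! ### Domination of the integrals -/

/-- An integrable function that dominates the factors of the integrals of degree `m`. -/
noncomputable def gapWeight (m : ℕ) : ℝ → ℝ :=
  (Ioo (-1 : ℝ) 2).indicator fun t => (bottomGap t * topGap t) ^ (-1 + 1 / (8 * m) : ℝ)

theorem measurable_gap : Measurable fun t => bottomGap t * topGap t := by
  unfold bottomGap topGap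
  fun_prop

theorem integrable_gapWeight {m : ℕ} (hm : 0 < m) : Integrable (gapWeight m) := by
  set r : ℝ := -1 + 1 / (8 * m) with hr
  have hm' : (1 : ℝ) ≤ m := by exact_mod_cast hm
  have hr1 : -1 < r := by
    have : (0 : ℝ) < 1 / (8 * m) := by positivity
    linarith
  have hr0 : r ≤ 0 := by
    have : 1 / (8 * m : ℝ) ≤ 1 := by rw [div_le_one (by positivity)]; linarith
    linarith
  refine IntegrableOn.integrable_indicator ?_ measurableSet_Ioo
  have h1 : IntegrableOn (fun t : ℝ => 1 + (1 + t) ^ r + (2 - t) ^ r) (Ioo (-1) 2) := by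
    have ha : IntervalIntegrable (fun t : ℝ => (1 + t) ^ r) volume (-1) 2 := by
      have := (intervalIntegral.intervalIntegrable_rpow' (a := 0) (b := 3) hr1).comp_add_left 1
      norm_num at this
      exact this
    have hb : IntervalIntegrable (fun t : ℝ => (2 - t) ^ r) volume (-1) 2 := by
      have := (intervalIntegral.intervalIntegrable_rpow' (a := 3) (b := 0) hr1).comp_sub_left 2
      norm_num at this
      exact this
    have := (((intervalIntegrable_const (c := (1 : ℝ))).add ha).add hb)
    rw [intervalIntegrable_iff_integrableOn_Ioo_of_le (by norm_num)] at this
    exact this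
  refine Integrable.mono' h1 (measurable_gap.pow_const r).aestronglyMeasurable ?_
  refine (ae_restrict_iff' measurableSet_Ioo).2 (Eventually.of_forall fun t ht => ?_)
  have hx : 0 < 1 + t := by linarith [ht.1]
  have hy : 0 < 2 - t := by linarith [ht.2]
  -- At every height at least one of the two gaps equals `1`, so a bound for one gap at a time is
  -- enough.
  have key : ∀ x : ℝ, 0 < x → (min 1 x) ^ r ≤ 1 + x ^ r := by
    intro x hx
    rcases le_total 1 x with h | h
    · rw [min_eq_left h, Real.one_rpow]
      exact le_add_of_nonneg_right (by positivity)
    · rw [min_eq_right h]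
      exact le_add_of_nonneg_left zero_le_one
  have hpx : 0 < (1 + t) ^ r := by positivity
  have hpy : 0 < (2 - t) ^ r := by positivity
  rw [Real.norm_of_nonneg (Real.rpow_nonneg
    (mul_pos (bottomGap_pos ht.1) (topGap_pos ht.2)).le _)]
  rcases le_total t 1 with h | h
  · rw [topGap_of_le h, mul_one]
    exact (key _ hx).trans (le_add_of_nonneg_right hpy.le)
  · rw [bottomGap_of_nonneg (by linarith), one_mul]
    exact (key _ hy).trans (by linarith)

theorem integrable_prod_gapWeight (m : ℕ) :
    Integrable fun T : Fin m → ℝ => ∏ k, gapWeight m (T k) :=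
  Integrable.fintype_prod fun k => integrable_gapWeight k.pos

/-- If the first factor is small at the bottom and the last factor is small at the top, the product
is dominated by an integrable function. -/
theorem prod_le_gapWeight {m : ℕ} {T : Fin m → ℝ} (hT : Monotone T)
    (hT' : ∀ k, T k ∈ Ioo (-1 : ℝ) 2) {a : Fin m → ℝ} (ha : ∀ k, 0 ≤ a k) {C M : ℝ} (hC : 0 ≤ C)
    (hM : 1 ≤ M) (h1 : ∀ k, a k ≤ C * (bottomGap (T k) * topGap (T k))⁻¹)
    (h2 : ∀ k : Fin m, (k : ℕ) = 0 → T k < 0 → a k ≤ C * (bottomGap (T k) * topGap (T k))⁻¹ *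
      (M * bottomGap (T k) ^ (1 / 8 : ℝ)))
    (h3 : ∀ k : Fin m, (k : ℕ) + 1 = m → 1 < T k → a k ≤ C * (bottomGap (T k) * topGap (T k))⁻¹ *
      (M * topGap (T k) ^ (1 / 8 : ℝ))) :
    ∏ k, a k ≤ C ^ m * M ^ 2 * ∏ k, gapWeight m (T k) := by
  -- Without chords there is neither a first nor a last factor; the products are empty and only `M ≥
  -- 1` is needed.
  rcases m with _ | n
  · simp only [Finset.univ_eq_empty, Finset.prod_empty, pow_zero, one_mul, mul_one]
    exact one_le_pow₀ hM
  have hb : ∀ k, 0 < bottomGap (T k) := fun k => bottomGap_pos (hT' k).1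
  have ht : ∀ k, 0 < topGap (T k) := fun k => topGap_pos (hT' k).2
  -- `F` and `G` record the gains of the first and the last factor. Away from the relevant end they
  -- are at least `1`, so they may be inserted everywhere; a single chord may carry both.
  set F : Fin (n + 1) → ℝ := fun k => if k = 0 then M * bottomGap (T k) ^ (1 / 8 : ℝ) else 1
  set G : Fin (n + 1) → ℝ := fun k => if k = Fin.last n then M * topGap (T k) ^ (1 / 8 : ℝ) else 1
  have hF : ∀ k, 0 ≤ T k → 1 ≤ F k := by
    intro k hk
    simp only [F, bottomGap_of_nonneg hk]
    split_ifs <;> simp [hM]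
  have hG : ∀ k, T k ≤ 1 → 1 ≤ G k := by
    intro k hk
    simp only [G, topGap_of_le hk]
    split_ifs <;> simp [hM]
  have hF1 : ∀ k, k ≠ 0 → F k = 1 := fun k hk => if_neg hk
  have hG1 : ∀ k, k ≠ Fin.last n → G k = 1 := fun k hk => if_neg hk
  have hstep : ∀ k, a k ≤ C * (bottomGap (T k) * topGap (T k))⁻¹ * (F k * G k) := by
    intro k
    have hc : 0 ≤ C * (bottomGap (T k) * topGap (T k))⁻¹ :=
      mul_nonneg hC (inv_nonneg.2 (mul_pos (hb k) (ht k)).le)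
    by_cases hk : k = 0 ∧ T k < 0
    · refine (h2 k (by simp [hk.1]) hk.2).trans (mul_le_mul_of_nonneg_left ?_ hc)
      have : F k = M * bottomGap (T k) ^ (1 / 8 : ℝ) := if_pos hk.1
      rw [← this]
      have hF0 : 0 ≤ F k := by
        rw [this]
        have := hb k
        positivity
      exact le_mul_of_one_le_right hF0 (hG k (by linarith [hk.2]))
    have hFk : 1 ≤ F k := by
      by_cases h0 : k = 0
      · exact hF k (not_lt.1 fun h => hk ⟨h0, h⟩)
      · exact (hF1 k h0).ge
    by_cases hk' : k = Fin.last n ∧ 1 < T k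
    · refine (h3 k (by simp [hk'.1]) hk'.2).trans (mul_le_mul_of_nonneg_left ?_ hc)
      have : G k = M * topGap (T k) ^ (1 / 8 : ℝ) := if_pos hk'.1
      rw [← this]
      have hG0 : 0 ≤ G k := by
        rw [this]
        have := ht k
        positivity
      exact le_mul_of_one_le_left hG0 hFk
    have hGk : 1 ≤ G k := by
      by_cases h0 : k = Fin.last n
      · exact hG k (not_lt.1 fun h => hk' ⟨h0, h⟩)
      · exact (hG1 k h0).ge
    exact (h1 k).trans (le_mul_of_one_le_right hc (one_le_mul_of_one_le_of_one_le hFk hGk))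
  have hprodF : ∏ k, F k = M * bottomGap (T 0) ^ (1 / 8 : ℝ) := by
    rw [Finset.prod_eq_single 0 (fun k _ hk => hF1 k hk) (by simp)]
    exact if_pos rfl
  have hprodG : ∏ k, G k = M * topGap (T (Fin.last n)) ^ (1 / 8 : ℝ) := by
    rw [Finset.prod_eq_single (Fin.last n) (fun k _ hk => hG1 k hk) (by simp)]
    exact if_pos rfl
  -- The share of the exponent `1/8` that falls to each of the `n + 1` chords.
  set δ : ℝ := 1 / (8 * (n + 1 : ℕ)) with hδ
  have hδ0 : 0 < δ := by positivity
  have hspread : ∀ {x : ℝ}, 0 < x → x ^ (1 / 8 : ℝ) = ∏ _k : Fin (n + 1), x ^ δ := by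
    intro x hx
    rw [Finset.prod_const, Finset.card_univ, Fintype.card_fin, ← Real.rpow_natCast,
      ← Real.rpow_mul hx.le]
    congr 1
    rw [hδ]
    field_simp
  -- The first chord is the lowest, so its gap to the minima is the smallest and its gain is at most
  -- the product of the shares of all the chords.
  have hB : bottomGap (T 0) ^ (1 / 8 : ℝ) ≤ ∏ k, bottomGap (T k) ^ δ := by
    rw [hspread (hb 0)]
    refine Finset.prod_le_prod (fun k _ => Real.rpow_nonneg (hb 0).le _) fun k _ => ?_
    exact Real.rpow_le_rpow (hb 0).le (bottomGap_mono (hT (Fin.zero_le k))) hδ0.le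
  have hTp : topGap (T (Fin.last n)) ^ (1 / 8 : ℝ) ≤ ∏ k, topGap (T k) ^ δ := by
    rw [hspread (ht _)]
    refine Finset.prod_le_prod (fun k _ => Real.rpow_nonneg (ht _).le _) fun k _ => ?_
    exact Real.rpow_le_rpow (ht _).le (topGap_anti (hT (Fin.le_last k))) hδ0.le
  have hw : ∀ k, gapWeight (n + 1) (T k) =
      (bottomGap (T k) * topGap (T k))⁻¹ * (bottomGap (T k) ^ δ * topGap (T k) ^ δ) := by
    intro k
    rw [gapWeight, indicator_of_mem (hT' k), Real.rpow_add (mul_pos (hb k) (ht k)),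
      Real.rpow_neg_one, Real.mul_rpow (hb k).le (ht k).le]
  have hI : 0 ≤ ∏ k, (bottomGap (T k) * topGap (T k))⁻¹ :=
    Finset.prod_nonneg fun k _ => inv_nonneg.2 (mul_pos (hb k) (ht k)).le
  calc ∏ k, a k ≤ ∏ k, (C * (bottomGap (T k) * topGap (T k))⁻¹ * (F k * G k)) :=
        Finset.prod_le_prod (fun k _ => ha k) fun k _ => hstep k
    _ = C ^ (n + 1) * M ^ 2 * ((∏ k, (bottomGap (T k) * topGap (T k))⁻¹) *
          (bottomGap (T 0) ^ (1 / 8 : ℝ) * topGap (T (Fin.last n)) ^ (1 / 8 : ℝ))) := by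
        simp only [Finset.prod_mul_distrib, hprodF, hprodG, Finset.prod_const, Finset.card_univ,
          Fintype.card_fin]
        ring
    _ ≤ C ^ (n + 1) * M ^ 2 * ((∏ k, (bottomGap (T k) * topGap (T k))⁻¹) *
          ((∏ k, bottomGap (T k) ^ δ) * ∏ k, topGap (T k) ^ δ)) := by
        have hb0 := hb 0
        have ht0 := ht (Fin.last n)
        gcongr
        exact Finset.prod_nonneg fun k _ => Real.rpow_nonneg (hb k).le _
    _ = _ := by simp only [hw, Finset.prod_mul_distrib]

theorem chordForm_eq_zero {ι : Type} (S : Strands ι) (P : Chord ι) {t lo hi : ℝ}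
    (hlo : ∀ j, S.lo j = lo) (hhi : ∀ j, S.hi j = hi) (ht : t ∉ Ioo lo hi) :
    chordForm S P t = 0 := by
  induction P using Chord.ind with
  | _ i j h =>
    refine if_neg fun h' => ht ?_
    have := h' i (Sym2.mem_mk_left i j)
    rwa [hlo, hhi] at this

theorem gapWeight_nonneg (m : ℕ) (t : ℝ) : 0 ≤ gapWeight m t := by
  refine indicator_nonneg (fun t ht => Real.rpow_nonneg ?_ _) t
  exact (mul_pos (bottomGap_pos ht.1) (topGap_pos ht.2)).le

/-- The weights `c` allow one proof for two estimates: all equal to `1` for convergence, and equal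
to `R` at one long chord for the decay. They must be `1` near the extrema, where nothing can be
spared. The square of `R ^ (1/4)` accounts for one gain at each end. -/
theorem norm_pairingForm_le {N : ℕ} {S : Strands (Fin N ⊕ Fin N)} (hlo : ∀ j, S.lo j = -1)
    (hhi : ∀ j, S.hi j = 2) {s : Equiv.Perm (Fin N)} {R K : ℝ} (hR : 1 ≤ R) (hK : 1 ≤ K) {m : ℕ}
    {T : Fin m → ℝ} (hT : StrictMono T) (P : Fin m → Chord (Fin N ⊕ Fin N)) {c : Fin m → ℝ}
    (hc : ∀ k, 0 ≤ c k)
    (hbot : ∀ k : Fin m, T k < 0 → c k = 1 ∧ chordForm S (P k) (T k) = chordForm (closingStrands s R) (P k) (T k))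
    (htop : ∀ k, 1 < T k → c k = 1 ∧ chordForm S (P k) (T k) = chordForm (closingStrands s R) (P k) (T k))
    (hmid : ∀ k, T k ∈ Icc (0 : ℝ) 1 → c k * ‖chordForm S (P k) (T k)‖ ≤ K)
    (hfirst : ∀ k : Fin m, (k : ℕ) = 0 → T k < 0 → ∀ n, (P k).1 ≠ s(Sum.inl n, Sum.inr n))
    (hlast : ∀ k : Fin m, (k : ℕ) + 1 = m → 1 < T k → ∀ n, (P k).1 ≠ s(Sum.inl n, Sum.inr (s n))) :
    (∏ k, c k) * ‖pairingForm S P T‖ ≤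
      K ^ m * (R ^ (1 / 4 : ℝ)) ^ 2 * ∏ k, gapWeight m (T k) := by
  have hR0 : 0 < R := by linarith
  by_cases hT' : ∀ k, T k ∈ Ioo (-1 : ℝ) 2
  swap
  · push Not at hT'
    obtain ⟨k, hk⟩ := hT'
    have h0 : pairingForm S P T = 0 :=
      Finset.prod_eq_zero (Finset.mem_univ k) (chordForm_eq_zero S _ hlo hhi hk)
    rw [h0, norm_zero, mul_zero]
    have : 0 ≤ ∏ k, gapWeight m (T k) := Finset.prod_nonneg fun k _ => gapWeight_nonneg m _
    positivity
  rw [pairingForm, norm_prod, ← Finset.prod_mul_distrib]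
  have hgap : ∀ k, 0 ≤ (bottomGap (T k) * topGap (T k))⁻¹ := fun k =>
    inv_nonneg.2 (mul_pos (bottomGap_pos (hT' k).1) (topGap_pos (hT' k).2)).le
  have hKle : ∀ {x : ℝ}, 0 ≤ x → x ≤ K * x := fun hx => le_mul_of_one_le_left hx hK
  refine prod_le_gapWeight hT.monotone hT' (fun k => mul_nonneg (hc k) (norm_nonneg _))
    (by linarith) (Real.one_le_rpow hR (by norm_num)) (fun k => ?_) (fun k hk h => ?_)
    fun k hk h => ?_
  · rcases lt_or_ge (T k) 0 with h | h
    · rw [(hbot k h).1, (hbot k h).2, one_mul]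
      exact (norm_chordForm_bottom s hR0 ⟨(hT' k).1, h⟩ (P k)).1.trans (hKle (hgap k))
    rcases lt_or_ge 1 (T k) with h' | h'
    · rw [(htop k h').1, (htop k h').2, one_mul]
      exact (norm_chordForm_top s hR0 ⟨h', (hT' k).2⟩ (P k)).1.trans (hKle (hgap k))
    · rw [bottomGap_of_nonneg h, topGap_of_le h', mul_one, inv_one, mul_one]
      exact hmid k ⟨h, h'⟩
  · rw [(hbot k h).1, (hbot k h).2, one_mul]
    refine ((norm_chordForm_bottom s hR0 ⟨(hT' k).1, h⟩ (P k)).2 (hfirst k hk h)).trans ?_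
    rw [mul_assoc]
    have := bottomGap_pos (hT' k).1
    exact hKle (mul_nonneg (hgap k) (by positivity))
  · rw [(htop k h).1, (htop k h).2, one_mul]
    refine ((norm_chordForm_top s hR0 ⟨h, (hT' k).2⟩ (P k)).2 (hlast k hk h)).trans ?_
    rw [mul_assoc]
    have := topGap_pos (hT' k).2
    exact hKle (mul_nonneg (hgap k) (by positivity))

/-! ### Measurability -/

theorem measurable_chordForm {ι : Type} {S : Strands ι} (hS : ∀ j, Measurable (S.pos j))
    (P : Chord ι) : Measurable (chordForm S P) := by
  classical
  induction P using Chord.ind with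
  | _ i j h =>
    have h1 : MeasurableSet {t | ∀ s ∈ s(i, j), S.lo s < t ∧ t < S.hi s} := by
      have : {t | ∀ s ∈ s(i, j), S.lo s < t ∧ t < S.hi s} =
          Ioo (S.lo i) (S.hi i) ∩ Ioo (S.lo j) (S.hi j) := by
        ext t; simp
      rw [this]
      exact measurableSet_Ioo.inter measurableSet_Ioo
    unfold chordForm
    refine Measurable.ite h1 (Measurable.const_mul ?_ _) measurable_const
    exact ((measurable_deriv _).sub (measurable_deriv _)).div ((hS i).sub (hS j))

theorem measurable_pairingForm {ι : Type} {S : Strands ι} (hS : ∀ j, Measurable (S.pos j)) {m : ℕ}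
    (P : Fin m → Chord ι) : Measurable (pairingForm S P) :=
  Finset.measurable_prod _ fun k _ => (measurable_chordForm hS (P k)).comp (measurable_pi_apply k)

theorem measurable_closing_pos {N : ℕ} (s : Equiv.Perm (Fin N)) (R : ℝ) (j : Fin N ⊕ Fin N) :
    Measurable ((closingStrands s R).pos j) := by
  have hr : Measurable (arcRadius R) := by unfold arcRadius; fun_prop
  rcases j with i | n
  · refine (Measurable.ite measurableSet_Iio measurable_const measurable_const).add
      ((Complex.measurable_ofReal.comp (hr.const_sub _)).mul_const _)
  · exact ((Complex.measurable_ofReal.comp (hr.const_add _)).mul_const _).const_add _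

theorem measurable_closure_pos {N : ℕ} {x y : UConf N} {γ : Path x y} {z : ℝ → Conf N}
    (hz : IsC1Lift γ z) (s : Equiv.Perm (Fin N)) (R : ℝ) (j : Fin N ⊕ Fin N) :
    Measurable ((closureStrands z s R).pos j) := by
  classical
  rcases j with i | n
  -- The lift is controlled on the unit interval only, so it is replaced by its constant extension,
  -- which is continuous.
  · have h1 : Measurable fun t => (z (projIcc (0 : ℝ) 1 zero_le_one t)).1 i :=
      ((continuousOn_lift hz i).comp_continuous (continuous_subtype_val.comp continuous_projIcc)
        fun t => (projIcc (0 : ℝ) 1 zero_le_one t).2).measurable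
    have h2 : (closureStrands z s R).pos (Sum.inl i) = fun t => if t ∈ Icc (0 : ℝ) 1 then
        (z (projIcc (0 : ℝ) 1 zero_le_one t)).1 i else (closingStrands s R).pos (Sum.inl i) t := by
      funext t
      by_cases ht : t ∈ Icc (0 : ℝ) 1
      · rw [closure_pos_inl z s R ht, if_pos ht, projIcc_of_mem _ ht]
      · rw [if_neg ht]
        exact if_neg ht
    rw [h2]
    exact Measurable.ite measurableSet_Icc h1 (measurable_closing_pos s R _)
  · exact measurable_closing_pos s R (Sum.inr n)

/-! ### Convergence -/

theorem closure_injective {N : ℕ} {z : ℝ → Conf N} (s : Equiv.Perm (Fin N)) {C R : ℝ} (hC1 : 1 ≤ C)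
    (hC : ∀ t ∈ Icc (0 : ℝ) 1, ∀ i, ‖(z t).1 i‖ ≤ C) (hR : 2 * (C + N) ≤ R) {t : ℝ}
    (ht : t ∈ Ioo (-1 : ℝ) 2) : Function.Injective fun j => (closureStrands z s R).pos j t := by
  have hN : (0 : ℝ) ≤ N := Nat.cast_nonneg N
  have hR0 : 0 < R := by linarith
  have hne : ∀ i n : Fin N, (closureStrands z s R).pos (Sum.inl i) t ≠
      (closureStrands z s R).pos (Sum.inr n) t := by
    intro i n e
    by_cases h : t ∈ Icc (0 : ℝ) 1
    · rw [closure_pos_inl z s R h, closure_pos_inr z s R h] at e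
      have h1 := norm_sub_back_ge (hC t h i) hR n
      rw [e, sub_self, norm_zero] at h1
      linarith
    · rw [show (closureStrands z s R).pos (Sum.inl i) t =
        (closingStrands s R).pos (Sum.inl i) t from if_neg h] at e
      have him := congrArg Complex.im e
      have hpos : 0 < arcRadius R t := by
        have : 0 < min 1 (min (1 + t) (2 - t)) :=
          lt_min one_pos (lt_min (by linarith [ht.1]) (by linarith [ht.2]))
        unfold arcRadius
        positivity
      have h3 : (if t < 0 then ((i : ℕ) : ℂ) else ((s i : ℕ) : ℂ)).im = 0 := by split_ifs <;> simp
      simp [closureStrands, closingStrands, h3] at him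
      linarith
  intro j j' e
  rcases j with i | i <;> rcases j' with i' | i'
  · by_cases h : t ∈ Icc (0 : ℝ) 1
    · simp only [closure_pos_inl z s R h] at e
      rw [(z t).2 e]
    · have h0 : ∀ i, (closureStrands z s R).pos (Sum.inl i) t =
        (closingStrands s R).pos (Sum.inl i) t := fun i => if_neg h
      simp only [h0, closingStrands, add_left_inj] at e
      split_ifs at e
      · rw [Fin.ext (Nat.cast_injective e)]
      · rw [s.injective (Fin.ext (Nat.cast_injective e))]
  · exact (hne _ _ e).elim
  · exact (hne _ _ e.symm).elim
  · simp only [closureStrands, closingStrands, add_left_inj] at e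
    rw [Fin.ext (Nat.cast_injective e)]

/-- A nonzero diagram excludes exactly the lowest and highest chords for which the gain would fail.
In the second bound the factor `R` on the left is absorbed by one long chord. -/
theorem norm_pairingForm_closure_le {N : ℕ} {x y : UConf N} {γ : Path x y} {z : ℝ → Conf N}
    (hz : IsC1Lift γ z) (s : Equiv.Perm (Fin N)) {C R : ℝ} (hC1 : 1 ≤ C)
    (hC : ∀ t ∈ Icc (0 : ℝ) 1, (∀ i, ‖(z t).1 i‖ ≤ C) ∧
      (∀ i, ‖velocity z t i‖ ≤ C) ∧ ∀ P, ‖dlogDiff (z t).1 (velocity z t) P‖ ≤ C)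
    (hR : 2 * (C + N) ≤ R) {m : ℕ} (P : Fin m → Chord (Fin N ⊕ Fin N))
    (hP : linkDiagram (closureStrands z s R) (closureNext s) P ≠ 0) {T : Fin m → ℝ}
    (hT : StrictMono T) (h0 : ∀ k, T k ≠ 0) (h1 : ∀ k, T k ≠ 1) :
    ‖pairingForm (closureStrands z s R) P T‖ ≤
        (2 * C) ^ m * (R ^ (1 / 4 : ℝ)) ^ 2 * ∏ k, gapWeight m (T k) ∧
      ((∃ k, T k ∈ Ioo (0 : ℝ) 1 ∧ ∃ n, Sum.inr n ∈ (P k).1) →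
        R * ‖pairingForm (closureStrands z s R) P T‖ ≤
          (2 * C) ^ m * (R ^ (1 / 4 : ℝ)) ^ 2 * ∏ k, gapWeight m (T k)) := by
  classical
  have hN : (0 : ℝ) ≤ N := Nat.cast_nonneg N
  have hR1 : 1 ≤ R := by linarith
  have hIoo : ∀ k, T k ∈ Icc (0 : ℝ) 1 → T k ∈ Ioo (0 : ℝ) 1 := fun k hk =>
    ⟨lt_of_le_of_ne hk.1 (h0 k).symm, lt_of_le_of_ne hk.2 (h1 k)⟩
  have hbot : ∀ k, T k < 0 → chordForm (closureStrands z s R) (P k) (T k) =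
      chordForm (closingStrands s R) (P k) (T k) := fun k hk =>
    chordForm_closure_eq_closing z s R (fun h => hk.not_ge h.1) _
  have htop : ∀ k, 1 < T k → chordForm (closureStrands z s R) (P k) (T k) =
      chordForm (closingStrands s R) (P k) (T k) := fun k hk =>
    chordForm_closure_eq_closing z s R (fun h => hk.not_ge h.2) _
  have hfirst : ∀ k : Fin m, (k : ℕ) = 0 → T k < 0 → ∀ n, (P k).1 ≠ s(Sum.inl n, Sum.inr n) :=
    fun k hk _ n hn => hP (linkDiagram_eq_zero_of_first _ rfl s P k hk n hn)
  have hlast : ∀ k : Fin m, (k : ℕ) + 1 = m → 1 < T k →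
      ∀ n, (P k).1 ≠ s(Sum.inl n, Sum.inr (s n)) :=
    fun k hk _ n hn => hP (linkDiagram_eq_zero_of_last _ rfl s P k hk n hn)
  constructor
  · have key := norm_pairingForm_le (S := closureStrands z s R) (fun _ => rfl) (fun _ => rfl) hR1
      (show 1 ≤ 2 * C by linarith) hT P (c := fun _ => 1) (fun _ => zero_le_one)
      (fun k hk => ⟨rfl, hbot k hk⟩) (fun k hk => ⟨rfl, htop k hk⟩)
      (fun k hk => by
        rw [one_mul]
        exact (norm_chordForm_middle hz s hC1 hC hR (hIoo k hk) (P k)).1) hfirst hlast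
    simpa using key
  · rintro ⟨k₀, hk₀, hn⟩
    have key := norm_pairingForm_le (S := closureStrands z s R) (fun _ => rfl) (fun _ => rfl) hR1
      (show 1 ≤ 2 * C by linarith) hT P (c := fun k => if k = k₀ then R else 1)
      (fun k => by split_ifs <;> linarith)
      (fun k hk => ⟨if_neg fun e => (e ▸ hk).not_gt hk₀.1, hbot k hk⟩)
      (fun k hk => ⟨if_neg fun e => (e ▸ hk).not_gt hk₀.2, htop k hk⟩)
      (fun k hk => by
        have := norm_chordForm_middle hz s hC1 hC hR (hIoo k hk) (P k)
        split_ifs with e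
        · exact this.2 (e ▸ hn)
        · rw [one_mul]
          exact this.1) hfirst hlast
    simpa using key

theorem ae_ne_zero_one (m : ℕ) : ∀ᵐ T : Fin m → ℝ, (∀ k, T k ≠ 0) ∧ ∀ k, T k ≠ 1 := by
  filter_upwards [ae_apply (ae_ne 0), ae_apply (ae_ne 1)] with T h0 h1 using ⟨h0, h1⟩

theorem kontsevichConverges_closure {N : ℕ} {x y : UConf N} {γ : Path x y} {z : ℝ → Conf N}
    (hz : IsC1Lift γ z) (s : Equiv.Perm (Fin N)) {C R : ℝ} (hC1 : 1 ≤ C)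
    (hC : ∀ t ∈ Icc (0 : ℝ) 1, (∀ i, ‖(z t).1 i‖ ≤ C) ∧
      (∀ i, ‖velocity z t i‖ ≤ C) ∧ ∀ P, ‖dlogDiff (z t).1 (velocity z t) P‖ ≤ C)
    (hR : 2 * (C + N) ≤ R) (m : ℕ) :
    KontsevichConverges (closureStrands z s R) (closureNext s) m := by
  intro P hP
  refine Integrable.mono' (((integrable_prod_gapWeight m).const_mul
    ((2 * C) ^ m * (R ^ (1 / 4 : ℝ)) ^ 2)).integrableOn)
    (measurable_pairingForm (measurable_closure_pos hz s R) P).aestronglyMeasurable ?_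
  refine (ae_restrict_iff' (measurableSet_strictMono m)).2 ?_
  filter_upwards [ae_ne_zero_one m] with T h hT
  exact (norm_pairingForm_closure_le hz s hC1 hC hR P hP hT h.1 h.2).1

/-- On either end portion the conditions on the middle and on the opposite end are vacuous, so the
general bound applies with `K = 1`. -/
theorem closingConverges {N : ℕ} (s : Equiv.Perm (Fin N)) {R : ℝ} (hR : 1 ≤ R) :
    ClosingConverges s R := by
  have hmeas : ∀ {m : ℕ} (a b : ℝ),
      MeasurableSet ({T : Fin m → ℝ | StrictMono T} ∩ {T | ∀ k, T k ∈ Ioo a b}) := by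
    intro m a b
    refine (measurableSet_strictMono m).inter ?_
    have : {T : Fin m → ℝ | ∀ k, T k ∈ Ioo a b} = ⋂ k, (fun T => T k) ⁻¹' Ioo a b := by ext; simp
    rw [this]
    exact MeasurableSet.iInter fun k => measurableSet_Ioo.preimage (measurable_pi_apply k)
  intro a b k Q Q' h
  constructor
  · refine Integrable.mono' (((integrable_prod_gapWeight b).const_mul
      ((1 : ℝ) ^ b * (R ^ (1 / 4 : ℝ)) ^ 2)).integrableOn)
      (measurable_pairingForm (measurable_closing_pos s R) Q).aestronglyMeasurable ?_
    refine (ae_restrict_iff' (hmeas _ _)).2 (Eventually.of_forall fun T hT => ?_)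
    have key := norm_pairingForm_le (S := closingStrands s R) (s := s) (fun _ => rfl) (fun _ => rfl)
      hR le_rfl hT.1 Q (c := fun _ => 1) (fun _ => zero_le_one) (fun k hk => ⟨rfl, rfl⟩)
      (fun k hk => ⟨rfl, rfl⟩) (fun k hk => absurd hk.1 (hT.2 k).2.not_ge)
      (fun j hj _ n hn => h (graftMap_eq_zero_of_first s Q Q' rfl j hj n hn))
      (fun j hj hj' => absurd hj' (not_lt.2 (by linarith [(hT.2 j).2])))
    simpa using key
  · refine Integrable.mono' (((integrable_prod_gapWeight a).const_mul
      ((1 : ℝ) ^ a * (R ^ (1 / 4 : ℝ)) ^ 2)).integrableOn)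
      (measurable_pairingForm (measurable_closing_pos s R) Q').aestronglyMeasurable ?_
    refine (ae_restrict_iff' (hmeas _ _)).2 (Eventually.of_forall fun T hT => ?_)
    have key := norm_pairingForm_le (S := closingStrands s R) (s := s) (fun _ => rfl) (fun _ => rfl)
      hR le_rfl hT.1 Q' (c := fun _ => 1) (fun _ => zero_le_one) (fun k hk => ⟨rfl, rfl⟩)
      (fun k hk => ⟨rfl, rfl⟩) (fun k hk => absurd hk.2 (hT.2 k).1.not_ge)
      (fun j hj hj' => absurd hj' (not_lt.2 (by linarith [(hT.2 j).1])))
      (fun j hj _ n hn => h (graftMap_eq_zero_of_last s Q Q' rfl j hj n hn))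
    simpa using key

/-! ### The long chords -/

theorem measurableSet_longHeights {m : ℕ} (p : Fin m → Prop) :
    MeasurableSet {T : Fin m → ℝ | ∃ k, T k ∈ Ioo (0 : ℝ) 1 ∧ p k} := by
  have : {T : Fin m → ℝ | ∃ k, T k ∈ Ioo (0 : ℝ) 1 ∧ p k} =
      ⋃ k, ⋃ _ : p k, (fun T => T k) ⁻¹' Ioo 0 1 := by
    ext T
    simp only [mem_ofPred_eq, mem_iUnion, mem_preimage, exists_prop]
    exact exists_congr fun k => and_comm
  rw [this]
  exact MeasurableSet.iUnion fun k => MeasurableSet.iUnion fun _ =>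
    measurableSet_Ioo.preimage (measurable_pi_apply k)

/-- The integrand times `R` is bounded by `R ^ (1/2)` times a fixed integrable function, so the
integral is `O(R ^ (-1/2))`. -/
theorem tendsto_longIntegral {N : ℕ} {x y : UConf N} {γ : Path x y} {z : ℝ → Conf N}
    (hz : IsC1Lift γ z) (s : Equiv.Perm (Fin N)) {m : ℕ} (P : Fin m → Chord (Fin N ⊕ Fin N))
    (hP : closeMap (closureNext s) m (chordDiagram ∅ m (strandWord Sum.isLeft P)) ≠ 0) :
    Tendsto (fun R => pairingIntegral (closureStrands z s R) P
      {T | ∃ k, T k ∈ Ioo (0 : ℝ) 1 ∧ ∃ n, Sum.inr n ∈ (P k).1}) atTop (𝓝 0) := by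
  obtain ⟨C, hC1, hC⟩ := hz.exists_bound
  set I := ∫ T : Fin m → ℝ, ∏ k, gapWeight m (T k)
  have hbound : ∀ᶠ R : ℝ in atTop, ‖pairingIntegral (closureStrands z s R) P
      {T | ∃ k, T k ∈ Ioo (0 : ℝ) 1 ∧ ∃ n, Sum.inr n ∈ (P k).1}‖ ≤
      (2 * C) ^ m * I * R ^ (-(1 / 2) : ℝ) := by
    filter_upwards [eventually_ge_atTop (2 * (C + N)), eventually_ge_atTop 1] with R hR hR1
    have hR0 : 0 < R := by linarith
    set A := (2 * C) ^ m * R ^ (-(1 / 2) : ℝ)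
    have hA : (2 * C) ^ m * (R ^ (1 / 4 : ℝ)) ^ 2 = R * A := by
      have h1 : (R ^ (1 / 4 : ℝ)) ^ 2 = R ^ (1 / 2 : ℝ) := by
        rw [← Real.rpow_natCast, ← Real.rpow_mul hR0.le]; norm_num
      have h2 : R * R ^ (-(1 / 2) : ℝ) = R ^ (1 / 2 : ℝ) := by
        nth_rewrite 1 [← Real.rpow_one R]
        rw [← Real.rpow_add hR0]; norm_num
      rw [h1, ← h2]
      ring
    have hmeas := (measurableSet_strictMono m).inter
      (measurableSet_longHeights fun k => ∃ n : Fin N, Sum.inr n ∈ (P k).1)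
    have hint : Integrable fun T : Fin m → ℝ => A * ∏ k, gapWeight m (T k) :=
      (integrable_prod_gapWeight m).const_mul A
    have hnn : ∀ T : Fin m → ℝ, 0 ≤ A * ∏ k, gapWeight m (T k) := fun T =>
      mul_nonneg (by positivity) (Finset.prod_nonneg fun k _ => gapWeight_nonneg m _)
    calc _ ≤ ∫ T in {T : Fin m → ℝ | StrictMono T} ∩ {T | ∃ k, T k ∈ Ioo (0 : ℝ) 1 ∧
          ∃ n, Sum.inr n ∈ (P k).1}, A * ∏ k, gapWeight m (T k) := by
          refine norm_integral_le_of_norm_le hint.integrableOn ((ae_restrict_iff' hmeas).2 ?_)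
          filter_upwards [ae_ne_zero_one m] with T h hT
          have := (norm_pairingForm_closure_le hz s hC1 hC hR P hP hT.1 h.1 h.2).2 hT.2
          rw [hA, mul_assoc] at this
          exact le_of_mul_le_mul_left this hR0
      _ ≤ ∫ T : Fin m → ℝ, A * ∏ k, gapWeight m (T k) :=
          setIntegral_le_integral hint (Eventually.of_forall hnn)
      _ = _ := by
          rw [integral_const_mul]
          ring
  refine squeeze_zero_norm' hbound ?_
  have := (tendsto_rpow_neg_atTop (show (0 : ℝ) < 1 / 2 by norm_num)).const_mul ((2 * C) ^ m * I)
  rwa [mul_zero] at this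

/-- The diagrams depend on the orientations of the strands and not on `R`. This leaves a finite sum
of coefficients tending to zero, those of vanishing diagrams being discarded beforehand. -/
theorem tendsto_longPart {N : ℕ} {x y : UConf N} {γ : Path x y} {z : ℝ → Conf N}
    (hz : IsC1Lift γ z) (s : Equiv.Perm (Fin N)) (m : ℕ)
    (W : ChordSpace (univ : Set (Cycles (closureNext s))) m →ₗ[ℂ] ℂ) :
    Tendsto (fun R : ℝ => W (longPart z s R m)) atTop (𝓝 0) := by
  simp only [longPart, kontsevichPart, map_smul, map_sum, smul_eq_mul]
  have key : ∀ P : Fin m → Chord (Fin N ⊕ Fin N), Tendsto (fun R : ℝ =>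
      pairingIntegral (closureStrands z s R) P
        {T | ∃ k, T k ∈ Ioo (0 : ℝ) 1 ∧ ∃ n, Sum.inr n ∈ (P k).1} *
      W (linkDiagram (closureStrands z s R) (closureNext s) P)) atTop (𝓝 0) := by
    intro P
    by_cases hP : closeMap (closureNext s) m (chordDiagram ∅ m (strandWord Sum.isLeft P)) = 0
    · have : ∀ R, linkDiagram (closureStrands z s R) (closureNext s) P = 0 := fun R => hP
      simp [this]
    · have h := (tendsto_longIntegral hz s P hP).mul_const
        (W (closeMap (closureNext s) m (chordDiagram ∅ m (strandWord Sum.isLeft P))))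
      rw [zero_mul] at h
      exact h
  have h := (tendsto_finsetSum Finset.univ fun P _ => key P).const_mul
    (((2 * Real.pi * Complex.I) ^ m)⁻¹)
  rw [Finset.sum_const_zero, mul_zero] at h
  exact h

/-! ### Cutting the heights at the ends of the braid -/

/-- The first `b`, the next `k` and the last `a` indices. -/
def blockEquiv {b k a m : ℕ} (h : k + (b + a) = m) : Fin b ⊕ (Fin k ⊕ Fin a) ≃ Fin m :=
  ((Equiv.sumCongr (Equiv.refl _) finSumFinEquiv).trans finSumFinEquiv).trans
    (finCongr (show b + (k + a) = m by omega))

theorem blockEquiv_inl {b k a m : ℕ} (h : k + (b + a) = m) (j : Fin b) :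
    (blockEquiv h (Sum.inl j) : ℕ) = j := by
  simp [blockEquiv]

theorem blockEquiv_inr_inl {b k a m : ℕ} (h : k + (b + a) = m) (j : Fin k) :
    (blockEquiv h (Sum.inr (Sum.inl j)) : ℕ) = b + j := by
  simp [blockEquiv]

theorem blockEquiv_inr_inr {b k a m : ℕ} (h : k + (b + a) = m) (j : Fin a) :
    (blockEquiv h (Sum.inr (Sum.inr j)) : ℕ) = b + (k + j) := by
  simp [blockEquiv]

/-- Fubini for a product of functions of separate variables; it holds without integrability because
of the convention that a divergent integral is zero. -/
theorem integral_sum_mul {ι κ : Type} [Fintype ι] [Fintype κ] (F : (ι → ℝ) → ℂ) (G : (κ → ℝ) → ℂ) :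
    ∫ T : ι ⊕ κ → ℝ, F (fun i => T (Sum.inl i)) * G (fun j => T (Sum.inr j)) =
      (∫ T, F T) * ∫ T, G T := by
  rw [← integral_prod_mul]
  exact (volume_measurePreserving_sumPiEquivProdPi (fun _ : ι ⊕ κ => ℝ)).integral_comp
    (MeasurableEquiv.measurableEmbedding _) fun p => F p.1 * G p.2

theorem integral_block_mul {b k a m : ℕ} (h : k + (b + a) = m) (F : (Fin b → ℝ) → ℂ)
    (G : (Fin k → ℝ) → ℂ) (H : (Fin a → ℝ) → ℂ) :
    ∫ T : Fin m → ℝ, F (fun j => T (blockEquiv h (Sum.inl j))) *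
      (G (fun j => T (blockEquiv h (Sum.inr (Sum.inl j)))) *
        H (fun j => T (blockEquiv h (Sum.inr (Sum.inr j))))) =
      (∫ T, F T) * ((∫ T, G T) * ∫ T, H T) := by
  rw [← integral_sum_mul G H, ← integral_sum_mul F]
  rw [← (volume_measurePreserving_piCongrLeft (fun _ : Fin m => ℝ) (blockEquiv h)).integral_comp
    (MeasurableEquiv.measurableEmbedding _)]
  have : ∀ (T : Fin b ⊕ (Fin k ⊕ Fin a) → ℝ) x,
      MeasurableEquiv.piCongrLeft (fun _ : Fin m => ℝ) (blockEquiv h) T (blockEquiv h x) = T x :=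
    fun T x => Equiv.piCongrLeft_apply_apply (fun _ : Fin m => ℝ) (blockEquiv h) T x
  simp only [this]

/-- The heights of which the first `b` are near the minima, the next `k` are those of points of the
braid, and the other ones are near the maxima. -/
def heightRegion (b k m : ℕ) : Set (Fin m → ℝ) :=
  {T | ∀ i : Fin m, T i ∈ if (i : ℕ) < b then Ioo (-1 : ℝ) 0 else
    if (i : ℕ) < b + k then Ioo (0 : ℝ) 1 else Ioo (1 : ℝ) 2}

theorem measurableSet_forall_mem {m : ℕ} {B : Fin m → Set ℝ} (hB : ∀ k, MeasurableSet (B k)) :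
    MeasurableSet {T : Fin m → ℝ | ∀ k, T k ∈ B k} := by
  have : {T : Fin m → ℝ | ∀ k, T k ∈ B k} = ⋂ k, (fun T => T k) ⁻¹' B k := by ext; simp
  rw [this]
  exact MeasurableSet.iInter fun k => (hB k).preimage (measurable_pi_apply k)

theorem measurableSet_heightRegion (b k m : ℕ) : MeasurableSet (heightRegion b k m) :=
  measurableSet_forall_mem fun i => by split_ifs <;> exact measurableSet_Ioo

theorem mem_heightRegion_iff {b k a m : ℕ} (h : k + (b + a) = m) (T : Fin m → ℝ) :
    T ∈ heightRegion b k m ↔ (∀ j, T (blockEquiv h (Sum.inl j)) ∈ Ioo (-1 : ℝ) 0) ∧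
      (∀ j, T (blockEquiv h (Sum.inr (Sum.inl j))) ∈ Ioo (0 : ℝ) 1) ∧
        ∀ j, T (blockEquiv h (Sum.inr (Sum.inr j))) ∈ Ioo (1 : ℝ) 2 := by
  have h1 : T ∈ heightRegion b k m ↔ ∀ x, T (blockEquiv h x) ∈
      if (blockEquiv h x : ℕ) < b then Ioo (-1 : ℝ) 0 else
        if (blockEquiv h x : ℕ) < b + k then Ioo (0 : ℝ) 1 else Ioo (1 : ℝ) 2 :=
    ⟨fun hT x => hT _, fun hT i => by
      have := hT ((blockEquiv h).symm i)
      rwa [Equiv.apply_symm_apply] at this⟩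
  rw [h1, Sum.forall, Sum.forall]
  refine and_congr (forall_congr' fun j => ?_) (and_congr (forall_congr' fun j => ?_)
    (forall_congr' fun j => ?_))
  · rw [blockEquiv_inl, if_pos j.2]
  · rw [blockEquiv_inr_inl, if_neg (by omega), if_pos (by omega)]
  · rw [blockEquiv_inr_inr, if_neg (by omega), if_neg (by omega)]

theorem strictMono_block_iff {b k a m : ℕ} (h : k + (b + a) = m) {T : Fin m → ℝ}
    (hT : T ∈ heightRegion b k m) : StrictMono T ↔
      StrictMono (fun j => T (blockEquiv h (Sum.inl j))) ∧
      StrictMono (fun j => T (blockEquiv h (Sum.inr (Sum.inl j)))) ∧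
      StrictMono fun j => T (blockEquiv h (Sum.inr (Sum.inr j))) := by
  obtain ⟨h1, h2, h3⟩ := (mem_heightRegion_iff h T).1 hT
  constructor
  · intro hs
    refine ⟨fun i j hij => hs ?_, fun i j hij => hs ?_, fun i j hij => hs ?_⟩
    · rwa [Fin.lt_def, blockEquiv_inl, blockEquiv_inl]
    · rw [Fin.lt_def, blockEquiv_inr_inl, blockEquiv_inr_inl]; omega
    · rw [Fin.lt_def, blockEquiv_inr_inr, blockEquiv_inr_inr]; omega
  · rintro ⟨s1, s2, s3⟩ i j hij
    obtain ⟨x, rfl⟩ := (blockEquiv h).surjective i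
    obtain ⟨y, rfl⟩ := (blockEquiv h).surjective j
    rw [Fin.lt_def] at hij
    rcases x with x | x | x <;> rcases y with y | y | y <;>
      simp only [blockEquiv_inl, blockEquiv_inr_inl, blockEquiv_inr_inr] at hij
    · exact s1 hij
    · exact (h1 x).2.trans (h2 y).1
    · exact ((h1 x).2.trans one_pos).trans (h3 y).1
    · omega
    · exact s2 (Fin.lt_def.2 (by omega))
    · exact (h2 x).2.trans (h3 y).1
    · omega
    · omega
    · exact s3 (Fin.lt_def.2 (by omega))

/-- For increasing heights, the indices with height below a given level form an initial segment; its
length is a block size. -/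
theorem exists_threshold {m : ℕ} (p : Fin m → Prop) (hp : ∀ i j, i ≤ j → p j → p i) :
    ∃ b ≤ m, ∀ i : Fin m, (i : ℕ) < b ↔ p i := by
  classical
  have hex : ∃ b : ℕ, ∀ i : Fin m, b ≤ (i : ℕ) → ¬ p i := ⟨m, fun i hi => absurd i.2 hi.not_gt⟩
  refine ⟨Nat.find hex, Nat.find_min' hex fun i hi => absurd i.2 hi.not_gt, fun i => ⟨fun hi => ?_,
    fun hi => not_le.1 fun h => Nat.find_spec hex i h hi⟩⟩
  by_contra hn
  exact Nat.find_min hex hi fun j hj hpj => hn (hp i j hj hpj)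

theorem threshold_unique {m b b' : ℕ} {p : Fin m → Prop} (hb : b ≤ m) (hb' : b' ≤ m)
    (h : ∀ i : Fin m, (i : ℕ) < b ↔ p i) (h' : ∀ i : Fin m, (i : ℕ) < b' ↔ p i) : b = b' := by
  rcases lt_trichotomy b b' with hlt | he | hlt
  · exact absurd ((h ⟨b, by omega⟩).2 ((h' ⟨b, by omega⟩).1 hlt)) (lt_irrefl b)
  · exact he
  · exact absurd ((h' ⟨b', by omega⟩).2 ((h ⟨b', by omega⟩).1 hlt)) (lt_irrefl b')

theorem heightRegion_threshold {b k m : ℕ} {T : Fin m → ℝ} (hT : T ∈ heightRegion b k m)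
    (i : Fin m) : ((i : ℕ) < b ↔ T i < 0) ∧ ((i : ℕ) < b + k ↔ T i < 1) := by
  have := hT i
  split_ifs at this with h1 h2
  · exact ⟨iff_of_true h1 this.2, iff_of_true (by omega) (this.2.trans one_pos)⟩
  · exact ⟨iff_of_false h1 this.1.not_gt, iff_of_true h2 this.2⟩
  · exact ⟨iff_of_false h1 (one_pos.trans this.1).not_gt, iff_of_false h2 this.1.not_gt⟩

/-- `q` is the pair of numbers of chords near the minima and near the maxima; the number on the
braid is what remains of `m`. Both are read off from the thresholds at heights `0` and `1`. -/
theorem existsUnique_heightRegion {m : ℕ} {T : Fin m → ℝ} (hT : StrictMono T)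
    (hT' : ∀ k, T k ∈ Ioo (-1 : ℝ) 2) (h0 : ∀ k, T k ≠ 0) (h1 : ∀ k, T k ≠ 1) :
    ∃! q : {q : Fin (m + 1) × Fin (m + 1) // (q.1 : ℕ) + q.2 ≤ m},
      T ∈ heightRegion q.1.1 (m - (q.1.1 + q.1.2)) m := by
  obtain ⟨b, hbm, hb⟩ := exists_threshold (fun i => T i < 0) fun i j hij hj =>
    (hT.monotone hij).trans_lt hj
  obtain ⟨c, hcm, hc⟩ := exists_threshold (fun i => T i < 1) fun i j hij hj =>
    (hT.monotone hij).trans_lt hj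
  have hbc : b ≤ c := by
    by_contra hlt
    have h2 := (hb ⟨c, by omega⟩).1 (by simpa using hlt)
    exact absurd ((hc ⟨c, by omega⟩).2 (h2.trans one_pos)) (lt_irrefl c)
  have hk : b + (m - (b + (m - c))) = c := by omega
  refine ⟨⟨(⟨b, by omega⟩, ⟨m - c, by omega⟩), by simp only; omega⟩, fun i => ?_, fun q hq => ?_⟩
  · simp only [hk]
    split_ifs with hi hi'
    · exact ⟨(hT' i).1, (hb i).1 hi⟩
    · exact ⟨lt_of_le_of_ne (not_lt.1 fun h => hi ((hb i).2 h)) (h0 i).symm, (hc i).1 hi'⟩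
    · exact ⟨lt_of_le_of_ne (not_lt.1 fun h => hi' ((hc i).2 h)) (h1 i).symm, (hT' i).2⟩
  · obtain ⟨⟨q1, q2⟩, hq'⟩ := q
    simp only at hq hq'
    have e1 : b = q1 := threshold_unique hbm (by omega) hb fun i => (heightRegion_threshold hq i).1
    have e2 : c = q1 + (m - (q1 + q2)) :=
      threshold_unique hcm (by omega) hc fun i => (heightRegion_threshold hq i).2
    ext <;> simp only <;> omega

/-- Cutting an integral at the ends of the braid. -/
theorem setIntegral_eq_sum_heightRegion {m : ℕ} {A : Set (Fin m → ℝ)} (hA : MeasurableSet A)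
    (hA' : ∀ T ∈ A, StrictMono T) {f : (Fin m → ℝ) → ℂ} (hf : IntegrableOn f A)
    (hf0 : ∀ T, (∃ k, T k ∉ Ioo (-1 : ℝ) 2) → f T = 0) :
    ∫ T in A, f T = ∑ q : {q : Fin (m + 1) × Fin (m + 1) // (q.1 : ℕ) + q.2 ≤ m},
      ∫ T in A ∩ heightRegion q.1.1 (m - (q.1.1 + q.1.2)) m, f T := by
  have h1 : ∀ q : {q : Fin (m + 1) × Fin (m + 1) // (q.1 : ℕ) + q.2 ≤ m},
      ∫ T in A ∩ heightRegion q.1.1 (m - (q.1.1 + q.1.2)) m, f T =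
        ∫ T in A, (heightRegion q.1.1 (m - (q.1.1 + q.1.2)) m).indicator f T := fun q => by
    rw [setIntegral_indicator (measurableSet_heightRegion _ _ _)]
  simp only [h1]
  rw [← integral_finsetSum _ fun q _ => hf.indicator (measurableSet_heightRegion _ _ _)]
  refine integral_congr_ae ((ae_restrict_iff' hA).2 ?_)
  filter_upwards [ae_ne_zero_one m] with T h hT
  by_cases hT' : ∀ k, T k ∈ Ioo (-1 : ℝ) 2
  · obtain ⟨q, hq, huniq⟩ := existsUnique_heightRegion (hA' T hT) hT' h.1 h.2
    rw [Finset.sum_eq_single q, indicator_of_mem hq]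
    · exact fun q' _ hq' => indicator_of_notMem (fun h => hq' (huniq q' h)) _
    · simp
  · push Not at hT'
    rw [hf0 T hT']
    refine (Finset.sum_eq_zero fun q _ => ?_).symm
    by_cases hq : T ∈ heightRegion q.1.1 (m - (q.1.1 + q.1.2)) m
    · rw [indicator_of_mem hq, hf0 T hT']
    · exact indicator_of_notMem hq _

/-! ### The pairings without long chords -/

/-- A chord of the braid, as a chord of the closure. -/
def Chord.front {N : ℕ} (P : Chord (Fin N)) : Chord (Fin N ⊕ Fin N) :=
  ⟨Sym2.map Sum.inl P.1, fun h => P.2 ((Sym2.isDiag_map Sum.inl_injective).1 h)⟩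

theorem Chord.front_injective {N : ℕ} : Function.Injective (Chord.front (N := N)) := fun _ _ h =>
  Subtype.ext (Sym2.map.injective Sum.inl_injective (congrArg Subtype.val h))

theorem Chord.inl_mem_front {N : ℕ} (P : Chord (Fin N)) (i : Fin N) :
    Sum.inl i ∈ P.front.1 ↔ i ∈ P.1 := by
  simp [Chord.front, Sym2.mem_map]

theorem Chord.inr_notMem_front {N : ℕ} (P : Chord (Fin N)) (n : Fin N) :
    Sum.inr n ∉ P.front.1 := by
  simp [Chord.front, Sym2.mem_map]

theorem Chord.exists_front {N : ℕ} (P : Chord (Fin N ⊕ Fin N)) (h : ∀ n, Sum.inr n ∉ P.1) :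
    ∃ P', Chord.front P' = P := by
  induction P using Chord.ind with
  | _ i j hij =>
    rcases i with i | i
    · rcases j with j | j
      · exact ⟨⟨s(i, j), fun e => hij (by simpa using e)⟩, rfl⟩
      · exact (h j (Sym2.mem_mk_right _ _)).elim
    · exact (h i (Sym2.mem_mk_left _ _)).elim

/-- The chords `Q` near the minima, `P` on the braid, and `Q'` near the maxima. -/
def joinChords {N b k a m : ℕ} (h : k + (b + a) = m) (Q : Fin b → Chord (Fin N ⊕ Fin N))
    (P : Fin k → Chord (Fin N)) (Q' : Fin a → Chord (Fin N ⊕ Fin N)) :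
    Fin m → Chord (Fin N ⊕ Fin N) :=
  fun i => Sum.elim Q (Sum.elim (fun j => (P j).front) Q') ((blockEquiv h).symm i)

theorem joinChords_apply {N b k a m : ℕ} (h : k + (b + a) = m) (Q : Fin b → Chord (Fin N ⊕ Fin N))
    (P : Fin k → Chord (Fin N)) (Q' : Fin a → Chord (Fin N ⊕ Fin N)) (x) :
    joinChords h Q P Q' (blockEquiv h x) = Sum.elim Q (Sum.elim (fun j => (P j).front) Q') x := by
  rw [joinChords, Equiv.symm_apply_apply]

theorem chordForm_front {N : ℕ} {x y : UConf N} {γ : Path x y} {z : ℝ → Conf N}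
    (hz : IsC1Lift γ z) (s : Equiv.Perm (Fin N)) (R : ℝ) {t : ℝ} (ht : t ∈ Ioo (0 : ℝ) 1)
    (P : Chord (Fin N)) :
    chordForm (closureStrands z s R) P.front t = chordForm (braidStrands z) P t := by
  rw [chordForm_braidStrands hz, indicator_of_mem ht]
  induction P using Chord.ind with
  | _ i j h =>
    have h1 : ∀ u ∈ (Chord.front ⟨s(i, j), h⟩ : Chord (Fin N ⊕ Fin N)).1,
        (closureStrands z s R).lo u < t ∧ t < (closureStrands z s R).hi u :=
      fun u _ => ⟨show (-1 : ℝ) < t by linarith [ht.1], show t < (2 : ℝ) by linarith [ht.2]⟩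
    have hpos := closure_pos_inl z s R (Ioo_subset_Icc_self ht)
    have hsign : chordSign (closureStrands z s R).up (Chord.front ⟨s(i, j), h⟩) = 1 := by
      simp [Chord.front, chordSign, closureStrands, closingStrands]
    have hd := deriv_closure_inl hz s R ht
    rw [chordForm, if_pos h1, hsign, one_mul]
    change (deriv ((closureStrands z s R).pos (Sum.inl i)) t -
      deriv ((closureStrands z s R).pos (Sum.inl j)) t) /
      ((closureStrands z s R).pos (Sum.inl i) t - (closureStrands z s R).pos (Sum.inl j) t) =
      (velocity z t i - velocity z t j) / ((z t).1 i - (z t).1 j)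
    rw [hd, hd, hpos, hpos]

/-- When the blocks lie in disjoint consecutive intervals, being increasing is a condition on each
block separately. The domain and the integrand are then both products. -/
theorem pairingIntegral_join {N : ℕ} {x y : UConf N} {γ : Path x y} {z : ℝ → Conf N}
    (hz : IsC1Lift γ z) (s : Equiv.Perm (Fin N)) (R : ℝ) {b k a m : ℕ} (h : k + (b + a) = m)
    (Q : Fin b → Chord (Fin N ⊕ Fin N)) (P : Fin k → Chord (Fin N))
    (Q' : Fin a → Chord (Fin N ⊕ Fin N)) :
    ∫ T in {T | StrictMono T} ∩ heightRegion b k m,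
        pairingForm (closureStrands z s R) (joinChords h Q P Q') T =
      bottomIntegral s R Q * (pairingIntegral (braidStrands z) P univ * topIntegral s R Q') := by
  have hmid : pairingIntegral (braidStrands z) P univ =
      ∫ T in {T | StrictMono T} ∩ {T | ∀ k, T k ∈ Ioo (0 : ℝ) 1},
        pairingForm (braidStrands z) P T := by
    rw [pairingIntegral, inter_univ]
    unfold pairingForm
    rw [setIntegral_cube _ _ (measurableSet_strictMono k) _ measurableSet_Ioo]
    simp only [chordForm_braidStrands hz, indicator_indicator, inter_self]
  have hm : ∀ {n : ℕ} (u v : ℝ),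
      MeasurableSet ({T : Fin n → ℝ | StrictMono T} ∩ {T | ∀ k, T k ∈ Ioo u v}) := fun u v =>
    (measurableSet_strictMono _).inter (measurableSet_forall_mem fun _ => measurableSet_Ioo)
  rw [hmid, bottomIntegral, topIntegral, pairingIntegral, pairingIntegral,
    ← integral_indicator (hm _ _), ← integral_indicator (hm _ _), ← integral_indicator (hm _ _),
    ← integral_block_mul h,
    ← integral_indicator ((measurableSet_strictMono m).inter (measurableSet_heightRegion b k m))]
  congr 1
  funext T
  have hmem : T ∈ {T | StrictMono T} ∩ heightRegion b k m ↔
      ((fun j => T (blockEquiv h (Sum.inl j))) ∈ {T : Fin b → ℝ | StrictMono T} ∩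
        {T | ∀ k, T k ∈ Ioo (-1 : ℝ) 0}) ∧
      ((fun j => T (blockEquiv h (Sum.inr (Sum.inl j)))) ∈ {T : Fin k → ℝ | StrictMono T} ∩
        {T | ∀ k, T k ∈ Ioo (0 : ℝ) 1}) ∧
      ((fun j => T (blockEquiv h (Sum.inr (Sum.inr j)))) ∈ {T : Fin a → ℝ | StrictMono T} ∩
        {T | ∀ k, T k ∈ Ioo (1 : ℝ) 2}) := by
    constructor
    · rintro ⟨hs, hT⟩
      obtain ⟨h1, h2, h3⟩ := (mem_heightRegion_iff h T).1 hT
      obtain ⟨s1, s2, s3⟩ := (strictMono_block_iff h hT).1 hs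
      exact ⟨⟨s1, h1⟩, ⟨s2, h2⟩, ⟨s3, h3⟩⟩
    · rintro ⟨⟨s1, h1⟩, ⟨s2, h2⟩, ⟨s3, h3⟩⟩
      have hT := (mem_heightRegion_iff h T).2 ⟨h1, h2, h3⟩
      exact ⟨(strictMono_block_iff h hT).2 ⟨s1, s2, s3⟩, hT⟩
  by_cases m1 : (fun j => T (blockEquiv h (Sum.inl j))) ∈ {T : Fin b → ℝ | StrictMono T} ∩
      {T | ∀ k, T k ∈ Ioo (-1 : ℝ) 0}
  swap
  · rw [indicator_of_notMem fun h => m1 (hmem.1 h).1, indicator_of_notMem m1, zero_mul]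
  by_cases m2 : (fun j => T (blockEquiv h (Sum.inr (Sum.inl j)))) ∈ {T : Fin k → ℝ | StrictMono T} ∩
      {T | ∀ k, T k ∈ Ioo (0 : ℝ) 1}
  swap
  · rw [indicator_of_notMem fun h => m2 (hmem.1 h).2.1, indicator_of_notMem m2, zero_mul, mul_zero]
  by_cases m3 : (fun j => T (blockEquiv h (Sum.inr (Sum.inr j)))) ∈ {T : Fin a → ℝ | StrictMono T} ∩
      {T | ∀ k, T k ∈ Ioo (1 : ℝ) 2}
  swap
  · rw [indicator_of_notMem fun h => m3 (hmem.1 h).2.2, indicator_of_notMem m3, mul_zero, mul_zero]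
  rw [indicator_of_mem (hmem.2 ⟨m1, m2, m3⟩), indicator_of_mem m1, indicator_of_mem m2,
    indicator_of_mem m3]
  unfold pairingForm
  rw [← Equiv.prod_comp (blockEquiv h), Fintype.prod_sum_type, Fintype.prod_sum_type]
  simp only [joinChords_apply, Sum.elim_inl, Sum.elim_inr]
  congr 1
  · exact Finset.prod_congr rfl fun j _ =>
      chordForm_closure_eq_closing z s R (fun h => (m1.2 j).2.not_ge h.1) _
  congr 1
  · exact Finset.prod_congr rfl fun j _ => chordForm_front hz s R (m2.2 j) _
  · exact Finset.prod_congr rfl fun j _ =>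
      chordForm_closure_eq_closing z s R (fun h => (m3.2 j).1.not_ge h.2) _

/-! ### The diagrams of pairings without long chords -/

theorem finRange_block {b k a m : ℕ} (h : k + (b + a) = m) : List.finRange m =
    (List.finRange b).map (fun j => blockEquiv h (Sum.inl j)) ++
      ((List.finRange k).map (fun j => blockEquiv h (Sum.inr (Sum.inl j))) ++
        (List.finRange a).map fun j => blockEquiv h (Sum.inr (Sum.inr j))) := by
  refine List.map_injective_iff.2 Fin.val_injective ?_
  have hl : ∀ (n : ℕ) (f : ℕ → ℕ), (List.finRange n).map (fun j : Fin n => f j) = (List.range n).map f := by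
    intro n f
    rw [← List.map_coe_finRange_eq_range, List.map_map]
    rfl
  simp only [List.map_append, List.map_map, Function.comp_def, blockEquiv_inl, blockEquiv_inr_inl,
    blockEquiv_inr_inr]
  rw [hl b fun j => j, hl k fun j => b + j, hl a fun j => b + (k + j), hl m fun j => j]
  rw [show m = b + (k + a) by omega, List.range_add, List.range_add]
  simp [Function.comp_def]

/-- The relation on labels is stated for permutations of `ℕ`; an injective renaming of finitely many
labels extends to one. -/
theorem exists_perm_extending {m : ℕ} (f : Fin m → ℕ) (hf : Function.Injective f) :
    ∃ r : Equiv.Perm ℕ, ∀ i : Fin m, r i = f i := by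
  classical
  let e : {n : ℕ // n < m} ≃ {n : ℕ // n ∈ range f} :=
    Fin.equivSubtype.symm.trans (Equiv.ofInjective f hf)
  have : Finite ({n : ℕ | n < m} : Set ℕ) := (finite_lt_nat m).to_subtype
  exact ⟨e.extendSubtype, fun i => e.extendSubtype_apply_of_mem i i.2⟩

/-- The same diagram with its chords named in two ways: by height on the left, and by residues
modulo `3` with `0` for the braid, `1` for `Q` and `2` for `Q'` on the right. -/
theorem chordDiagram_join {N b k a m : ℕ} (h : k + (b + a) = m)
    (Q : Fin b → Chord (Fin N ⊕ Fin N)) (P : Fin k → Chord (Fin N))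
    (Q' : Fin a → Chord (Fin N ⊕ Fin N)) :
    chordDiagram ∅ m (strandWord Sum.isLeft (joinChords h Q P Q')) =
      chordDiagram ∅ m (glueWord (closurePieces Q Q') braidLabel (strandWord (fun _ => true) P)) := by
  classical
  set f : Fin m → ℕ := fun i => Sum.elim (fun j : Fin b => 3 * (j : ℕ) + 1)
    (Sum.elim (fun j : Fin k => 3 * (j : ℕ)) fun j : Fin a => 3 * (j : ℕ) + 2)
    ((blockEquiv h).symm i) with hfdef
  have hf : Function.Injective f := by
    refine Function.Injective.comp ?_ (blockEquiv h).symm.injective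
    rintro (x | x | x) (y | y | y) e <;> simp only [Sum.elim_inl, Sum.elim_inr] at e <;>
      first | omega | (congr 3; omega)
  obtain ⟨r, hr⟩ := exists_perm_extending f hf
  have hr' : ∀ x, r (blockEquiv h x : ℕ) = Sum.elim (fun j : Fin b => 3 * (j : ℕ) + 1)
      (Sum.elim (fun j : Fin k => 3 * (j : ℕ)) fun j : Fin a => 3 * (j : ℕ) + 2) x := by
    intro x
    rw [hr, hfdef]
    simp only [Equiv.symm_apply_apply]
  rw [chordDiagram_relabel ∅ m _ r]
  congr 1
  funext j
  rcases j with i | n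
  · rw [glueWord_closurePieces_inl]
    simp only [strandWord, Sum.isLeft_inl, if_true, finRange_block h, List.filter_append,
      List.map_append, List.filter_map, List.map_map, Function.comp_def, joinChords_apply, hr',
      Sum.elim_inl, Sum.elim_inr, Chord.inl_mem_front]
    congr!
  -- A descending leg is read from the top, so reversal puts `Q'` before `Q`; the braid has no foot
  -- on it.
  · rw [glueWord_closurePieces_inr]
    simp only [strandWord, Sum.isLeft_inr, Bool.false_eq_true, if_false, finRange_block h,
      List.filter_append, List.map_append, List.filter_map, List.map_map, Function.comp_def,
      joinChords_apply, hr', Sum.elim_inl, Sum.elim_inr, Chord.inr_notMem_front, decide_false,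
      List.filter_false, List.map_nil, List.nil_append, List.map_reverse, List.reverse_append]
    congr!

theorem graftMap_strandWord {N b k a m : ℕ} (S : Strands (Fin N ⊕ Fin N)) (hS : S.up = Sum.isLeft)
    (s : Equiv.Perm (Fin N)) (h : k + (b + a) = m)
    (Q : Fin b → Chord (Fin N ⊕ Fin N)) (P : Fin k → Chord (Fin N))
    (Q' : Fin a → Chord (Fin N ⊕ Fin N)) :
    graftMap s Q Q' h (chordDiagram ∅ k (strandWord (fun _ => true) P)) =
      linkDiagram S (closureNext s) (joinChords h Q P Q') := by
  rw [graftMap_chordDiagram, ← chordDiagram_join, linkDiagram, hS]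

/-! ### The Kontsevich integral of the closure -/

/-- The heights for which `P` has a foot in the back of the closure at the height of the braid. -/
def longHeights {N m : ℕ} (P : Fin m → Chord (Fin N ⊕ Fin N)) : Set (Fin m → ℝ) :=
  {T | ∃ k, T k ∈ Ioo (0 : ℝ) 1 ∧ ∃ n, Sum.inr n ∈ (P k).1}

theorem heightRegion_subset_compl_longHeights {N b k a m : ℕ} (h : k + (b + a) = m)
    (Q : Fin b → Chord (Fin N ⊕ Fin N)) (P : Fin k → Chord (Fin N))
    (Q' : Fin a → Chord (Fin N ⊕ Fin N)) :
    heightRegion b k m ⊆ (longHeights (joinChords h Q P Q'))ᶜ := by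
  rintro T hT ⟨i, hi, n, hn⟩
  obtain ⟨h1, h2, h3⟩ := (mem_heightRegion_iff h T).1 hT
  obtain ⟨x, rfl⟩ := (blockEquiv h).surjective i
  rcases x with x | x | x
  · exact absurd hi.1 (h1 x).2.not_gt
  · rw [joinChords_apply] at hn
    exact Chord.inr_notMem_front (P x) n hn
  · exact absurd hi.2 (h3 x).1.not_gt

theorem joinChords_injective {N b k a m : ℕ} (h : k + (b + a) = m) :
    Function.Injective fun p : (Fin b → Chord (Fin N ⊕ Fin N)) ×
      (Fin a → Chord (Fin N ⊕ Fin N)) × (Fin k → Chord (Fin N)) => joinChords h p.1 p.2.2 p.2.1 := by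
  rintro ⟨Q, Q', P⟩ ⟨Q₁, Q₁', P₁⟩ e
  have key : ∀ x, Sum.elim Q (Sum.elim (fun j => (P j).front) Q') x =
      Sum.elim Q₁ (Sum.elim (fun j => (P₁ j).front) Q₁') x := fun x => by
    have := congrFun e (blockEquiv h x)
    simpa only [joinChords_apply] using this
  have h1 : Q = Q₁ := funext fun j => key (Sum.inl j)
  have h2 : P = P₁ := funext fun j => Chord.front_injective (key (Sum.inr (Sum.inl j)))
  have h3 : Q' = Q₁' := funext fun j => key (Sum.inr (Sum.inr j))
  rw [h1, h2, h3]

/-- A middle chord that is not long has both feet on braid strands, hence comes from a chord of the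
braid. -/
theorem exists_joinChords {N b k a m : ℕ} (h : k + (b + a) = m)
    (P : Fin m → Chord (Fin N ⊕ Fin N)) {T : Fin m → ℝ} (hT : T ∈ heightRegion b k m)
    (hT' : T ∉ longHeights P) : P ∈ range fun p : (Fin b → Chord (Fin N ⊕ Fin N)) ×
      (Fin a → Chord (Fin N ⊕ Fin N)) × (Fin k → Chord (Fin N)) => joinChords h p.1 p.2.2 p.2.1 := by
  obtain ⟨h1, h2, h3⟩ := (mem_heightRegion_iff h T).1 hT
  choose P' hP' using fun j => Chord.exists_front (P (blockEquiv h (Sum.inr (Sum.inl j))))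
    fun n hn => hT' ⟨_, h2 j, n, hn⟩
  refine ⟨(fun j => P (blockEquiv h (Sum.inl j)), fun j => P (blockEquiv h (Sum.inr (Sum.inr j))),
    P'), funext fun i => ?_⟩
  obtain ⟨x, rfl⟩ := (blockEquiv h).surjective i
  simp only [joinChords_apply]
  rcases x with x | x | x
  · rfl
  · exact hP' x
  · rfl

/-- Pairings that are not joined from three blocks have an empty domain of integration once long
chords are excluded; the others are parametrized injectively by their blocks. -/
theorem sum_heightRegion_smul_linkDiagram {N : ℕ} {x y : UConf N} {γ : Path x y} {z : ℝ → Conf N}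
    (hz : IsC1Lift γ z) (s : Equiv.Perm (Fin N)) (R : ℝ) {b k a m : ℕ} (h : k + (b + a) = m) :
    ∑ P : Fin m → Chord (Fin N ⊕ Fin N),
      (∫ T in ({T | StrictMono T} ∩ (longHeights P)ᶜ) ∩ heightRegion b k m,
        pairingForm (closureStrands z s R) P T) •
          linkDiagram (closureStrands z s R) (closureNext s) P =
      ∑ Q : Fin b → Chord (Fin N ⊕ Fin N), ∑ Q' : Fin a → Chord (Fin N ⊕ Fin N),
        ∑ P : Fin k → Chord (Fin N),
          (bottomIntegral s R Q * (pairingIntegral (braidStrands z) P univ * topIntegral s R Q')) •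
            linkDiagram (closureStrands z s R) (closureNext s) (joinChords h Q P Q') := by
  simp only [← Fintype.sum_prod_type']
  refine (Fintype.sum_of_injective _ (joinChords_injective h) _ _ (fun P hP => ?_)
    fun p => ?_).symm
  · have : ({T | StrictMono T} ∩ (longHeights P)ᶜ) ∩ heightRegion b k m = ∅ :=
      eq_empty_of_forall_notMem fun T hT => hP (exists_joinChords h P hT.2 hT.1.2)
    rw [this, setIntegral_empty, zero_smul]
  · rw [inter_assoc, inter_eq_right.2 (heightRegion_subset_compl_longHeights h _ _ _),
      pairingIntegral_join hz]

theorem graftMap_liftedHolonomy {N : ℕ} {x y : UConf N} {γ : Path x y} {z : ℝ → Conf N}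
    (hz : IsC1Lift γ z) (s : Equiv.Perm (Fin N)) (R : ℝ) {b k a m : ℕ} (h : k + (b + a) = m)
    (Q : Fin b → Chord (Fin N ⊕ Fin N)) (Q' : Fin a → Chord (Fin N ⊕ Fin N)) :
    graftMap s Q Q' h (liftedHolonomy z k) = ((2 * Real.pi * Complex.I) ^ k)⁻¹ •
      ∑ P : Fin k → Chord (Fin N), pairingIntegral (braidStrands z) P univ •
        linkDiagram (closureStrands z s R) (closureNext s) (joinChords h Q P Q') := by
  rw [liftedHolonomy, map_sum, Finset.smul_sum]
  refine Finset.sum_congr rfl fun P _ => ?_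
  rw [map_smul, graftMap_strandWord (closureStrands z s R) rfl, kzIterated_eq_pairingIntegral hz,
    mul_smul]

/-- The factors `(2πi)⁻¹` of the `b + a` grafted chords and of the remaining chords on the braid
combine into the power `m`. -/
theorem closeGraft_liftedHolonomy {N : ℕ} {x y : UConf N} {γ : Path x y} {z : ℝ → Conf N}
    (hz : IsC1Lift γ z) (s : Equiv.Perm (Fin N)) (R : ℝ) (m : ℕ) :
    closeGraft s R (liftedHolonomy z) m = ((2 * Real.pi * Complex.I) ^ m)⁻¹ •
      ∑ q : {q : Fin (m + 1) × Fin (m + 1) // (q.1 : ℕ) + q.2 ≤ m},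
        ∑ P : Fin m → Chord (Fin N ⊕ Fin N),
          (∫ T in ({T | StrictMono T} ∩ (longHeights P)ᶜ) ∩
            heightRegion q.1.1 (m - (q.1.1 + q.1.2)) m,
              pairingForm (closureStrands z s R) P T) •
            linkDiagram (closureStrands z s R) (closureNext s) P := by
  rw [closeGraft, Finset.smul_sum]
  refine Finset.sum_congr rfl fun q _ => ?_
  rw [sum_heightRegion_smul_linkDiagram hz s R (Nat.sub_add_cancel q.2)]
  have hpow : ((2 * Real.pi * Complex.I) ^ m)⁻¹ =
      ((2 * Real.pi * Complex.I) ^ ((q.1.1 : ℕ) + q.1.2))⁻¹ *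
        ((2 * Real.pi * Complex.I) ^ (m - (q.1.1 + q.1.2)))⁻¹ := by
    rw [← mul_inv, ← pow_add, Nat.add_sub_cancel' q.2]
  rw [hpow, mul_smul]
  congr 1
  simp only [Finset.smul_sum]
  refine Finset.sum_congr rfl fun Q _ => Finset.sum_congr rfl fun Q' _ => ?_
  rw [graftMap_liftedHolonomy hz s R, Finset.smul_sum, Finset.smul_sum]
  refine Finset.sum_congr rfl fun P _ => ?_
  simp only [smul_smul]
  congr 1
  ring

/-- Pairings with vanishing diagram are dropped first, since their integrals may diverge. For the
others convergence permits splitting the domain into long and non-long heights, and the latter into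
height regions. -/
theorem kontsevichLink_closure {N : ℕ} {x y : UConf N} {γ : Path x y} {z : ℝ → Conf N}
    (hz : IsC1Lift γ z) (s : Equiv.Perm (Fin N)) (R : ℝ) (m : ℕ)
    (hconv : KontsevichConverges (closureStrands z s R) (closureNext s) m) :
    kontsevichLink (closureStrands z s R) (closureNext s) m =
      closeGraft s R (liftedHolonomy z) m + longPart z s R m := by
  rw [closeGraft_liftedHolonomy hz, longPart, kontsevichLink, kontsevichPart, kontsevichPart,
    ← smul_add, Finset.sum_comm, ← Finset.sum_add_distrib]
  congr 1
  refine Finset.sum_congr rfl fun P _ => ?_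
  rw [← Finset.sum_smul, ← add_smul]
  by_cases hP : linkDiagram (closureStrands z s R) (closureNext s) P = 0
  · rw [hP, smul_zero, smul_zero]
  congr 1
  have hL : MeasurableSet (longHeights P) :=
    measurableSet_longHeights fun k => ∃ n, Sum.inr n ∈ (P k).1
  have hint := hconv P hP
  rw [← setIntegral_eq_sum_heightRegion ((measurableSet_strictMono m).inter hL.compl)
    (fun T hT => hT.1) (hint.mono_set inter_subset_left), pairingIntegral, inter_univ,
    pairingIntegral]
  · rw [add_comm]
    exact (integral_inter_add_sdiff hL hint).symm
  · rintro T ⟨k, hk⟩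
    exact Finset.prod_eq_zero (Finset.mem_univ k)
      (chordForm_eq_zero _ _ (fun _ => rfl) (fun _ => rfl) hk)

theorem mainTheorem1 {N : ℕ} {x : UConf N} (γ : Path x x) (z : ℝ → Conf N) (hz : IsC1Lift γ z)
    (s : Equiv.Perm (Fin N)) (hs : ∀ i, (z 1).1 i = (z 0).1 (s i)) :
    -- parallel transport along `γ` exists, is unique, and is multiplication by `exp (∫_I ω(γ))`
    (∀ ψ₀ : ChordSeries N, ∃ Ψ : unitInterval → ChordBundle N,
      (∀ t, (Ψ t).proj = γ t) ∧ IsHorizontal γ Ψ ∧ Ψ 0 = ⟦(z 0, ψ₀)⟧ ∧ Ψ 1 = ⟦(z 1, kzExp z * ψ₀)⟧ ∧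
      ∀ Φ : unitInterval → ChordBundle N, IsHorizontal γ Φ → Φ 0 = Ψ 0 → Φ = Ψ) ∧
    -- the expansion of the holonomy as iterated integrals over simplices
    (∀ (m : ℕ) (d : Chord (Fin N) →₀ ℕ), d.degree = m →
      MvPowerSeries.coeff d (kzExp z) =
        ∑ P : Fin m → Chord (Fin N), kzIterated z P *
          MvPowerSeries.coeff d (∏ k, (MvPowerSeries.X (P k) : ChordSeries N))) ∧
    -- lifted to the braid, it is the Kontsevich integral of the braid
    (∀ m, liftedHolonomy z m = kontsevichTangle (braidStrands z) m) ∧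
    -- closing the braid strands directly
    (∀ m, closeMap s m (liftedHolonomy z m) = kontsevichLink (braidStrands z) s m) ∧
    -- the closure as a Morse link
    ((∀ n, (z 0).1 n = ((n : ℕ) : ℂ)) → ∀ m,
      (∀ᶠ R : ℝ in atTop,
        (∀ t ∈ Ioo (-1 : ℝ) 2, Function.Injective fun j => (closureStrands z s R).pos j t) ∧
        KontsevichConverges (closureStrands z s R) (closureNext s) m ∧
        ClosingConverges s R ∧
        kontsevichLink (closureStrands z s R) (closureNext s) m =
          closeGraft s R (liftedHolonomy z) m + longPart z s R m) ∧
      ∀ W : ChordSpace (univ : Set (Cycles (closureNext s))) m →ₗ[ℂ] ℂ,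
        Tendsto (fun R : ℝ => W (longPart z s R m)) atTop (𝓝 0)) := by
  refine ⟨fun ψ₀ => holonomy_eq_kzExp γ z hz ψ₀, fun m d hd => coeff_kzExp hz m d hd,
    liftedHolonomy_eq_kontsevichTangle hz, closeMap_liftedHolonomy hz s,
    fun _ m => ⟨?_, tendsto_longPart hz s m⟩⟩
  obtain ⟨C, hC1, hC⟩ := hz.exists_bound
  -- `C` bounds the positions, velocities and forms of the braid, and `2 * (C + N) ≤ R` keeps the
  -- back at distance at least `R / 2` from it.
  filter_upwards [eventually_ge_atTop (2 * (C + N)), eventually_ge_atTop 1] with R hR hR1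
  have hconv := kontsevichConverges_closure hz s hC1 hC hR m
  exact ⟨fun t ht => closure_injective s hC1 (fun t ht => (hC t ht).1) hR ht, hconv,
    closingConverges s hR1, kontsevichLink_closure hz s R m hconv⟩
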